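/- Let $N\ge 1$, $Q=(0,1)^N$. For $s\in[0,1)$ and a vector field $v\in C_c^\infty(Q;\mathbb R^N)$ put $$\operatorname{div}^s v:=\Big[\big(1-\tfrac1N\big)s+\tfrac1N\Big]\sum_{i=1}^N\partial^s_{i,R}v_i,\qquad d^s_Rw(x)=-\frac1{\Gamma(1-s)}\frac{d}{dx}\int_x^1\frac{w(t)}{(t-x)^s}\,dt ,$$ where $\partial^s_{i,R}$ is $d^s_R$ acting in the variable $x_i$ (so $d_R^0w=w$). For $k\in\mathbb N_0$, $\operatorname{div}^k$ is the $k$-fold divergence. For $p\in[1,\infty]$, $|\cdot|^*_{\ell^p}$ is the norm dual to the entrywise $\ell^p$ norm. For $r=\lfloor r\rfloor+s\ge0$ with $s\in[0,1)$ and $u\in L^1(Q)$ let $$TV^r_{\ell^p}(u):=\sup\Big\{\int_Q u\,\operatorname{div}^s[\operatorname{div}^{\lfloor r\rfloor}\varphi]\,dx:\ \varphi\in C_c^\infty(Q;\mathbb R^{N^{\lfloor r\rfloor+1}}),\ |\varphi|^*_{\ell^p}\le1\Big\}\in[0,\infty],$$ and for $k\in\mathbb N_0$ let $$\overline{TV}{}^k_{\ell^p}(u):=\sup\Big\{\int_Q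 u\,\operatorname{div}^{k}\varphi\,dx:\ \varphi\in C_c^\infty(Q;\mathbb R^{N^{k}}),\ |\varphi|^*_{\ell^p}\le1\Big\}$$ be the classical total variation of order $k$ (the $L^1$ norm if $k=0$); put $\overline{TV}{}^r_{\ell^p}:=TV^r_{\ell^p}$ if $r$ is not an integer. Let $BV^r(Q)$ be the set of $u\in L^1(Q)$ with $TV^r_{\ell^p}(u)<\infty$ for all $p\in[1,\infty]$, and $BV(Q)$ the classical space of functions of bounded variation. Let $SV^r(Q)$ be the set of $u\in L^1(Q)$ such that for every $p\in[1,\infty]$ we have $TV^r_{\ell^p}(u)<\infty$ and there are $v_j\in C^\infty(Q)\cap L^1(Q)$ with $TV^r_{\ell^p}(v_j)<\infty$, $v_j\to u$ in $L^1(Q)$ and $TV^r_{\ell^p}(v_j)\to TV^r_{\ell^p}(u)$. For $u\in BV(Q)$ let $T[u]$ be its trace on $\partial Q$. Let $r_n>0$ with $r_n\to r\ge0$, let $p_n\in[1,\infty]$ with $p_n\to p\in[1,\infty]$, let $u_n\in L^1(Q)$, and suppose that for some $q\in(1,\infty]$ $$\sup_n\big\{\|u_n\|_{L^q(Q)}+TV^{r_n}_{\ell^{m_n}}(u_n)\big\}<\infty,$$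 where the exponents $m_n\in[1,\infty]$ are arbitrary (for instance $m_n=2$ or $m_n=p_n$). Then there are $u\in BV^r(Q)\cap L^q(Q)$ and a subsequence $(u_{n_j})$ with the following properties. 1. $u_{n_j}\rightharpoonup u$ weakly in $L^q(Q)$ (weakly-$*$ if $q=\infty$), and $$\liminf_{n\to\infty}TV^{r_n}_{\ell^{p_n}}(u_n)\ \ge\ TV^r_{\ell^p}(u).$$ If moreover $N=1$, or $p=1$, or $r$ is not an integer, or $r_n\le r$ for all large $n$, then also $\liminf_{n\to\infty}\overline{TV}{}^{r_n}_{\ell^{p_n}}(u_n)\ge\overline{TV}{}^r_{\ell^p}(u)$. 2. If in addition $r>0$, $u_n\in BV(Q)\cap SV^{r_n}(Q)$ for all $n$, and $\sup_n\|T[u_n]\|_{L^\infty(\partial Q)}<\infty$ (in particular if $u_n\in IM(Q)\cap SV^{r_n}(Q)$, where $IM(Q)=\{u\in BV(Q):\|T[u]\|_{L^\infty(\partial Q)}\le1\}$), then $u_{n_j}\to u$ strongly in $L^1(Q)$. -/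

import Mathlib

open MeasureTheory Filter Topology Set
open scoped ENNReal ContDiff

noncomputable section

namespace FracTV

/-- The open unit cube `Q = (0,1)^N`. -/
def Q (N : ℕ) : Set (Fin N → ℝ) := Set.pi Set.univ (fun _ => Set.Ioo (0 : ℝ) 1)

/-- Lebesgue measure on the cube. -/
abbrev μQ (N : ℕ) : Measure (Fin N → ℝ) := volume.restrict (Q N)

/-- `f ∈ C_c^∞(Q)`. -/
def IsTest {N : ℕ} (f : (Fin N → ℝ) → ℝ) : Prop :=
  ContDiff ℝ ∞ f ∧ HasCompactSupport f ∧ tsupport f ⊆ Q N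

/-- `|y|^*_{ℓ^p} ≤ 1`, where `|·|^*_{ℓ^p}` is the norm dual to the `ℓ^p` norm on `ℝ^ι`
(entrywise for tensors). -/
def DualNormLeOne {ι : Type} [Fintype ι] (p : ℝ≥0∞) (y : ι → ℝ) : Prop :=
  ∀ x : ι → ℝ, ‖WithLp.toLp p x‖ ≤ 1 → ∑ j, x j * y j ≤ 1

/-- Right-sided Riemann-Liouville derivative on `(0,1)` of order `s ∈ [0,1)`:
`-(1/Γ(1-s)) d/dx ∫_x^1 w(t) (t-x)^{-s} dt`. -/
def rlRight (s : ℝ) (w : ℝ → ℝ) (x : ℝ) : ℝ :=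
  -(1 / Real.Gamma (1 - s)) * deriv (fun y => ∫ t in y..1, w t / (t - y) ^ s) x

/-- The fractional partial derivative `∂^s_{i,R}`. -/
def fracPartial {N : ℕ} (s : ℝ) (i : Fin N) (f : (Fin N → ℝ) → ℝ) (x : Fin N → ℝ) : ℝ :=
  rlRight s (fun t => f (Function.update x i t)) (x i)

/-- The partial derivative `∂_i`. -/
def partialD {N : ℕ} (i : Fin N) (f : (Fin N → ℝ) → ℝ) (x : Fin N → ℝ) : ℝ :=
  fderiv ℝ f x (Pi.single i 1)

/-- The iterated divergence `div^k` of a tensor field with `N^k` entries: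
`div^{k+1} ψ = ∑_i ∂_i (div^k ψ_i)`, where `ψ_i` is the `i`-th row. -/
def iterDiv {N : ℕ} : (k : ℕ) → ((Fin k → Fin N) → (Fin N → ℝ) → ℝ) → (Fin N → ℝ) → ℝ
  | 0, ψ => ψ Fin.elim0
  | k + 1, ψ => fun x => ∑ i, partialD i (iterDiv k (fun J => ψ (Fin.cons i J))) x

/-- The scaled fractional divergence
`div^s v = [(1 - 1/N) s + 1/N] ∑_i ∂^s_{i,R} v_i` of a vector field. -/
def fracDiv {N : ℕ} (s : ℝ) (v : Fin N → (Fin N → ℝ) → ℝ) (x : Fin N → ℝ) : ℝ :=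
  ((1 - 1 / (N : ℝ)) * s + 1 / (N : ℝ)) * ∑ i, fracPartial s i (v i) x

/-- `div^s [div^k φ]` for a tensor field with `N^{k+1}` entries. -/
def fracIterDiv {N : ℕ} (s : ℝ) (k : ℕ) (φ : (Fin (k + 1) → Fin N) → (Fin N → ℝ) → ℝ) :
    (Fin N → ℝ) → ℝ :=
  fracDiv s (fun i => iterDiv k (fun J => φ (Fin.cons i J)))

/-- Admissible test tensor fields with `N^m` entries: `φ ∈ C_c^∞(Q)`, `|φ|^*_{ℓ^p} ≤ 1`. -/
def Admissible {N : ℕ} (p : ℝ≥0∞) (m : ℕ) (φ : (Fin m → Fin N) → (Fin N → ℝ) → ℝ) : Prop :=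
  (∀ J, IsTest (φ J)) ∧ ∀ x, DualNormLeOne p (fun J => φ J x)

/-- The classical total variation `TV^k_{ℓ^p}(u)` of integer order `k`. -/
def intTV {N : ℕ} (p : ℝ≥0∞) (k : ℕ) (u : (Fin N → ℝ) → ℝ) : ℝ≥0∞ :=
  ⨆ (φ : (Fin k → Fin N) → (Fin N → ℝ) → ℝ) (_ : Admissible p k φ),
    ENNReal.ofReal (∫ x in Q N, u x * iterDiv k φ x)

/-- The `r`-order total variation `TV^r_{ℓ^p}(u)`, for real `r = ⌊r⌋ + s ≥ 0`, `s ∈ [0,1)`. -/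
def fracTV {N : ℕ} (p : ℝ≥0∞) (r : ℝ) (u : (Fin N → ℝ) → ℝ) : ℝ≥0∞ :=
  ⨆ (φ : (Fin (⌊r⌋₊ + 1) → Fin N) → (Fin N → ℝ) → ℝ) (_ : Admissible p (⌊r⌋₊ + 1) φ),
    ENNReal.ofReal (∫ x in Q N, u x * fracIterDiv (r - ⌊r⌋₊) ⌊r⌋₊ φ x)

open Classical in
/-- The variant of `TV^r_{ℓ^p}` that is the classical total variation at integer orders
(the `L^1` norm at order `0`). It coincides with `fracTV` at the other orders. -/
def mixedTV {N : ℕ} (p : ℝ≥0∞) (r : ℝ) (u : (Fin N → ℝ) → ℝ) : ℝ≥0∞ :=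
  if r = ⌊r⌋₊ then intTV p ⌊r⌋₊ u else fracTV p r u

/-- The space `BV^r(Q)`. -/
def BVr (N : ℕ) (r : ℝ) : Set ((Fin N → ℝ) → ℝ) :=
  {u | IntegrableOn u (Q N) ∧ ∀ p : ℝ≥0∞, 1 ≤ p → fracTV p r u < ⊤}

/-- The classical space `BV(Q)`. -/
def BV (N : ℕ) : Set ((Fin N → ℝ) → ℝ) :=
  {u | IntegrableOn u (Q N) ∧ intTV 2 1 u < ⊤}

/-- Strict convergence `v_n → u` with respect to the `TV^r_{ℓ^p}` seminorm. -/
def StrictConv {N : ℕ} (p : ℝ≥0∞) (r : ℝ) (v : ℕ → (Fin N → ℝ) → ℝ)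
    (u : (Fin N → ℝ) → ℝ) : Prop :=
  (∀ n, IntegrableOn (v n) (Q N) ∧ fracTV p r (v n) < ⊤) ∧
  IntegrableOn u (Q N) ∧ fracTV p r u < ⊤ ∧
  Tendsto (fun n => eLpNorm (v n - u) 1 (μQ N)) atTop (𝓝 0) ∧
  Tendsto (fun n => fracTV p r (v n)) atTop (𝓝 (fracTV p r u))

/-- The space `SV^r(Q)`: the intersection over `p ∈ [1,∞]` of the closures of `C^∞(Q)` under
strict convergence. -/
def SVr (N : ℕ) (r : ℝ) : Set ((Fin N → ℝ) → ℝ) :=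
  {u | ∀ p : ℝ≥0∞, 1 ≤ p → ∃ v : ℕ → (Fin N → ℝ) → ℝ,
    (∀ n, ContDiffOn ℝ ∞ (v n) (Q N)) ∧ StrictConv p r v u}

/-- `T` is a boundary trace of `u`: for `H^{N-1}`-a.e. `x₀ ∈ ∂Q`,
`⨍_{B(x₀,ε) ∩ Q} |u - T(x₀)| → 0` as `ε → 0`, with Euclidean balls `B`. -/
def IsTrace {N : ℕ} (u T : (Fin N → ℝ) → ℝ) : Prop :=
  ∀ᵐ x₀ ∂((μH[(N : ℝ) - 1] : Measure (Fin N → ℝ)).restrict (frontier (Q N))),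
    Tendsto (fun ε : ℝ => ⨍ y in {y | ∑ i, (y i - x₀ i) ^ 2 < ε ^ 2} ∩ Q N, |u y - T x₀|)
      (𝓝[>] 0) (𝓝 0)

/-- Functions of `BV(Q)` with `‖T[u]‖_{L^∞(∂Q)} ≤ M`. The space `IM(Q)` is the case `M = 1`. -/
def IM (N : ℕ) (M : ℝ) : Set ((Fin N → ℝ) → ℝ) :=
  {u | u ∈ BV N ∧ ∃ T, IsTrace u T ∧
    ∀ᵐ x₀ ∂((μH[(N : ℝ) - 1] : Measure (Fin N → ℝ)).restrict (frontier (Q N))), |T x₀| ≤ M}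

/-- Weak convergence in `L^q(Q)`, `q ∈ (1,∞]` (weak-* if `q = ∞`): testing against `L^{q'}(Q)`. -/
def WeakConv {N : ℕ} (q : ℝ≥0∞) (v : ℕ → (Fin N → ℝ) → ℝ) (u : (Fin N → ℝ) → ℝ) : Prop :=
  (∀ n, MemLp (v n) q (μQ N)) ∧ MemLp u q (μQ N) ∧
  ∀ q' : ℝ≥0∞, q⁻¹ + q'⁻¹ = 1 → ∀ g : (Fin N → ℝ) → ℝ, MemLp g q' (μQ N) →
    Tendsto (fun n => ∫ x in Q N, v n x * g x) atTop (𝓝 (∫ x in Q N, u x * g x))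

end FracTV

end

/-! Lower semicontinuity. One differentiation under the integral and one integration by parts turn
the fractional derivative of a test function into a fractional integral of order `2 - s` of its
second derivative (`rlRight_eq`, `fracPartial_eq`). The kernel `t^(1-s)/Γ(2-s)` on `(0,1]` is
bounded and depends continuously in `L^1` on `s`, up to and including `s = 1`. Hence for a fixed
field `φ` the functions `div^s div^k φ` converge uniformly when `s` converges in `[0,1]`
(`extDiv_tendsto_uniformly`). The dual unit balls of `ℓ^{p_n}` and `ℓ^p` agree up to a factor
tending to 1, so a near-optimal field for the limit, slightly rescaled, is a competitor for every
`n`, and weak convergence passes to the limit in the pairing (`WeakL1.eventually_lt`).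

At an integer order the splitting `r = k + s` jumps. Orders approaching from below see `s → 1` and
give the classical variation in the limit. Orders at or above it see `s → 0` and give `N^(1/p-1)`
times the classical variation (`splitTV_zero`). This factor is at most 1, so the fractional
functional is always lower semicontinuous, while the classical one needs the factor to be 1 or
orders that do not exceed the limit. The weak limit exists by reflexivity-type compactness of `L^q`,
along a subsequence realizing the lower limit.

Strong convergence is of Fréchet–Kolmogorov type. Write `g - g(· - h e_i) = ∂_i G` with `|G| ≤ h`.
The Riemann–Liouville kernel of order `r`, cut off at distance `η`, gives `ψ = K ∗ ∂_i G`, which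
still has compact support in the cube and has size of order `η^r`. The operator of order `r` maps
`ψ` to `±(∂_i G + E)`, where `E` is smoothing and bounded by a constant depending on `η` times `h`
(`dirConv_iterate_partialD_localKernel`). Choosing `η`, then `h`, makes `∫ u (g - g(· - h e_i))`
small, uniformly over all `u` with bounded norm and variation and over orders in a compact subset of
`(0,∞)` (`exists_translation_bound`). Mollification then upgrades weak to strong convergence on
inner cubes, and the `L^q` bound with `q > 1` controls the boundary layer
(`WeakL1.tendsto_integral_abs_sub`, `exists_integral_boundary_le`). -/

noncomputable section

namespace FracTV

/-! ### Duality and weak sequential compactness in `L^q` over a finite measure. -/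

section WeakCompactness

variable {α : Type*} [MeasurableSpace α] {μ : Measure α} [IsFiniteMeasure μ] {q q' : ℝ≥0∞}

/-- For `q' < ∞` the `L^{q'}` norm of an indicator tends to 0 with the measure of the set, so the
tails of a disjoint union vanish. This is the countable additivity of the signed measure built from
a functional. -/
theorem hasSum_indicatorConstLp_iUnion [Fact (1 ≤ q')] (hq' : q' ≠ ⊤) {f : ℕ → Set α}
    (hf : ∀ i, MeasurableSet (f i)) (hd : Pairwise (Function.onFun Disjoint f)) :
    HasSum (fun i => indicatorConstLp q' (hf i) (measure_ne_top μ (f i)) (1 : ℝ))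
      (indicatorConstLp q' (MeasurableSet.iUnion hf) (measure_ne_top μ (⋃ i, f i)) (1 : ℝ)) := by
  have hm : ∀ s : Finset ℕ, MeasurableSet (⋃ i ∈ s, f i) := fun s =>
    Finset.measurableSet_biUnion s fun i _ => hf i
  have hsum : ∀ s : Finset ℕ, ∑ i ∈ s, indicatorConstLp q' (hf i) (measure_ne_top μ (f i)) (1 : ℝ)
      = indicatorConstLp q' (hm s) (measure_ne_top μ _) (1 : ℝ) := by
    intro s
    induction s using Finset.induction_on with
    | empty =>
      rw [Finset.sum_empty, eq_comm]
      convert! indicatorConstLp_empty (μ := μ) (p := q') (c := (1 : ℝ)) using 2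
      simp
    | insert a s ha ih =>
      rw [Finset.sum_insert ha, ih, ← indicatorConstLp_disjoint_union (hf a) (hm s)
        (measure_ne_top _ _) (measure_ne_top _ _)]
      · congr 1
        simp
      · rw [Set.disjoint_iUnion₂_right]
        intro i hi
        exact hd (by rintro rfl; exact ha hi)
  unfold HasSum
  simp_rw [hsum]
  refine tendsto_indicatorConstLp_set hq' ?_
  have h1 : ∀ s : Finset ℕ, symmDiff (⋃ i ∈ s, f i) (⋃ i, f i) = (⋃ i, f i) \ ⋃ i ∈ s, f i := by
    intro s
    refine symmDiff_of_le ?_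
    exact Set.iUnion₂_subset fun i _ => Set.subset_iUnion f i
  have h2 : ∀ s : Finset ℕ, μ (symmDiff (⋃ i ∈ s, f i) (⋃ i, f i))
      = μ (⋃ i, f i) - ∑ i ∈ s, μ (f i) := by
    intro s
    rw [h1, measure_sdiff (Set.iUnion₂_subset fun i _ => Set.subset_iUnion f i)
      (hm s).nullMeasurableSet (measure_ne_top _ _), measure_biUnion_finset
      (fun i _ j _ hij => hd hij) (fun i _ => hf i)]
  simp_rw [h2]
  have h3 : HasSum (fun i => μ (f i)) (μ (⋃ i, f i)) := by
    rw [measure_iUnion hd hf]; exact ENNReal.summable.hasSum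
  have := ENNReal.Tendsto.sub (tendsto_const_nhds (x := μ (⋃ i, f i))) h3
    (Or.inl (measure_ne_top _ _))
  simpa using this

/-- The map `A ↦ Λ(1_A)` is a signed measure absolutely continuous with respect to `μ`; its
Radon–Nikodym derivative is the density. -/
theorem exists_density_of_strongDual [Fact (1 ≤ q')] (hq' : q' ≠ ⊤)
    (Λ : StrongDual ℝ (Lp ℝ q' μ)) :
    ∃ v : α → ℝ, Measurable v ∧ Integrable v μ ∧ ∀ (A : Set α) (hA : MeasurableSet A),
      Λ (indicatorConstLp q' hA (measure_ne_top μ A) 1) = ∫ x in A, v x ∂μ := by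
  classical
  let ν : SignedMeasure α :=
    { measureOf' := fun A => if hA : MeasurableSet A then
        Λ (indicatorConstLp q' hA (measure_ne_top μ A) 1) else 0
      empty' := by simp [indicatorConstLp_empty]
      not_measurable' := fun A hA => by simp [hA]
      m_iUnion' := fun f hf hd => by
        simp only [hf, MeasurableSet.iUnion hf, dite_true]
        exact Λ.hasSum (hasSum_indicatorConstLp_iUnion hq' hf hd) }
  have hν : ∀ (A : Set α) (hA : MeasurableSet A),
      ν A = Λ (indicatorConstLp q' hA (measure_ne_top μ A) 1) := fun A hA => by
    change (if hA : MeasurableSet A then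
        Λ (indicatorConstLp q' hA (measure_ne_top μ A) 1) else 0) = _
    simp [hA]
  have hac : ν ≪ᵥ μ.toENNRealVectorMeasure := by
    refine VectorMeasure.AbsolutelyContinuous.mk fun A hA h0 => ?_
    rw [Measure.toENNRealVectorMeasure_apply_measurable hA] at h0
    rw [hν A hA]
    have : indicatorConstLp q' hA (measure_ne_top μ A) (1 : ℝ) = 0 := by
      rw [Lp.eq_zero_iff_ae_eq_zero]
      refine indicatorConstLp_coeFn.trans ?_
      exact indicator_meas_zero h0
    rw [this, map_zero]
  refine ⟨ν.rnDeriv μ, ν.measurable_rnDeriv μ, ν.integrable_rnDeriv μ, fun A hA => ?_⟩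
  rw [← hν A hA, ← withDensityᵥ_apply (ν.integrable_rnDeriv μ) hA,
    ν.withDensityᵥ_rnDeriv_eq μ hac]

theorem strongDual_simpleFunc_eq [Fact (1 ≤ q')] {Λ : StrongDual ℝ (Lp ℝ q' μ)} {v : α → ℝ}
    (hv : Integrable v μ) (h : ∀ (A : Set α) (hA : MeasurableSet A),
      Λ (indicatorConstLp q' hA (measure_ne_top μ A) 1) = ∫ x in A, v x ∂μ)
    (f : SimpleFunc α ℝ) :
    Λ ((f.memLp_of_isFiniteMeasure q' μ).toLp f) = ∫ x, v x * f x ∂μ := by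
  induction f using SimpleFunc.induction with
  | const c hs =>
    rename_i s
    have : ((SimpleFunc.piecewise s hs (SimpleFunc.const α c)
        (SimpleFunc.const α 0)).memLp_of_isFiniteMeasure q' μ).toLp _
        = c • indicatorConstLp q' hs (measure_ne_top μ s) (1 : ℝ) := by
      ext1
      filter_upwards [MemLp.coeFn_toLp ((SimpleFunc.piecewise s hs (SimpleFunc.const α c)
        (SimpleFunc.const α 0)).memLp_of_isFiniteMeasure q' μ),
        Lp.coeFn_smul c (indicatorConstLp q' hs (measure_ne_top μ s) (1 : ℝ)),
        indicatorConstLp_coeFn (p := q') (hs := hs) (hμs := measure_ne_top μ s) (c := (1 : ℝ))]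
        with x h1 h2 h3
      rw [h1, h2, Pi.smul_apply, h3]
      by_cases hx : x ∈ s <;> simp [hx]
    rw [this, map_smul, h s hs, smul_eq_mul, ← integral_const_mul, ← integral_indicator hs]
    congr 1
    ext x
    by_cases hx : x ∈ s <;> simp [hx, mul_comm]
  | add hd hf hg =>
    rename_i f g
    have e : ((f + g).memLp_of_isFiniteMeasure q' μ).toLp (f + g)
        = (f.memLp_of_isFiniteMeasure q' μ).toLp f + (g.memLp_of_isFiniteMeasure q' μ).toLp g := by
      rw [← MemLp.toLp_add]; rfl
    have hInt : ∀ f : SimpleFunc α ℝ, Integrable (fun x => v x * f x) μ := fun f => by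
      obtain ⟨C, hC⟩ := f.exists_forall_norm_le
      exact hv.mul_bdd f.aestronglyMeasurable (Eventually.of_forall hC)
    rw [e, map_add, hf, hg, ← integral_add (hInt f) (hInt g)]
    simp [mul_add]

/-- For `q = ∞` the averages of `v` over all sets are bounded by `‖Λ‖`. For `q < ∞` the functional
is tested with the extremal function of Hölder's inequality built from simple functions below `|v|`.
All integrals are then finite, so one may divide, and Fatou's lemma gives the bound for `v`. -/
theorem memLp_of_strongDual [Fact (1 ≤ q')] [hc : ENNReal.HolderConjugate q q'] (hq' : q' ≠ ⊤)
    {Λ : StrongDual ℝ (Lp ℝ q' μ)} {v : α → ℝ} (hvm : Measurable v)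
    (hv : Integrable v μ) (h : ∀ (A : Set α) (hA : MeasurableSet A),
      Λ (indicatorConstLp q' hA (measure_ne_top μ A) 1) = ∫ x in A, v x ∂μ) :
    MemLp v q μ := by
  have hq'1 : 1 ≤ q' := Fact.out
  have hinv : q⁻¹ + q'⁻¹ = 1 := ENNReal.holderConjugate_iff.1 hc
  rcases eq_or_ne q ⊤ with rfl | hq
  · have hq1 : q' = 1 := by simpa using hinv
    subst hq1
    have hA : ∀ A, MeasurableSet A → |∫ x in A, v x ∂μ| ≤ ∫ x in A, ‖Λ‖ ∂μ := by
      intro A hA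
      rw [← h A hA, ← Real.norm_eq_abs]
      refine (Λ.le_opNorm _).trans ?_
      rw [norm_indicatorConstLp one_ne_zero ENNReal.one_ne_top]
      simp [mul_comm]
    refine memLp_top_of_bound hvm.aestronglyMeasurable ‖Λ‖ ?_
    have h1 := ae_le_of_forall_setIntegral_le hv (integrable_const ‖Λ‖)
      fun A hA' _ => (le_abs_self _).trans (hA A hA')
    have h2 := ae_le_of_forall_setIntegral_le hv.neg (integrable_const ‖Λ‖)
      fun A hA' _ => by
        simp only [Pi.neg_apply, integral_neg]
        exact (neg_le_abs _).trans (hA A hA')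
    filter_upwards [h1, h2] with x h1 h2
    rw [Real.norm_eq_abs, abs_le]
    simp only [Pi.neg_apply] at h2
    constructor <;> linarith
  · have hq1 : 1 < q := by
      rcases ENNReal.HolderConjugate.one_le (p := q) (q := q') |>.lt_or_eq with h | h
      · exact h
      · subst h
        simp at hinv
        exact absurd hinv hq'
    have hQ : 1 < q.toReal := by
      simpa using (ENNReal.toReal_lt_toReal ENNReal.one_ne_top hq).2 hq1
    have hinvR : q.toReal⁻¹ + q'.toReal⁻¹ = 1 := by
      rw [← ENNReal.toReal_inv, ← ENNReal.toReal_inv, ← ENNReal.toReal_add, hinv,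
        ENNReal.toReal_one]
      · simpa using (zero_lt_one.trans hq1).ne'
      · simpa using (zero_lt_one.trans_le hq'1).ne'
    have hq0 : q ≠ 0 := (zero_lt_one.trans hq1).ne'
    have hq'0 : q' ≠ 0 := (zero_lt_one.trans_le hq'1).ne'
    have hQ'pos : 0 < q'.toReal := ENNReal.toReal_pos hq'0 hq'
    set a := q.toReal with ha
    set b := q'.toReal with hb
    have hab : (a - 1) * b = a := by
      have ha0 : a ≠ 0 := by positivity
      field_simp at hinvR
      linarith
    let e : ℕ → SimpleFunc α ℝ≥0∞ := SimpleFunc.eapprox fun x => ‖v x‖ₑ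
    have hem : Measurable fun x => ‖v x‖ₑ := hvm.enorm
    have hele : ∀ n x, e n x ≤ ‖v x‖ₑ := fun n x => by
      rw [← SimpleFunc.iSup_eapprox_apply hem x]
      exact le_iSup (fun n => (SimpleFunc.eapprox (fun x => ‖v x‖ₑ) n) x) n
    have hbound : ∀ n, ∫⁻ x, e n x ^ a ∂μ ≤ ENNReal.ofReal (‖Λ‖ ^ a) := by
      intro n
      let w : SimpleFunc α ℝ := (e n).map ENNReal.toReal
      have hw0 : ∀ x, 0 ≤ w x := fun x => ENNReal.toReal_nonneg
      have hwv : ∀ x, w x ≤ |v x| := fun x => by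
        have := ENNReal.toReal_mono (enorm_ne_top) (hele n x)
        simpa [w] using this
      let s : SimpleFunc α ℝ := SimpleFunc.piecewise {x | 0 ≤ v x}
        (measurableSet_le measurable_const hvm) (SimpleFunc.const α 1) (SimpleFunc.const α (-1))
      have hs : ∀ x, s x * v x = |v x| ∧ |s x| = 1 := fun x => by
        by_cases hx : 0 ≤ v x
        · simp [s, hx, abs_of_nonneg]
        · simp [s, hx, abs_of_neg (not_le.1 hx)]
      -- With `(a - 1) b = a` one has `|g|^b = w^a`, while `v g ≥ w^a`; this yields `I ≤ ‖Λ‖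
      -- I^(1/b)`.
      let g : SimpleFunc α ℝ := s * w.map (fun t => t ^ (a - 1))
      have hg : ∀ x, g x = s x * w x ^ (a - 1) := fun x => rfl
      have hgn : ∀ x, ‖g x‖ ^ b = w x ^ a := fun x => by
        rw [hg, norm_mul, Real.norm_eq_abs, (hs x).2, one_mul, Real.norm_of_nonneg
          (Real.rpow_nonneg (hw0 x) _), ← Real.rpow_mul (hw0 x), hab]
      set I := ∫ x, w x ^ a ∂μ with hI
      have hI0 : 0 ≤ I := integral_nonneg fun x => Real.rpow_nonneg (hw0 x) _
      have hwint : Integrable (fun x => w x ^ a) μ :=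
        (w.map (fun t => t ^ a)).integrable_of_isFiniteMeasure
      have hgnorm : ‖(g.memLp_of_isFiniteMeasure q' μ).toLp g‖ = I ^ b⁻¹ := by
        rw [Lp.norm_toLp, (g.memLp_of_isFiniteMeasure q' μ).eLpNorm_eq_integral_rpow_norm hq'0 hq',
          ENNReal.toReal_ofReal (by positivity)]
        simp_rw [← hb, hgn]
        rfl
      have hvg : Integrable (fun x => v x * g x) μ := by
        obtain ⟨C, hC⟩ := g.exists_forall_norm_le
        exact hv.mul_bdd g.aestronglyMeasurable (Eventually.of_forall hC)
      have h1 : I ≤ ∫ x, v x * g x ∂μ := by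
        refine integral_mono hwint hvg fun x => ?_
        have : v x * g x = |v x| * w x ^ (a - 1) := by rw [hg, ← (hs x).1]; ring
        simp only [this]
        have h2 : w x ^ a = w x * w x ^ (a - 1) := by
          rcases (hw0 x).eq_or_lt with h | h
          · rw [← h, Real.zero_rpow (by positivity), zero_mul]
          · rw [← Real.rpow_one_add' h.le (by linarith)]
            congr 1; ring
        rw [h2]
        exact mul_le_mul_of_nonneg_right (hwv x) (Real.rpow_nonneg (hw0 x) _)
      have h2 : I ≤ ‖Λ‖ * I ^ b⁻¹ := by
        rw [← hgnorm]
        refine h1.trans ?_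
        rw [← strongDual_simpleFunc_eq hv h g]
        exact (le_abs_self _).trans (Λ.le_opNorm _)
      have h3 : I ≤ ‖Λ‖ ^ a := by
        rcases hI0.eq_or_lt with h0 | h0
        · rw [← h0]; positivity
        · have h4 : I ^ a⁻¹ ≤ ‖Λ‖ := by
            have h5 : I = I ^ a⁻¹ * I ^ b⁻¹ := by
              rw [← Real.rpow_add h0, hinvR, Real.rpow_one]
            have h6 : 0 < I ^ b⁻¹ := Real.rpow_pos_of_pos h0 _
            exact le_of_mul_le_mul_right (h5.symm.le.trans h2) h6
          calc I = (I ^ a⁻¹) ^ a := by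
                rw [← Real.rpow_mul hI0, inv_mul_cancel₀ (by positivity), Real.rpow_one]
            _ ≤ ‖Λ‖ ^ a := Real.rpow_le_rpow (by positivity) h4 (by positivity)
      have h4 : ∀ x, e n x ^ a = ENNReal.ofReal (w x ^ a) := fun x => by
        have hne : e n x ≠ ⊤ := (SimpleFunc.eapprox_lt_top _ n x).ne
        rw [← ENNReal.ofReal_rpow_of_nonneg (hw0 x) (by positivity)]
        simp [w, ENNReal.ofReal_toReal hne]
      simp_rw [h4]
      rw [← ofReal_integral_eq_lintegral_ofReal hwint
        (Eventually.of_forall fun x => Real.rpow_nonneg (hw0 x) _)]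
      exact ENNReal.ofReal_le_ofReal h3
    refine ⟨hvm.aestronglyMeasurable, ?_⟩
    rw [eLpNorm_lt_top_iff_lintegral_rpow_enorm_lt_top hq0 hq]
    refine lt_of_le_of_lt ?_ (ENNReal.ofReal_lt_top (r := ‖Λ‖ ^ a))
    have hlim : ∀ x, ‖v x‖ₑ ^ a = liminf (fun n => e n x ^ a) atTop := fun x =>
      (((ENNReal.continuous_rpow_const).tendsto _).comp
        (SimpleFunc.tendsto_eapprox hem x)).liminf_eq.symm
    calc ∫⁻ x, ‖v x‖ₑ ^ a ∂μ = ∫⁻ x, liminf (fun n => e n x ^ a) atTop ∂μ := by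
          simp_rw [hlim]
      _ ≤ liminf (fun n => ∫⁻ x, e n x ^ a ∂μ) atTop :=
          lintegral_liminf_le fun n => (e n).measurable.pow_const _
      _ ≤ _ := by
          refine (liminf_le_liminf (Eventually.of_forall hbound)).trans ?_
          simp

/-- Riesz representation of the dual of `L^{q'}`, for a finite measure and `q' < ∞`. -/
theorem exists_memLp_of_strongDual [Fact (1 ≤ q')] [Fact (1 ≤ q)] [ENNReal.HolderConjugate q q']
    (hq' : q' ≠ ⊤) (Λ : StrongDual ℝ (Lp ℝ q' μ)) :
    ∃ v : α → ℝ, MemLp v q μ ∧ ∀ g : Lp ℝ q' μ, Λ g = ∫ x, v x * g x ∂μ := by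
  obtain ⟨v, hvm, hv, h⟩ := exists_density_of_strongDual hq' Λ
  have hvq : MemLp v q μ := memLp_of_strongDual hq' hvm hv h
  refine ⟨v, hvq, ?_⟩
  have hpair : ∀ g : Lp ℝ q' μ, ∫ x, v x * g x ∂μ
      = (ContinuousLinearMap.mul ℝ ℝ).lpPairing μ q q' (hvq.toLp v) g := fun g => by
    rw [ContinuousLinearMap.lpPairing_eq_integral]
    refine integral_congr_ae ?_
    filter_upwards [hvq.coeFn_toLp] with x hx
    simp [hx]
  refine Lp.induction hq' _ ?_ ?_ ?_
  · intro c s hs hμs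
    rw [hpair]
    have : ((Lp.simpleFunc.indicatorConst q' hs hμs.ne c : Lp.simpleFunc ℝ q' μ) : Lp ℝ q' μ)
        = c • indicatorConstLp q' hs hμs.ne (1 : ℝ) := by
      rw [Lp.simpleFunc.coe_indicatorConst]
      ext1
      filter_upwards [Lp.coeFn_smul c (indicatorConstLp q' hs hμs.ne (1 : ℝ)),
        indicatorConstLp_coeFn (p := q') (hs := hs) (hμs := hμs.ne) (c := (1 : ℝ)),
        indicatorConstLp_coeFn (p := q') (hs := hs) (hμs := hμs.ne) (c := c)] with x h1 h2 h3
      rw [h1, Pi.smul_apply, h2, h3]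
      by_cases hx : x ∈ s <;> simp [hx]
    rw [this, map_smul, map_smul, h s hs, ← hpair, ← integral_indicator hs]
    congr 1
    refine integral_congr_ae ?_
    filter_upwards [indicatorConstLp_coeFn (p := q') (hs := hs) (hμs := hμs.ne) (c := (1 : ℝ))]
      with x hx
    rw [hx]
    by_cases hx : x ∈ s <;> simp [hx]
  · intro f g hf hg _ h1 h2
    rw [hpair] at h1 h2 ⊢
    rw [map_add, map_add, h1, h2]
  · simp_rw [hpair]
    exact isClosed_eq Λ.continuous (ContinuousLinearMap.continuous _)

/-- Weak (weak-* if `q = ∞`) sequential compactness of bounded sets of `L^q`, `q > 1`. -/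
theorem exists_weakly_convergent_subseq [IsSeparable μ] (hq : 1 < q) {u : ℕ → α → ℝ}
    (hu : ∀ n, AEStronglyMeasurable (u n) μ) {C : ℝ≥0∞} (hC : C ≠ ⊤)
    (hb : ∀ n, eLpNorm (u n) q μ ≤ C) :
    ∃ (v : α → ℝ) (σ : ℕ → ℕ), StrictMono σ ∧ MemLp v q μ ∧
      ∀ q' : ℝ≥0∞, q⁻¹ + q'⁻¹ = 1 → ∀ g : α → ℝ, MemLp g q' μ →
        Tendsto (fun n => ∫ x, u (σ n) x * g x ∂μ) atTop (𝓝 (∫ x, v x * g x ∂μ)) := by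
  have hmem : ∀ n, MemLp (u n) q μ := fun n => ⟨hu n, (hb n).trans_lt hC.lt_top⟩
  have hc : ENNReal.HolderConjugate q (1 - q⁻¹)⁻¹ :=
    ENNReal.HolderConjugate.inv_one_sub_inv' hq.le
  set q₁ := (1 - q⁻¹)⁻¹ with hq₁
  have : Fact (1 ≤ q) := ⟨hq.le⟩
  have : Fact (1 ≤ q₁) := ⟨ENNReal.HolderConjugate.one_le q₁ q⟩
  have hq₁top : q₁ ≠ ⊤ := ((ENNReal.HolderConjugate.lt_top_iff_one_lt q₁ q).2 hq).ne
  have : Fact (q₁ ≠ ⊤) := ⟨hq₁top⟩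
  let L : ℕ → StrongDual ℝ (Lp ℝ q₁ μ) := fun n =>
    (ContinuousLinearMap.mul ℝ ℝ).lpPairing μ q q₁ ((hmem n).toLp (u n))
  have hL : ∀ n g (hg : MemLp g q₁ μ), L n (hg.toLp g) = ∫ x, u n x * g x ∂μ := fun n g hg => by
    simp only [L]
    rw [ContinuousLinearMap.lpPairing_eq_integral]
    refine integral_congr_ae ?_
    filter_upwards [(hmem n).coeFn_toLp, hg.coeFn_toLp] with x h1 h2
    simp [h1, h2]
  let R := ‖(ContinuousLinearMap.mul ℝ ℝ).lpPairing μ q q₁‖ * C.toReal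
  have hball : ∀ n, (StrongDual.toWeakDual (L n)) ∈
      (WeakDual.toStrongDual ⁻¹' Metric.closedBall (0 : StrongDual ℝ (Lp ℝ q₁ μ)) R) := by
    intro n
    simp only [mem_preimage, Metric.mem_closedBall, dist_zero_right]
    change ‖L n‖ ≤ R
    refine (ContinuousLinearMap.le_opNorm _ _).trans ?_
    refine mul_le_mul_of_nonneg_left ?_ (norm_nonneg _)
    rw [Lp.norm_toLp]
    exact ENNReal.toReal_mono hC (hb n)
  -- The predual `L^{q₁}` is separable because `μ` is separable and `q₁ < ∞`, so dual balls are
  -- sequentially weak-* compact.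
  obtain ⟨Λ, _, σ, hσ, hlim⟩ := WeakDual.isSeqCompact_closedBall ℝ (Lp ℝ q₁ μ) 0 R hball
  obtain ⟨v, hv, hΛ⟩ := exists_memLp_of_strongDual (q := q) hq₁top (WeakDual.toStrongDual Λ)
  refine ⟨v, σ, hσ, hv, fun q' hq' g hg => ?_⟩
  have hc' : ENNReal.HolderConjugate q q' := ENNReal.holderConjugate_iff.2 hq'
  obtain rfl : q₁ = q' := ENNReal.HolderConjugate.unique q q₁ q'
  have h1 := ((WeakDual.eval_continuous (𝕜 := ℝ) (hg.toLp g)).tendsto Λ).comp hlim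
  have h2 : Λ (hg.toLp g) = ∫ x, v x * g x ∂μ := by
    refine (hΛ (hg.toLp g)).trans (integral_congr_ae ?_)
    filter_upwards [hg.coeFn_toLp] with x h1
    simp [h1]
  rw [← h2]
  refine h1.congr fun n => ?_
  exact hL (σ n) g hg

end WeakCompactness

/-! ### Comparison of `ℓ^p` norms and of their dual unit balls. -/

section DualNorm

variable {ι : Type} [Fintype ι] {p q : ℝ≥0∞}

theorem norm_toLp_eq_toReal_eLpNorm (hp : 1 ≤ p) (x : ι → ℝ) :
    ‖WithLp.toLp p x‖ = (eLpNorm x p (@Measure.count ι ⊤)).toReal := by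
  let _ : MeasurableSpace ι := ⊤
  rcases eq_or_ne p ⊤ with rfl | hpt
  · rw [PiLp.norm_eq_ciSup, eLpNorm_exponent_top, eLpNormEssSup_count, ENNReal.toReal_iSup]
    · simp
    · simp
  · have hp0 : p ≠ 0 := (zero_lt_one.trans_le hp).ne'
    have hpr : 0 < p.toReal := ENNReal.toReal_pos hp0 hpt
    rw [PiLp.norm_eq_sum hpr, eLpNorm_eq_lintegral_rpow_enorm_toReal hp0 hpt, lintegral_count,
      tsum_fintype, ← ENNReal.toReal_rpow, ENNReal.toReal_sum]
    · simp [← ENNReal.toReal_rpow]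
    · intro a _
      exact ENNReal.rpow_ne_top_of_nonneg hpr.le enorm_ne_top

/-- Each entry is at most `M = ‖x‖_q`, so `|x_i|^p ≤ M^(p-q) |x_i|^q`. -/
theorem norm_toLp_le_of_le (hq : 1 ≤ q) (hqp : q ≤ p) (x : ι → ℝ) :
    ‖WithLp.toLp p x‖ ≤ ‖WithLp.toLp q x‖ := by
  have : Fact (1 ≤ q) := ⟨hq⟩
  have hx : ∀ i, |x i| ≤ ‖WithLp.toLp q x‖ := fun i => PiLp.norm_apply_le (WithLp.toLp q x) i
  have h0 : 0 ≤ ‖WithLp.toLp q x‖ := norm_nonneg _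
  rcases eq_or_ne p ⊤ with rfl | hpt
  · rw [PiLp.norm_eq_ciSup]
    exact Real.iSup_le hx h0
  · have hqt : q ≠ ⊤ := ne_top_of_le_ne_top hpt hqp
    have hq0 : q ≠ 0 := (zero_lt_one.trans_le hq).ne'
    have hp0 : p ≠ 0 := (zero_lt_one.trans_le (hq.trans hqp)).ne'
    have hpr : 0 < p.toReal := ENNReal.toReal_pos hp0 hpt
    have hqr : 0 < q.toReal := ENNReal.toReal_pos hq0 hqt
    have hle : q.toReal ≤ p.toReal := ENNReal.toReal_mono hpt hqp
    set M := ‖WithLp.toLp q x‖ with hM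
    rcases h0.eq_or_lt with h | h
    · have : x = 0 := by
        ext i
        have := hx i
        rw [← h] at this
        simpa using this
      subst this
      rw [PiLp.norm_eq_sum hpr]
      simp [Real.zero_rpow hpr.ne', Real.zero_rpow (inv_pos.2 hpr).ne', ← h]
    · have hMq : ∑ i, |x i| ^ q.toReal = M ^ q.toReal := by
        rw [hM, PiLp.norm_eq_sum hqr, ← Real.rpow_mul (Finset.sum_nonneg fun i _ => by positivity)]
        simp [hqr.ne']
      rw [PiLp.norm_eq_sum hpr]
      have h1 : ∑ i, |x i| ^ p.toReal ≤ M ^ p.toReal := by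
        calc ∑ i, |x i| ^ p.toReal ≤ ∑ i, M ^ (p.toReal - q.toReal) * |x i| ^ q.toReal := by
              refine Finset.sum_le_sum fun i _ => ?_
              rcases (abs_nonneg (x i)).eq_or_lt with hi | hi
              · rw [← hi, Real.zero_rpow hpr.ne', Real.zero_rpow hqr.ne', mul_zero]
              · have : |x i| ^ p.toReal = |x i| ^ (p.toReal - q.toReal) * |x i| ^ q.toReal := by
                  rw [← Real.rpow_add hi, sub_add_cancel]
                rw [this]
                gcongr
                exact hx i
          _ = M ^ p.toReal := by
              rw [← Finset.mul_sum, hMq, ← Real.rpow_add h, sub_add_cancel]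
      calc (∑ i, ‖x i‖ ^ p.toReal) ^ (1 / p.toReal) ≤ (M ^ p.toReal) ^ (1 / p.toReal) := by
            refine Real.rpow_le_rpow (Finset.sum_nonneg fun i _ => by positivity) h1 (by positivity)
        _ = M := by
            rw [← Real.rpow_mul h0, mul_one_div_cancel hpr.ne', Real.rpow_one]

/-- Comparison of the `ℓ^p` and `ℓ^q` norms. -/
theorem norm_toLp_le_card_rpow_mul [Nonempty ι] (hp : 1 ≤ p) (hq : 1 ≤ q) (x : ι → ℝ) :
    ‖WithLp.toLp p x‖ ≤
      (Fintype.card ι : ℝ) ^ |(p⁻¹).toReal - (q⁻¹).toReal| * ‖WithLp.toLp q x‖ := by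
  have hcard : (1 : ℝ) ≤ Fintype.card ι := by exact_mod_cast Fintype.card_pos
  rcases le_total q p with h | h
  · refine (norm_toLp_le_of_le hq h x).trans ?_
    have : Fact (1 ≤ q) := ⟨hq⟩
    exact le_mul_of_one_le_left (norm_nonneg _) (Real.one_le_rpow hcard (abs_nonneg _))
  -- For `p ≤ q` this is Hölder's inequality for the counting measure, whose total mass is the
  -- number of entries.
  · let _ : MeasurableSpace ι := ⊤
    rw [norm_toLp_eq_toReal_eLpNorm hp, norm_toLp_eq_toReal_eLpNorm hq]
    have h1 := eLpNorm_le_eLpNorm_mul_rpow_measure_univ (μ := Measure.count) h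
      (f := x) (measurable_of_finite x).aestronglyMeasurable
    have hq0 : q ≠ 0 := (zero_lt_one.trans_le hq).ne'
    have hinv : (q⁻¹).toReal ≤ (p⁻¹).toReal := by
      refine ENNReal.toReal_mono ?_ (ENNReal.inv_le_inv.2 h)
      simpa using (zero_lt_one.trans_le hp).ne'
    have hfin : eLpNorm x q Measure.count * Measure.count (univ : Set ι) ^
        (1 / p.toReal - 1 / q.toReal) ≠ ⊤ := by
      refine ENNReal.mul_ne_top ((eLpNorm_count_lt_top hq0).2 fun i => enorm_lt_top).ne ?_
      refine ENNReal.rpow_ne_top_of_nonneg ?_ ?_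
      · simpa using hinv
      · rw [Measure.count_univ]; simp
    refine (ENNReal.toReal_mono hfin h1).trans_eq ?_
    rw [ENNReal.toReal_mul, ← ENNReal.toReal_rpow, Measure.count_univ, abs_of_nonneg (by linarith),
      mul_comm]
    simp

theorem DualNormLeOne.of_norm_le {p q : ℝ≥0∞} {y : ι → ℝ} (hy : DualNormLeOne q y) {C : ℝ}
    (hC : 0 < C) (h : ∀ x : ι → ℝ, ‖WithLp.toLp q x‖ ≤ C * ‖WithLp.toLp p x‖) (hq : 1 ≤ q) :
    DualNormLeOne p (fun j => C⁻¹ * y j) := by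
  intro x hx
  have : Fact (1 ≤ q) := ⟨hq⟩
  have h1 : ‖WithLp.toLp q (fun j => C⁻¹ * x j)‖ ≤ 1 := by
    have : WithLp.toLp q (fun j => C⁻¹ * x j) = C⁻¹ • WithLp.toLp q x := rfl
    rw [this, norm_smul, Real.norm_of_nonneg (inv_nonneg.2 hC.le), inv_mul_le_iff₀ hC, mul_one]
    exact (h x).trans (mul_le_of_le_one_right hC.le hx)
  have := hy _ h1
  convert this using 2
  ring

theorem DualNormLeOne.neg {p : ℝ≥0∞} (hp : 1 ≤ p) {y : ι → ℝ} (hy : DualNormLeOne p y) :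
    DualNormLeOne p (fun j => -y j) := by
  intro x hx
  have : Fact (1 ≤ p) := ⟨hp⟩
  have h1 : ‖WithLp.toLp p (fun j => -x j)‖ ≤ 1 := by
    have : WithLp.toLp p (fun j => -x j) = -WithLp.toLp p x := rfl
    rwa [this, norm_neg]
  have := hy _ h1
  convert this using 2
  ring

/-- A field with a single nonzero entry is admissible for every `p` with the same bound, which makes
the later estimates uniform in the exponents. -/
theorem dualNormLeOne_single [DecidableEq ι] {p : ℝ≥0∞} (hp : 1 ≤ p) (j : ι) {a : ℝ}
    (ha : |a| ≤ 1) : DualNormLeOne p (fun i => if i = j then a else 0) := by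
  intro x hx
  have : Fact (1 ≤ p) := ⟨hp⟩
  have hj : |x j| ≤ 1 := (PiLp.norm_apply_le (WithLp.toLp p x) j).trans hx
  simp only [mul_ite, mul_zero, Finset.sum_ite_eq', Finset.mem_univ, if_true]
  calc x j * a ≤ |x j * a| := le_abs_self _
    _ = |x j| * |a| := abs_mul _ _
    _ ≤ 1 * 1 := mul_le_mul hj ha (abs_nonneg _) zero_le_one
    _ = 1 := one_mul 1

end DualNorm

/-! ### Averaging tensors over the first index. -/

section Tensor

variable {N k : ℕ} {p : ℝ≥0∞}

theorem sum_fin_succ_eq {M : Type*} [AddCommMonoid M] (f : (Fin (k + 1) → Fin N) → M) :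
    ∑ J, f J = ∑ i, ∑ J : Fin k → Fin N, f (Fin.cons i J) := by
  rw [← Fintype.sum_prod_type']
  exact (Fintype.sum_equiv (Fin.consEquiv fun _ => Fin N) _ _ fun _ => rfl).symm

/-- The ratio `N^{1/p-1}` of the two total variations at integer orders. -/
def intRatio (N : ℕ) (p : ℝ≥0∞) : ℝ := (N : ℝ) ^ ((p⁻¹).toReal - 1)

theorem intRatio_pos (hN : 1 ≤ N) (p : ℝ≥0∞) : 0 < intRatio N p :=
  Real.rpow_pos_of_pos (by exact_mod_cast hN) _

theorem intRatio_le_one (hN : 1 ≤ N) (hp : 1 ≤ p) : intRatio N p ≤ 1 := by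
  refine Real.rpow_le_one_of_one_le_of_nonpos (by exact_mod_cast hN) ?_
  have : (p⁻¹).toReal ≤ 1 := by
    rw [← ENNReal.toReal_one]
    exact ENNReal.toReal_mono ENNReal.one_ne_top (ENNReal.inv_le_one.2 hp)
  linarith

/-- Repeating every entry `N` times multiplies the `ℓ^p` norm by `N^(1/p)`, and the division
contributes `1/N`. This operation is the adjoint of averaging over the first index. -/
theorem norm_toLp_tail_div_le (hN : 1 ≤ N) (hp : 1 ≤ p) (x : (Fin k → Fin N) → ℝ) :
    ‖WithLp.toLp p (fun J : Fin (k + 1) → Fin N => x (Fin.tail J) / N)‖ ≤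
      intRatio N p * ‖WithLp.toLp p x‖ := by
  have hN0 : (0 : ℝ) < N := by exact_mod_cast hN
  have : Fact (1 ≤ p) := ⟨hp⟩
  rcases eq_or_ne p ⊤ with rfl | hpt
  · rw [PiLp.norm_eq_ciSup]
    refine Real.iSup_le (fun J => ?_) (mul_nonneg (intRatio_pos hN _).le (norm_nonneg _))
    have := PiLp.norm_apply_le (WithLp.toLp (⊤ : ℝ≥0∞) x) (Fin.tail J)
    simp only [intRatio, ENNReal.inv_top, ENNReal.toReal_zero, zero_sub, Real.rpow_neg_one,
      norm_div, RCLike.norm_natCast]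
    rw [div_eq_inv_mul]
    exact mul_le_mul_of_nonneg_left this (by positivity)
  · have hp0 : p ≠ 0 := (zero_lt_one.trans_le hp).ne'
    have hpr : 0 < p.toReal := ENNReal.toReal_pos hp0 hpt
    have hS : 0 ≤ ∑ J, |x J| ^ p.toReal := Finset.sum_nonneg fun J _ => by positivity
    rw [PiLp.norm_eq_sum hpr, PiLp.norm_eq_sum hpr, sum_fin_succ_eq]
    simp only [Fin.tail_cons, norm_div, RCLike.norm_natCast, Finset.sum_const, Finset.card_univ,
      Fintype.card_fin, nsmul_eq_mul, Real.norm_eq_abs]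
    simp_rw [Real.div_rpow (abs_nonneg _) hN0.le, ← Finset.sum_div]
    rw [Real.mul_rpow hN0.le (by positivity), Real.div_rpow hS (by positivity), intRatio,
      ← Real.rpow_mul hN0.le, mul_one_div_cancel hpr.ne', Real.rpow_one, Real.rpow_sub_one hN0.ne',
      ENNReal.toReal_inv, one_div]
    apply le_of_eq
    ring

/-- Convexity of `t ↦ t^p` gives `|∑_i y_i|^p ≤ N^(p-1) ∑_i |y_i|^p`. The constant is the reciprocal
of `intRatio`, so averaging and repeating are sharp against each other. -/
theorem norm_toLp_sum_cons_le (hN : 1 ≤ N) (hp : 1 ≤ p) (y : (Fin (k + 1) → Fin N) → ℝ) :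
    ‖WithLp.toLp p (fun J : Fin k → Fin N => ∑ i, y (Fin.cons i J))‖ ≤
      (intRatio N p)⁻¹ * ‖WithLp.toLp p y‖ := by
  have hN0 : (0 : ℝ) < N := by exact_mod_cast hN
  have : Fact (1 ≤ p) := ⟨hp⟩
  rcases eq_or_ne p ⊤ with rfl | hpt
  · rw [PiLp.norm_eq_ciSup]
    refine Real.iSup_le (fun J => ?_) (mul_nonneg (inv_pos.2 (intRatio_pos hN _)).le
      (norm_nonneg _))
    have h1 : ∀ i, ‖y (Fin.cons i J)‖ ≤ ‖WithLp.toLp (⊤ : ℝ≥0∞) y‖ := fun i =>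
      PiLp.norm_apply_le (WithLp.toLp (⊤ : ℝ≥0∞) y) (Fin.cons i J)
    simp only [intRatio, ENNReal.inv_top, ENNReal.toReal_zero, zero_sub, Real.rpow_neg_one, inv_inv]
    refine (norm_sum_le _ _).trans ((Finset.sum_le_sum fun i _ => h1 i).trans_eq ?_)
    simp
  · have hp0 : p ≠ 0 := (zero_lt_one.trans_le hp).ne'
    have hpr : 0 < p.toReal := ENNReal.toReal_pos hp0 hpt
    have hp1 : 1 ≤ p.toReal := by
      rw [← ENNReal.toReal_one]; exact ENNReal.toReal_mono hpt hp
    have hS : 0 ≤ ∑ J, |y J| ^ p.toReal := Finset.sum_nonneg fun J _ => by positivity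
    rw [PiLp.norm_eq_sum hpr, PiLp.norm_eq_sum hpr]
    simp only [Real.norm_eq_abs]
    have h1 : ∑ J : Fin k → Fin N, |∑ i, y (Fin.cons i J)| ^ p.toReal ≤
        (N : ℝ) ^ (p.toReal - 1) * ∑ J, |y J| ^ p.toReal := by
      rw [sum_fin_succ_eq, Finset.sum_comm, Finset.mul_sum]
      refine Finset.sum_le_sum fun J _ => ?_
      refine (Real.rpow_le_rpow (abs_nonneg _) (Finset.abs_sum_le_sum_abs _ _) hpr.le).trans ?_
      have := Real.rpow_sum_le_const_mul_sum_rpow Finset.univ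
        (f := fun i : Fin N => y (Fin.cons i J)) hp1
      simpa using this
    refine (Real.rpow_le_rpow (Finset.sum_nonneg fun J _ => by positivity) h1
      (by positivity)).trans_eq ?_
    rw [Real.mul_rpow (by positivity) hS, intRatio, ← Real.rpow_mul hN0.le, ← Real.rpow_neg hN0.le,
      ENNReal.toReal_inv]
    congr 2
    field_simp
    ring

theorem DualNormLeOne.average (hN : 1 ≤ N) (hp : 1 ≤ p) {y : (Fin (k + 1) → Fin N) → ℝ}
    (hy : DualNormLeOne p y) :
    DualNormLeOne p (fun J : Fin k → Fin N =>
      (intRatio N p)⁻¹ * (1 / (N : ℝ) * ∑ i, y (Fin.cons i J))) := by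
  intro x hx
  have hc := intRatio_pos hN p
  have : Fact (1 ≤ p) := ⟨hp⟩
  have h1 : ‖WithLp.toLp p (fun J : Fin (k + 1) → Fin N =>
      (intRatio N p)⁻¹ * (x (Fin.tail J) / N))‖ ≤ 1 := by
    have : WithLp.toLp p (fun J : Fin (k + 1) → Fin N => (intRatio N p)⁻¹ * (x (Fin.tail J) / N))
      = (intRatio N p)⁻¹ • WithLp.toLp p (fun J : Fin (k + 1) → Fin N => x (Fin.tail J) / N) := rfl
    rw [this, norm_smul, Real.norm_of_nonneg (inv_nonneg.2 hc.le), inv_mul_le_iff₀ hc, mul_one]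
    exact (norm_toLp_tail_div_le hN hp x).trans (mul_le_of_le_one_right hc.le hx)
  refine le_trans (le_of_eq ?_) (hy _ h1)
  rw [sum_fin_succ_eq, Finset.sum_comm]
  refine Finset.sum_congr rfl fun J _ => ?_
  simp only [Fin.tail_cons, Finset.mul_sum]
  exact Finset.sum_congr rfl fun i _ => by ring

theorem DualNormLeOne.tail (hN : 1 ≤ N) (hp : 1 ≤ p) {y : (Fin k → Fin N) → ℝ}
    (hy : DualNormLeOne p y) :
    DualNormLeOne p (fun J : Fin (k + 1) → Fin N => intRatio N p * y (Fin.tail J)) := by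
  intro x hx
  have hc := intRatio_pos hN p
  have : Fact (1 ≤ p) := ⟨hp⟩
  have h1 : ‖WithLp.toLp p (fun J : Fin k → Fin N =>
      intRatio N p * ∑ i, x (Fin.cons i J))‖ ≤ 1 := by
    have : WithLp.toLp p (fun J : Fin k → Fin N => intRatio N p * ∑ i, x (Fin.cons i J))
      = intRatio N p • WithLp.toLp p (fun J : Fin k → Fin N => ∑ i, x (Fin.cons i J)) := rfl
    rw [this, norm_smul, Real.norm_of_nonneg hc.le]
    calc _ ≤ intRatio N p * ((intRatio N p)⁻¹ * ‖WithLp.toLp p x‖) :=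
          mul_le_mul_of_nonneg_left (norm_toLp_sum_cons_le hN hp x) hc.le
      _ = ‖WithLp.toLp p x‖ := by rw [mul_inv_cancel_left₀ hc.ne']
      _ ≤ 1 := hx
  refine le_trans (le_of_eq ?_) (hy _ h1)
  rw [sum_fin_succ_eq, Finset.sum_comm]
  refine Finset.sum_congr rfl fun J _ => ?_
  simp only [Fin.tail_cons, Finset.mul_sum, Finset.sum_mul]
  exact Finset.sum_congr rfl fun i _ => by ring

end Tensor

/-! ### Test functions on the cube and iterated divergences. -/

section TestFunctions

variable {N : ℕ} {f g : (Fin N → ℝ) → ℝ} {i : Fin N}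

theorem isOpen_Q : IsOpen (Q N) := isOpen_set_pi finite_univ fun _ _ => isOpen_Ioo

theorem measurableSet_Q : MeasurableSet (Q N) := isOpen_Q.measurableSet

theorem volume_Q : volume (Q N) = 1 := by
  rw [Q, Real.volume_pi_Ioo]
  simp

instance : IsProbabilityMeasure (μQ N) := ⟨by simp [volume_Q]⟩

theorem IsTest.hasCompactSupport (hf : IsTest f) : HasCompactSupport f := hf.2.1

theorem IsTest.continuous (hf : IsTest f) : Continuous f := hf.1.continuous

theorem IsTest.eq_zero (hf : IsTest f) {x : Fin N → ℝ} (hx : x ∉ Q N) : f x = 0 :=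
  image_eq_zero_of_notMem_tsupport fun h => hx (hf.2.2 h)

theorem IsTest.exists_bound (hf : IsTest f) : ∃ C, 0 ≤ C ∧ ∀ x, |f x| ≤ C := by
  obtain ⟨C, hC⟩ := hf.hasCompactSupport.exists_bound_of_continuous hf.continuous
  exact ⟨C, (norm_nonneg _).trans (hC 0), hC⟩

theorem contDiff_partialD (hf : ContDiff ℝ ∞ f) (i : Fin N) : ContDiff ℝ ∞ (partialD i f) :=
  (hf.fderiv_right (m := ∞) (by simp)).clm_apply contDiff_const

theorem IsTest.partialD (hf : IsTest f) (i : Fin N) : IsTest (partialD i f) :=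
  ⟨contDiff_partialD hf.1 i, hf.hasCompactSupport.fderiv_apply (𝕜 := ℝ) _,
    (tsupport_fderiv_apply_subset ℝ _).trans hf.2.2⟩

theorem IsTest.zero : IsTest (fun _ : Fin N → ℝ => (0 : ℝ)) :=
  ⟨contDiff_const, HasCompactSupport.zero, by simp [tsupport]⟩

theorem IsTest.add (hf : IsTest f) (hg : IsTest g) : IsTest (fun x => f x + g x) :=
  ⟨hf.1.add hg.1, hf.2.1.add hg.2.1,
    (tsupport_add f g).trans (union_subset hf.2.2 hg.2.2)⟩

theorem IsTest.const_mul (hf : IsTest f) (c : ℝ) : IsTest (fun x => c * f x) :=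
  ⟨contDiff_const.mul hf.1, hf.2.1.mul_left, (tsupport_mul_subset_right).trans hf.2.2⟩

theorem IsTest.neg (hf : IsTest f) : IsTest (fun x => -f x) := by
  simpa using hf.const_mul (-1)

theorem IsTest.sum {ι : Type*} (s : Finset ι) {F : ι → (Fin N → ℝ) → ℝ}
    (hF : ∀ j ∈ s, IsTest (F j)) : IsTest (fun x => ∑ j ∈ s, F j x) := by
  classical
  induction s using Finset.induction_on with
  | empty => simpa using IsTest.zero
  | insert a s ha ih =>
    simp_rw [Finset.sum_insert ha]
    exact (hF a (Finset.mem_insert_self a s)).add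
      (ih fun j hj => hF j (Finset.mem_insert_of_mem hj))

theorem partialD_const_mul (hf : ContDiff ℝ ∞ f) (c : ℝ) (i : Fin N) :
    partialD i (fun x => c * f x) = fun x => c * partialD i f x := by
  ext x
  have hd : DifferentiableAt ℝ f x := (hf.differentiable (by simp)) x
  simp only [FracTV.partialD]
  rw [fderiv_const_mul hd]
  rfl

theorem partialD_sum {ι : Type*} (s : Finset ι) {F : ι → (Fin N → ℝ) → ℝ}
    (hF : ∀ j ∈ s, ContDiff ℝ ∞ (F j)) (i : Fin N) :
    FracTV.partialD i (fun x => ∑ j ∈ s, F j x) = fun x => ∑ j ∈ s, FracTV.partialD i (F j) x := by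
  ext x
  simp only [FracTV.partialD]
  rw [fderiv_fun_sum fun j hj => ((hF j hj).differentiable (by simp)) x]
  simp

theorem IsTest.iterDiv : ∀ {k : ℕ} {φ : (Fin k → Fin N) → (Fin N → ℝ) → ℝ},
    (∀ J, IsTest (φ J)) → IsTest (iterDiv k φ)
  | 0, _, h => h _
  | _ + 1, _, h => IsTest.sum _ fun i _ => (IsTest.iterDiv fun J => h (Fin.cons i J)).partialD i

theorem iterDiv_const_mul (c : ℝ) : ∀ {k : ℕ} {φ : (Fin k → Fin N) → (Fin N → ℝ) → ℝ},
    (∀ J, IsTest (φ J)) → iterDiv k (fun J x => c * φ J x) = fun x => c * iterDiv k φ x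
  | 0, _, _ => rfl
  | k + 1, φ, h => by
    ext x
    simp only [FracTV.iterDiv, Finset.mul_sum]
    refine Finset.sum_congr rfl fun i _ => ?_
    rw [iterDiv_const_mul c fun J => h (Fin.cons i J),
      partialD_const_mul (IsTest.iterDiv fun J => h (Fin.cons i J)).1]

theorem iterDiv_sum {ι : Type*} (s : Finset ι) : ∀ {k : ℕ}
    {φ : ι → (Fin k → Fin N) → (Fin N → ℝ) → ℝ}, (∀ j J, IsTest (φ j J)) →
    iterDiv k (fun J x => ∑ j ∈ s, φ j J x) = fun x => ∑ j ∈ s, iterDiv k (φ j) x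
  | 0, _, _ => rfl
  | k + 1, φ, h => by
    ext x
    simp only [FracTV.iterDiv]
    rw [Finset.sum_comm]
    refine Finset.sum_congr rfl fun i _ => ?_
    rw [iterDiv_sum s fun j J => h j (Fin.cons i J),
      partialD_sum s fun j _ => (IsTest.iterDiv fun J => h j (Fin.cons i J)).1]

theorem hasDerivAt_line (hf : ContDiff ℝ ∞ f) (x : Fin N → ℝ) (i : Fin N) (t : ℝ) :
    HasDerivAt (fun t : ℝ => f (x + t • Pi.single i 1))
      (partialD i f (x + t • Pi.single i 1)) t := by
  have h1 : HasDerivAt (fun t : ℝ => x + t • (Pi.single i 1 : Fin N → ℝ))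
      (Pi.single i 1 : Fin N → ℝ) t := by
    simpa using ((hasDerivAt_id t).smul_const (Pi.single i 1 : Fin N → ℝ)).const_add x
  exact ((hf.differentiable (by simp)) _).hasFDerivAt.comp_hasDerivAt t h1

/-- One unit step from a point with positive coordinate leaves the cube. This removes every boundary
term at `t = 1` in the integrations by parts. -/
theorem line_notMem_Q {x : Fin N → ℝ} (hx : 0 < x i) {t : ℝ} (ht : 1 ≤ t) :
    x + t • (Pi.single i 1 : Fin N → ℝ) ∉ Q N := by
  intro h
  have := (h i (mem_univ i)).2
  simp at this
  linarith

theorem mem_Q_pos {x : Fin N → ℝ} (hx : x ∈ Q N) (i : Fin N) : 0 < x i := (hx i (mem_univ i)).1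

end TestFunctions

/-! ### The one-dimensional Riemann–Liouville derivative as a fractional integral. -/

section OneDim

/-- Passing to the second derivative replaces the singular kernel `τ^(-s)` by `τ^(1-s)/Γ(2-s)`,
which stays regular as `s → 1`. The sign in the definition cancels the one from the integration by
parts. -/
theorem rlRight_eq {s : ℝ} (hs1 : s < 1) {w w' w'' : ℝ → ℝ}
    (hw : ∀ t, HasDerivAt w (w' t) t) (hw' : ∀ t, HasDerivAt w' (w'' t) t)
    (hw'' : Continuous w'') (h0 : ∀ t, 1 ≤ t → w t = 0) (h0' : ∀ t, 1 ≤ t → w' t = 0)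
    {C : ℝ} (hC : ∀ t, |w' t| ≤ C) {x : ℝ} (hx : x ∈ Ioo (0 : ℝ) 1) :
    rlRight s w x = (Real.Gamma (2 - s))⁻¹ * ∫ τ in (0 : ℝ)..1, τ ^ (1 - s) * w'' (x + τ) := by
  have hwc : Continuous w := continuous_iff_continuousAt.2 fun t => (hw t).continuousAt
  have hwc' : Continuous w' := continuous_iff_continuousAt.2 fun t => (hw' t).continuousAt
  have hInt : ∀ a b : ℝ, IntervalIntegrable (fun τ : ℝ => τ ^ (-s)) volume a b := fun a b =>
    intervalIntegral.intervalIntegrable_rpow' (by linarith)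
  have hmul : ∀ (g : ℝ → ℝ), Continuous g → ∀ a b,
      IntervalIntegrable (fun τ : ℝ => τ ^ (-s) * g τ) volume a b := fun g hg a b =>
    (hInt a b).mul_continuousOn hg.continuousOn
  have h1 : ∀ y ∈ Ioo (0 : ℝ) 1,
      ∫ t in y..1, w t / (t - y) ^ s = ∫ τ in (0 : ℝ)..1, τ ^ (-s) * w (y + τ) := by
    intro y hy
    have e1 : ∫ t in y..1, w t / (t - y) ^ s = ∫ τ in (0 : ℝ)..(1 - y), τ ^ (-s) * w (y + τ) := by
      have := intervalIntegral.integral_comp_sub_right (a := y) (b := 1)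
        (fun τ => τ ^ (-s) * w (y + τ)) y
      rw [sub_self] at this
      rw [← this]
      refine intervalIntegral.integral_congr fun t ht => ?_
      rw [uIcc_of_le hy.2.le] at ht
      simp only [add_sub_cancel]
      rw [Real.rpow_neg (sub_nonneg.2 ht.1), div_eq_inv_mul]
    -- Since `w` vanishes beyond 1, the interval of integration can be fixed as `(0,1)`, and `y`
    -- remains only in the argument of `w`.
    have e2 : ∫ τ in (1 - y)..1, τ ^ (-s) * w (y + τ) = 0 := by
      rw [← intervalIntegral.integral_zero (μ := volume) (a := 1 - y) (b := 1)]
      refine intervalIntegral.integral_congr fun t ht => ?_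
      rw [uIcc_of_le (by linarith [hy.1])] at ht
      simp only [h0 (y + t) (by linarith [ht.1]), mul_zero]
    have hc : Continuous fun τ => w (y + τ) := hwc.comp (continuous_const.add continuous_id)
    rw [e1, ← intervalIntegral.integral_add_adjacent_intervals
      (hmul _ hc 0 (1 - y)) (hmul _ hc (1 - y) 1), e2, add_zero]
  have h2 : HasDerivAt (fun y => ∫ τ in (0 : ℝ)..1, τ ^ (-s) * w (y + τ))
      (∫ τ in (0 : ℝ)..1, τ ^ (-s) * w' (x + τ)) x := by
    have hm : ∀ (g : ℝ → ℝ), Continuous g → ∀ y, AEStronglyMeasurable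
        (fun τ => τ ^ (-s) * g (y + τ)) (volume.restrict (uIoc (0 : ℝ) 1)) := fun g hg y =>
      (hmul (fun τ => g (y + τ)) (hg.comp (continuous_const.add continuous_id)) 0 1).def'.1
    refine (intervalIntegral.hasDerivAt_integral_of_dominated_loc_of_deriv_le
      (bound := fun τ => τ ^ (-s) * C) (F := fun y τ => τ ^ (-s) * w (y + τ))
      (F' := fun y τ => τ ^ (-s) * w' (y + τ)) (univ_mem) (Eventually.of_forall fun y => hm w hwc y)
      (hmul _ (hwc.comp (continuous_const.add continuous_id)) 0 1) (hm w' hwc' x) ?_ ?_ ?_).2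
    · refine Eventually.of_forall fun t ht y _ => ?_
      rw [uIoc_of_le zero_le_one] at ht
      rw [norm_mul, Real.norm_of_nonneg (Real.rpow_nonneg ht.1.le _)]
      exact mul_le_mul_of_nonneg_left (hC _) (Real.rpow_nonneg ht.1.le _)
    · exact (hInt 0 1).mul_const C
    · refine Eventually.of_forall fun t _ y _ => ?_
      have := (hw (y + t)).comp_add_const y t
      exact this.const_mul _
  -- Both boundary terms vanish: `w'(x + 1) = 0` at the right end and `0^(1-s) = 0` at the left end.
  have h3 : ∫ τ in (0 : ℝ)..1, τ ^ (-s) * w' (x + τ)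
      = -(1 - s)⁻¹ * ∫ τ in (0 : ℝ)..1, τ ^ (1 - s) * w'' (x + τ) := by
    have hs' : (1 - s) ≠ 0 := by linarith
    have e := intervalIntegral.integral_mul_deriv_eq_deriv_mul_of_hasDerivAt (a := 0) (b := 1)
      (u := fun τ => w' (x + τ)) (u' := fun τ => w'' (x + τ))
      (v := fun τ => (1 - s)⁻¹ * τ ^ (1 - s)) (v' := fun τ => τ ^ (-s))
      (hwc'.comp (continuous_const.add continuous_id)).continuousOn
      (continuousOn_const.mul (Real.continuous_rpow_const (by linarith)).continuousOn)
      (fun t _ => by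
        have := (hw' (x + t)).comp_const_add x t
        exact this)
      (fun t ht => by
        simp only [zero_le_one, inf_of_le_left, sup_of_le_right] at ht
        have := (Real.hasDerivAt_rpow_const (x := t) (p := 1 - s) (Or.inl ht.1.ne')).const_mul
          (1 - s)⁻¹
        convert! this using 1
        rw [inv_mul_cancel_left₀ hs']
        congr 1; ring)
      ((hw''.comp (continuous_const.add continuous_id)).intervalIntegrable _ _) (hInt 0 1)
    rw [h0' (x + 1) (by linarith [hx.1]), Real.zero_rpow hs'] at e
    simp only [zero_mul, mul_zero, sub_self, zero_sub] at e
    rw [← intervalIntegral.integral_const_mul]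
    calc ∫ τ in (0 : ℝ)..1, τ ^ (-s) * w' (x + τ) = ∫ τ in (0 : ℝ)..1, w' (x + τ) * τ ^ (-s) := by
          congr 1; ext; ring
      _ = _ := by
          rw [e, ← intervalIntegral.integral_neg]
          congr 1; ext; ring
  have h4 : deriv (fun y => ∫ t in y..1, w t / (t - y) ^ s) x
      = ∫ τ in (0 : ℝ)..1, τ ^ (-s) * w' (x + τ) := by
    rw [← h2.deriv]
    refine Filter.EventuallyEq.deriv_eq ?_
    filter_upwards [Ioo_mem_nhds hx.1 hx.2] with y hy using h1 y hy
  have hG : Real.Gamma (2 - s) = (1 - s) * Real.Gamma (1 - s) := by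
    rw [← Real.Gamma_add_one (by linarith)]
    congr 1; ring
  rw [rlRight, h4, h3, hG, mul_inv, one_div]
  ring

end OneDim

/-! ### Convolution in a coordinate direction. -/

section DirConv

/-- Convolution with a kernel in the `i`-th coordinate direction. -/
def dirConv {N : ℕ} (K : ℝ → ℝ) (i : Fin N) (f : (Fin N → ℝ) → ℝ) (x : Fin N → ℝ) : ℝ :=
  ∫ t, K t * f (x + t • Pi.single i 1)

/-- The truncated Riemann-Liouville kernel of order `a`. -/
def rlKernel (a : ℝ) : ℝ → ℝ := indicator (Ioc 0 1) fun t => (Real.Gamma a)⁻¹ * t ^ (a - 1)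

theorem integrable_rlKernel {a : ℝ} (ha : 0 < a) : Integrable (rlKernel a) := by
  rw [rlKernel, integrable_indicator_iff measurableSet_Ioc]
  have := intervalIntegral.intervalIntegrable_rpow' (a := 0) (b := 1) (r := a - 1) (by linarith)
  rw [intervalIntegrable_iff_integrableOn_Ioc_of_le zero_le_one] at this
  exact this.const_mul _

variable {N : ℕ} {f : (Fin N → ℝ) → ℝ} {i : Fin N} {K : ℝ → ℝ}

theorem dirConv_rlKernel {a : ℝ} (f : (Fin N → ℝ) → ℝ) (i : Fin N) (x : Fin N → ℝ) :
    dirConv (rlKernel a) i f x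
      = (Real.Gamma a)⁻¹ * ∫ t in (0 : ℝ)..1, t ^ (a - 1) * f (x + t • Pi.single i 1) := by
  rw [dirConv, intervalIntegral.integral_of_le zero_le_one, ← integral_const_mul,
    ← integral_indicator measurableSet_Ioc]
  congr 1; ext t
  by_cases ht : t ∈ Ioc (0 : ℝ) 1
  · simp [rlKernel, ht, mul_assoc]
  · simp [rlKernel, ht]

/-- The fractional derivative of a test function as a fractional integral of its second
derivative. -/
theorem fracPartial_eq {s : ℝ} (hs1 : s < 1) (hf : IsTest f) (i : Fin N)
    {x : Fin N → ℝ} (hx : x ∈ Q N) :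
    fracPartial s i f x = dirConv (rlKernel (2 - s)) i (partialD i (partialD i f)) x := by
  have hline : ∀ t, Function.update x i t
      = Function.update x i 0 + t • (Pi.single i 1 : Fin N → ℝ) := by
    intro t; ext j
    by_cases h : j = i
    · subst h; simp
    · simp [h]
  have hnot : ∀ t, 1 ≤ t → Function.update x i t ∉ Q N := fun t ht h => by
    have := (h i (mem_univ i)).2
    simp at this
    linarith
  obtain ⟨C, -, hC⟩ := (hf.partialD i).exists_bound
  have hcont : Continuous fun t => partialD i (partialD i f) (Function.update x i t) :=
    ((hf.partialD i).partialD i).continuous.comp (by fun_prop)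
  rw [fracPartial, rlRight_eq hs1 (w' := fun t => partialD i f (Function.update x i t))
    (w'' := fun t => partialD i (partialD i f) (Function.update x i t)) ?_ ?_ hcont
    (fun t ht => hf.eq_zero (hnot t ht)) (fun t ht => (hf.partialD i).eq_zero (hnot t ht))
    (fun t => hC _) (hx i (mem_univ i)), dirConv_rlKernel]
  · congr 2; ext t
    rw [show (2 - s - 1) = 1 - s by ring]
    congr 2
    ext j
    by_cases h : j = i
    · subst h; simp
    · simp [h]
  · intro t
    rw [show (fun t => f (Function.update x i t)) = fun t => f (Function.update x i 0 +
      t • (Pi.single i 1 : Fin N → ℝ)) from funext fun t => by rw [← hline], hline t]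
    exact hasDerivAt_line hf.1 _ i t
  · intro t
    rw [show (fun t => partialD i f (Function.update x i t)) = fun t => partialD i f
      (Function.update x i 0 + t • (Pi.single i 1 : Fin N → ℝ)) from
      funext fun t => by rw [← hline], hline t]
    exact hasDerivAt_line (hf.partialD i).1 _ i t

theorem continuous_line (x : Fin N → ℝ) (i : Fin N) :
    Continuous fun t : ℝ => x + t • (Pi.single i 1 : Fin N → ℝ) := by fun_prop

theorem integrable_dirConv_integrand (hK : Integrable K) (hf : Continuous f) {C : ℝ}
    (hC : ∀ x, |f x| ≤ C) (i : Fin N) (x : Fin N → ℝ) :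
    Integrable fun t => K t * f (x + t • Pi.single i 1) :=
  hK.mul_bdd (hf.comp (continuous_line x i)).aestronglyMeasurable
    (Eventually.of_forall fun _ => hC _)

theorem hasFDerivAt_dirConv (hK : Integrable K) (hf : ContDiff ℝ ∞ f) (hc : HasCompactSupport f)
    (i : Fin N) (x : Fin N → ℝ) :
    HasFDerivAt (dirConv K i f) (∫ t, K t • fderiv ℝ f (x + t • Pi.single i 1)) x := by
  have hfd : Continuous (fderiv ℝ f) := hf.continuous_fderiv (by simp)
  have hm : AEStronglyMeasurable (fun t : ℝ => fderiv ℝ f (x + t • Pi.single i 1)) volume :=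
    (hfd.comp (continuous_line x i)).aestronglyMeasurable
  obtain ⟨C, hC⟩ := hc.exists_bound_of_continuous hf.continuous
  obtain ⟨C', hC'⟩ := (hc.fderiv (𝕜 := ℝ)).exists_bound_of_continuous hfd
  refine hasFDerivAt_integral_of_dominated_of_fderiv_le (bound := fun t => ‖K t‖ * C')
    (F' := fun x t => K t • fderiv ℝ f (x + t • Pi.single i 1)) univ_mem
    (Eventually.of_forall fun y => (integrable_dirConv_integrand hK hf.continuous hC i y).1)
    (integrable_dirConv_integrand hK hf.continuous hC i x)
    (hK.1.smul hm) ?_ (hK.norm.mul_const C') ?_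
  · refine Eventually.of_forall fun t y _ => ?_
    rw [norm_smul]
    exact mul_le_mul_of_nonneg_left (hC' _) (norm_nonneg _)
  · refine Eventually.of_forall fun t y _ => ?_
    have h1 := ((hf.differentiable (by simp)) (y + t • Pi.single i 1)).hasFDerivAt
    have h2 := h1.comp y ((hasFDerivAt_id y).add_const (t • Pi.single i 1))
    rw [ContinuousLinearMap.comp_id] at h2
    exact h2.const_mul (K t)

theorem fderiv_dirConv_apply (hK : Integrable K) (hf : ContDiff ℝ ∞ f) (hc : HasCompactSupport f)
    (i : Fin N) (x y : Fin N → ℝ) :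
    fderiv ℝ (dirConv K i f) x y = dirConv K i (fun z => fderiv ℝ f z y) x := by
  have hfd : Continuous (fderiv ℝ f) := hf.continuous_fderiv (by simp)
  obtain ⟨C', hC'⟩ := (hc.fderiv (𝕜 := ℝ)).exists_bound_of_continuous hfd
  rw [(hasFDerivAt_dirConv hK hf hc i x).fderiv, ContinuousLinearMap.integral_apply]
  · rfl
  · exact hK.smul_bdd C' (hfd.comp (continuous_line x i)).aestronglyMeasurable
      (Eventually.of_forall fun _ => hC' _)

theorem partialD_dirConv (hK : Integrable K) (hf : IsTest f) (i j : Fin N) :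
    partialD j (dirConv K i f) = dirConv K i (partialD j f) := by
  ext x
  exact fderiv_dirConv_apply hK hf.1 hf.2.1 i x _

/-- Differentiation falls on `f` alone, so smoothness follows by induction although the kernel is
merely integrable. -/
theorem contDiff_dirConv (hK : Integrable K) (hf : ContDiff ℝ ∞ f) (hc : HasCompactSupport f)
    (i : Fin N) : ContDiff ℝ ∞ (dirConv K i f) := by
  rw [contDiff_infty]
  intro n
  induction n generalizing f with
  | zero =>
    rw [Nat.cast_zero, contDiff_zero]
    exact continuous_iff_continuousAt.2 fun x => (hasFDerivAt_dirConv hK hf hc i x).continuousAt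
  | succ n ih =>
    rw [Nat.cast_succ, contDiff_succ_iff_fderiv_apply]
    refine ⟨fun x => (hasFDerivAt_dirConv hK hf hc i x).differentiableAt, by simp, fun y => ?_⟩
    simp_rw [fderiv_dirConv_apply hK hf hc]
    exact ih ((hf.fderiv_right (m := ∞) (by simp)).clm_apply contDiff_const)
      (hc.fderiv_apply (𝕜 := ℝ) y)

theorem abs_dirConv_le (hK : Integrable K) {C : ℝ} (hC : ∀ x, |f x| ≤ C) (i : Fin N)
    (x : Fin N → ℝ) : |dirConv K i f x| ≤ (∫ t, |K t|) * C := by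
  rw [← integral_mul_const]
  refine norm_integral_le_of_norm_le (f := fun t => K t * f (x + t • Pi.single i 1))
    (hK.abs.mul_const C) (Eventually.of_forall fun t => ?_)
  rw [norm_mul]
  exact mul_le_mul_of_nonneg_left (hC _) (abs_nonneg _)

end DirConv

/-! ### Continuity in the order, and the fractional divergence up to `s = 1`. -/

section Kernels

variable {N : ℕ} {f : (Fin N → ℝ) → ℝ} {i : Fin N}

/-- For orders at least 1 the powers `t^(a-1)` are at most 1 on `(0,1]` and `1/Γ` is locally
bounded, so a constant dominates. -/
theorem tendsto_integral_abs_rlKernel_sub {ι : Type*} {l : Filter ι} [l.IsCountablyGenerated]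
    {a : ι → ℝ} {a₀ : ℝ} (ha₀ : 1 ≤ a₀) (ha : ∀ᶠ n in l, 1 ≤ a n) (hlim : Tendsto a l (𝓝 a₀)) :
    Tendsto (fun n => ∫ t, |rlKernel (a n) t - rlKernel a₀ t|) l (𝓝 0) := by
  have hG : Tendsto (fun n => (Real.Gamma (a n))⁻¹) l (𝓝 (Real.Gamma a₀)⁻¹) := by
    have h1 : ContinuousAt Real.Gamma a₀ := (Real.differentiableAt_Gamma fun m => by
      have : (0 : ℝ) ≤ m := m.cast_nonneg
      linarith).continuousAt
    exact (h1.tendsto.comp hlim).inv₀ (Real.Gamma_pos_of_pos (by linarith)).ne'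
  set B := (Real.Gamma a₀)⁻¹ + 1 with hB
  have hev : ∀ᶠ n in l, (Real.Gamma (a n))⁻¹ ≤ B := by
    filter_upwards [hG.eventually (gt_mem_nhds (lt_add_one _))] with n hn using hn.le
  have hbd : ∀ b, 1 ≤ b → (Real.Gamma b)⁻¹ ≤ B → ∀ t,
      |rlKernel b t| ≤ (Ioc (0 : ℝ) 1).indicator (fun _ => B) t := by
    intro b hb hbB t
    have hpos : 0 < (Real.Gamma b)⁻¹ := inv_pos.2 (Real.Gamma_pos_of_pos (by linarith))
    by_cases ht : t ∈ Ioc (0 : ℝ) 1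
    · simp only [rlKernel, indicator_of_mem ht]
      rw [abs_of_nonneg (mul_nonneg hpos.le (Real.rpow_nonneg ht.1.le _))]
      calc _ ≤ (Real.Gamma b)⁻¹ * 1 := mul_le_mul_of_nonneg_left
            (Real.rpow_le_one ht.1.le ht.2 (by linarith)) hpos.le
        _ ≤ B := by rwa [mul_one]
    · simp [rlKernel, indicator_of_notMem ht]
  rw [show (0 : ℝ) = ∫ _ : ℝ, (0 : ℝ) by simp]
  refine tendsto_integral_filter_of_dominated_convergence
    ((Ioc (0 : ℝ) 1).indicator fun _ => 2 * B) ?_ ?_ ?_ ?_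
  · filter_upwards [ha] with n hn
    exact ((integrable_rlKernel (by linarith)).sub (integrable_rlKernel (by linarith))).abs.1
  · filter_upwards [ha, hev] with n hn hnB
    refine Eventually.of_forall fun t => ?_
    rw [Real.norm_eq_abs, abs_abs]
    have h1 := hbd _ hn hnB t
    have h2 := hbd a₀ ha₀ (by linarith) t
    refine (abs_sub _ _).trans ((add_le_add h1 h2).trans_eq ?_)
    by_cases ht : t ∈ Ioc (0 : ℝ) 1
    · simp only [indicator_of_mem ht]; ring
    · simp [indicator_of_notMem ht]
  · rw [integrable_indicator_iff measurableSet_Ioc]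
    exact integrableOn_const (by simp)
  · refine Eventually.of_forall fun t => ?_
    by_cases ht : t ∈ Ioc (0 : ℝ) 1
    · simp only [rlKernel, indicator_of_mem ht]
      have h1 : Tendsto (fun n => t ^ (a n - 1)) l (𝓝 (t ^ (a₀ - 1))) :=
        (Real.continuousAt_const_rpow ht.1.ne').tendsto.comp (hlim.sub_const 1)
      have := ((hG.mul h1).sub_const ((Real.Gamma a₀)⁻¹ * t ^ (a₀ - 1))).abs
      simpa using this
    · simp [rlKernel, indicator_of_notMem ht, tendsto_const_nhds]

theorem abs_dirConv_sub_le {K K' : ℝ → ℝ} (hK : Integrable K) (hK' : Integrable K')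
    (hf : Continuous f) {C : ℝ} (hC : ∀ x, |f x| ≤ C) (i : Fin N) (x : Fin N → ℝ) :
    |dirConv K i f x - dirConv K' i f x| ≤ (∫ t, |K t - K' t|) * C := by
  have : dirConv K i f x - dirConv K' i f x = dirConv (fun t => K t - K' t) i f x := by
    simp only [dirConv]
    rw [← integral_sub (integrable_dirConv_integrand hK hf hC i x)
      (integrable_dirConv_integrand hK' hf hC i x)]
    congr 1; ext t; ring
  rw [this]
  exact abs_dirConv_le (hK.sub hK') hC i x

theorem dirConv_rlKernel_one_partialD (hf : IsTest f) {x : Fin N → ℝ} (hx : 0 < x i) :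
    dirConv (rlKernel 1) i (partialD i f) x = -f x := by
  rw [dirConv_rlKernel]
  simp only [Real.Gamma_one, inv_one, one_mul, sub_self, Real.rpow_zero]
  rw [intervalIntegral.integral_eq_sub_of_hasDerivAt (f := fun t => f (x + t • Pi.single i 1))
    (fun t _ => hasDerivAt_line hf.1 x i t)
    (((hf.partialD i).continuous.comp (continuous_line x i)).intervalIntegrable _ _),
    hf.eq_zero (line_notMem_Q hx le_rfl)]
  simp

/-- Integration by parts lowers the order by one. The boundary terms vanish because `t^a` is 0 at 0
and `f` vanishes one unit further along the line. -/
theorem dirConv_rlKernel_succ_partialD (hf : IsTest f) {x : Fin N → ℝ} (hx : 0 < x i) {a : ℝ}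
    (ha : 1 ≤ a) :
    dirConv (rlKernel (a + 1)) i (partialD i f) x = -dirConv (rlKernel a) i f x := by
  rw [dirConv_rlKernel, dirConv_rlKernel, Real.Gamma_add_one (by linarith)]
  have hc : Continuous fun t : ℝ => t ^ (a - 1) := Real.continuous_rpow_const (by linarith)
  have e := intervalIntegral.integral_mul_deriv_eq_deriv_mul_of_hasDerivAt (a := 0) (b := 1)
    (u := fun t : ℝ => t ^ a) (u' := fun t => a * t ^ (a - 1))
    (v := fun t => f (x + t • Pi.single i 1))
    (v' := fun t => partialD i f (x + t • Pi.single i 1))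
    (Real.continuous_rpow_const (by linarith)).continuousOn
    (hf.continuous.comp (continuous_line x i)).continuousOn
    (fun t ht => Real.hasDerivAt_rpow_const (Or.inr ha))
    (fun t _ => hasDerivAt_line hf.1 x i t)
    ((hc.const_mul a).intervalIntegrable _ _)
    (((hf.partialD i).continuous.comp (continuous_line x i)).intervalIntegrable _ _)
  rw [hf.eq_zero (line_notMem_Q hx le_rfl), Real.zero_rpow (by linarith)] at e
  simp only [mul_zero, zero_mul, sub_zero, zero_sub] at e
  rw [add_sub_cancel_right, e]
  simp_rw [mul_assoc a]
  rw [intervalIntegral.integral_const_mul, mul_inv]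
  have : a ≠ 0 := by linarith
  field_simp

/-- The operator `div^s div^k` extended to `s = 1`, and to all of space. -/
def extDiv (s : ℝ) (k : ℕ) (φ : (Fin (k + 1) → Fin N) → (Fin N → ℝ) → ℝ) (x : Fin N → ℝ) : ℝ :=
  ((1 - 1 / (N : ℝ)) * s + 1 / (N : ℝ)) * ∑ i, dirConv (rlKernel (2 - s)) i
    (partialD i (partialD i (iterDiv k fun J => φ (Fin.cons i J)))) x

variable {k : ℕ} {φ : (Fin (k + 1) → Fin N) → (Fin N → ℝ) → ℝ}

theorem fracIterDiv_eq_extDiv {s : ℝ} (hs : s < 1) (hφ : ∀ J, IsTest (φ J)) {x : Fin N → ℝ}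
    (hx : x ∈ Q N) : fracIterDiv s k φ x = extDiv s k φ x := by
  simp only [fracIterDiv, fracDiv, extDiv]
  congr 1
  exact Finset.sum_congr rfl fun i _ =>
    fracPartial_eq hs (IsTest.iterDiv fun J => hφ (Fin.cons i J)) i hx

/-- At `s = 0` two integrations undo the two derivatives, and the weight equals `1/N`: what remains
is an average over the first index. -/
theorem extDiv_zero (hφ : ∀ J, IsTest (φ J)) {x : Fin N → ℝ} (hx : x ∈ Q N) :
    extDiv 0 k φ x = 1 / (N : ℝ) * ∑ i, iterDiv k (fun J => φ (Fin.cons i J)) x := by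
  simp only [extDiv, mul_zero, zero_add]
  congr 1
  refine Finset.sum_congr rfl fun i _ => ?_
  have ht := IsTest.iterDiv fun J => hφ (Fin.cons i J)
  rw [show (2 - 0 : ℝ) = 1 + 1 by norm_num, dirConv_rlKernel_succ_partialD (ht.partialD i)
    (mem_Q_pos hx i) le_rfl, dirConv_rlKernel_one_partialD ht (mem_Q_pos hx i), neg_neg]

/-- At `s = 1` the weight equals 1 and a single integration undoes one derivative. The minus sign is
that of the right-sided derivative. -/
theorem extDiv_one (hφ : ∀ J, IsTest (φ J)) {x : Fin N → ℝ} (hx : x ∈ Q N) :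
    extDiv 1 k φ x = -iterDiv (k + 1) φ x := by
  simp only [extDiv, mul_one, sub_add_cancel, one_mul, iterDiv]
  rw [← Finset.sum_neg_distrib]
  refine Finset.sum_congr rfl fun i _ => ?_
  have ht := IsTest.iterDiv fun J => hφ (Fin.cons i J)
  rw [show (2 - 1 : ℝ) = 1 by norm_num, dirConv_rlKernel_one_partialD (ht.partialD i)
    (mem_Q_pos hx i)]

theorem continuous_extDiv {s : ℝ} (hs : s ≤ 1) (hφ : ∀ J, IsTest (φ J)) :
    Continuous (extDiv s k φ) := by
  refine continuous_const.mul (continuous_finsetSum _ fun i _ => ?_)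
  have ht := ((IsTest.iterDiv fun J => hφ (Fin.cons i J)).partialD i).partialD i
  exact (contDiff_dirConv (integrable_rlKernel (by linarith)) ht.1 ht.2.1 i).continuous

theorem exists_extDiv_bound {s : ℝ} (hs : s ≤ 1) (hφ : ∀ J, IsTest (φ J)) :
    ∃ B, ∀ x, |extDiv s k φ x| ≤ B := by
  have ht := fun i => ((IsTest.iterDiv fun J => hφ (Fin.cons i J)).partialD i).partialD i
  choose C _ hC using fun i => (ht i).exists_bound
  refine ⟨|(1 - 1 / (N : ℝ)) * s + 1 / (N : ℝ)| * ∑ i, (∫ t, |rlKernel (2 - s) t|) * C i,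
    fun x => ?_⟩
  rw [extDiv, abs_mul]
  refine mul_le_mul_of_nonneg_left ((Finset.abs_sum_le_sum_abs _ _).trans
    (Finset.sum_le_sum fun i _ => ?_)) (abs_nonneg _)
  exact abs_dirConv_le (integrable_rlKernel (by linarith)) (hC i) i x

/-- The kernels converge in `L^1` and are applied to fixed bounded functions, so the error does not
depend on `x`. The factor `c n` accommodates the rescaling of the field between different exponents.
-/
theorem extDiv_tendsto_uniformly {l : Filter ℕ} [l.IsCountablyGenerated] {s c : ℕ → ℝ} {s₀ : ℝ}
    (hs₀ : s₀ ≤ 1) (hs : ∀ᶠ n in l, s n ≤ 1) (hlim : Tendsto s l (𝓝 s₀))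
    (hc : Tendsto c l (𝓝 1)) (hφ : ∀ J, IsTest (φ J)) :
    ∃ ε : ℕ → ℝ, Tendsto ε l (𝓝 0) ∧ ∀ᶠ n in l, ∀ x,
      |c n * extDiv (s n) k φ x - extDiv s₀ k φ x| ≤ ε n := by
  have ht := fun i => ((IsTest.iterDiv fun J => hφ (Fin.cons i J)).partialD i).partialD i
  choose C _ hC using fun i => (ht i).exists_bound
  let w : ℝ → ℝ := fun s => (1 - 1 / (N : ℝ)) * s + 1 / (N : ℝ)
  let κ : ℕ → ℝ := fun n => ∫ t, |rlKernel (2 - s n) t - rlKernel (2 - s₀) t|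
  have hκ : Tendsto κ l (𝓝 0) := by
    refine tendsto_integral_abs_rlKernel_sub (by linarith) ?_ (hlim.const_sub 2)
    filter_upwards [hs] with n hn; linarith
  let b : Fin N → ℝ := fun i => (∫ t, |rlKernel (2 - s₀) t|) * C i
  have hw : Tendsto (fun n => c n * w (s n)) l (𝓝 (w s₀)) := by
    have := hc.mul ((hlim.const_mul (1 - 1 / (N : ℝ))).add_const (1 / (N : ℝ)))
    simpa [w] using this
  refine ⟨fun n => ∑ i, (|c n * w (s n)| * (κ n * C i) + |c n * w (s n) - w s₀| * b i), ?_, ?_⟩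
  · rw [show (0 : ℝ) = ∑ i : Fin N, (|w s₀| * (0 * C i) + |w s₀ - w s₀| * b i) by simp]
    exact tendsto_finsetSum _ fun i _ => (hw.abs.mul (hκ.mul_const _)).add
      ((hw.sub_const _).abs.mul_const _)
  · filter_upwards [hs] with n hn x
    have e : c n * extDiv (s n) k φ x - extDiv s₀ k φ x = ∑ i, (c n * w (s n) *
        (dirConv (rlKernel (2 - s n)) i
          (partialD i (partialD i (iterDiv k fun J => φ (Fin.cons i J)))) x
        - dirConv (rlKernel (2 - s₀)) i
          (partialD i (partialD i (iterDiv k fun J => φ (Fin.cons i J)))) x)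
        + (c n * w (s n) - w s₀) * dirConv (rlKernel (2 - s₀)) i
          (partialD i (partialD i (iterDiv k fun J => φ (Fin.cons i J)))) x) := by
      simp only [extDiv, w, Finset.mul_sum]
      rw [← Finset.sum_sub_distrib]
      exact Finset.sum_congr rfl fun i _ => by ring
    rw [e]
    refine (Finset.abs_sum_le_sum_abs _ _).trans (Finset.sum_le_sum fun i _ => ?_)
    refine (abs_add_le _ _).trans ?_
    have h1 := abs_dirConv_sub_le (integrable_rlKernel (a := 2 - s n) (by linarith))
      (integrable_rlKernel (a := 2 - s₀) (by linarith)) (ht i).continuous (hC i) i x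
    have h2 := abs_dirConv_le (integrable_rlKernel (a := 2 - s₀) (by linarith)) (hC i) i x
    exact add_le_add ((abs_mul _ _).trans_le (mul_le_mul_of_nonneg_left h1 (abs_nonneg _)))
      ((abs_mul _ _).trans_le (mul_le_mul_of_nonneg_left h2 (abs_nonneg _)))

end Kernels

/-! ### Lower semicontinuity for a fixed integer part of the order. -/

section Semicontinuity

variable {N : ℕ} {p : ℝ≥0∞} {m k : ℕ}

/-- The total variation of order `k + s`, with `k` and `s` as separate arguments. -/
def splitTV (p : ℝ≥0∞) (s : ℝ) (k : ℕ) (u : (Fin N → ℝ) → ℝ) : ℝ≥0∞ :=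
  ⨆ (φ : (Fin (k + 1) → Fin N) → (Fin N → ℝ) → ℝ) (_ : Admissible p (k + 1) φ),
    ENNReal.ofReal (∫ x in Q N, u x * fracIterDiv s k φ x)

theorem fracTV_eq_splitTV (p : ℝ≥0∞) {r : ℝ} (hk : ⌊r⌋₊ = k) (u : (Fin N → ℝ) → ℝ) :
    fracTV p r u = splitTV p (r - k) k u := by
  subst hk; rfl

theorem le_splitTV {s : ℝ} (hs : s < 1) {u : (Fin N → ℝ) → ℝ}
    {φ : (Fin (k + 1) → Fin N) → (Fin N → ℝ) → ℝ} (hφ : Admissible p (k + 1) φ) :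
    ENNReal.ofReal (∫ x in Q N, u x * extDiv s k φ x) ≤ splitTV p s k u := by
  rw [setIntegral_congr_fun measurableSet_Q (g := fun x => u x * fracIterDiv s k φ x)
    fun x hx => by simp only [fracIterDiv_eq_extDiv hs hφ.1 hx]]
  exact le_iSup₂ (f := fun φ (_ : Admissible p (k + 1) φ) =>
    ENNReal.ofReal (∫ x in Q N, u x * fracIterDiv s k φ x)) φ hφ

theorem splitTV_le {s : ℝ} (hs : s < 1) {u : (Fin N → ℝ) → ℝ} {T : ℝ≥0∞}
    (h : ∀ φ : (Fin (k + 1) → Fin N) → (Fin N → ℝ) → ℝ, Admissible p (k + 1) φ →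
      ENNReal.ofReal (∫ x in Q N, u x * extDiv s k φ x) ≤ T) : splitTV p s k u ≤ T := by
  refine iSup₂_le fun φ hφ => ?_
  rw [setIntegral_congr_fun measurableSet_Q (g := fun x => u x * extDiv s k φ x)
    fun x hx => by simp only [fracIterDiv_eq_extDiv hs hφ.1 hx]]
  exact h φ hφ

theorem le_intTV {u : (Fin N → ℝ) → ℝ} {φ : (Fin k → Fin N) → (Fin N → ℝ) → ℝ}
    (hφ : Admissible p k φ) :
    ENNReal.ofReal (∫ x in Q N, u x * iterDiv k φ x) ≤ intTV p k u :=
  le_iSup₂ (f := fun φ (_ : Admissible p k φ) =>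
    ENNReal.ofReal (∫ x in Q N, u x * iterDiv k φ x)) φ hφ

theorem extDiv_const_mul (s c : ℝ) {φ : (Fin (k + 1) → Fin N) → (Fin N → ℝ) → ℝ}
    (hφ : ∀ J, IsTest (φ J)) (x : Fin N → ℝ) :
    extDiv s k (fun J x => c * φ J x) x = c * extDiv s k φ x := by
  simp only [extDiv, Finset.mul_sum]
  refine Finset.sum_congr rfl fun i _ => ?_
  have ht := IsTest.iterDiv fun J => hφ (Fin.cons i J)
  rw [iterDiv_const_mul c fun J => hφ (Fin.cons i J), partialD_const_mul ht.1,
    partialD_const_mul (ht.partialD i).1]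
  have : ∀ (K : ℝ → ℝ) (g : (Fin N → ℝ) → ℝ),
      dirConv K i (fun x => c * g x) x = c * dirConv K i g x := fun K g => by
    simp only [dirConv]
    rw [← integral_const_mul]
    congr 1; ext t; ring
  rw [this]
  ring

/-- The factor comparing the constraints `|φ|^*_{ℓ^p} ≤ 1` and `|φ|^*_{ℓ^q} ≤ 1`. -/
def cmpFactor (N m : ℕ) (p q : ℝ≥0∞) : ℝ :=
  (((N : ℝ) ^ m) ^ |(q⁻¹).toReal - (p⁻¹).toReal|)⁻¹

theorem cmpFactor_pos (hN : 1 ≤ N) (m : ℕ) (p q : ℝ≥0∞) : 0 < cmpFactor N m p q :=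
  inv_pos.2 (Real.rpow_pos_of_pos (pow_pos (by exact_mod_cast hN) _) _)

theorem Admissible.scale (hN : 1 ≤ N) {q : ℝ≥0∞} (hp : 1 ≤ p) (hq : 1 ≤ q)
    {φ : (Fin m → Fin N) → (Fin N → ℝ) → ℝ} (hφ : Admissible q m φ) :
    Admissible p m (fun J x => cmpFactor N m p q * φ J x) := by
  refine ⟨fun J => (hφ.1 J).const_mul _, fun x => ?_⟩
  have : NeZero N := ⟨by omega⟩
  have hc := Real.rpow_pos_of_pos (pow_pos (a := (N : ℝ)) (by exact_mod_cast hN) m)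
    |(q⁻¹).toReal - (p⁻¹).toReal|
  refine (hφ.2 x).of_norm_le hc (fun y => ?_) hq
  have := norm_toLp_le_card_rpow_mul hq hp y
  simpa using this

theorem tendsto_cmpFactor (hN : 1 ≤ N) (m : ℕ) {l : Filter ℕ} {p : ℕ → ℝ≥0∞} {p₀ : ℝ≥0∞}
    (hp₀ : 1 ≤ p₀) (hlim : Tendsto p l (𝓝 p₀)) :
    Tendsto (fun n => cmpFactor N m (p n) p₀) l (𝓝 1) := by
  have hD : (0 : ℝ) < (N : ℝ) ^ m := pow_pos (by exact_mod_cast hN) _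
  have h1 : Tendsto (fun n => ((p n)⁻¹).toReal) l (𝓝 (p₀⁻¹).toReal) := by
    refine (ENNReal.tendsto_toReal ?_).comp ((continuous_inv.tendsto p₀).comp hlim)
    simpa using (zero_lt_one.trans_le hp₀).ne'
  have h2 : Tendsto (fun n => |(p₀⁻¹).toReal - ((p n)⁻¹).toReal|) l (𝓝 0) := by
    have := (h1.const_sub (p₀⁻¹).toReal).abs
    simpa using this
  have h3 := ((Real.continuousAt_const_rpow hD.ne').tendsto.comp h2).inv₀ (by simp)
  simpa [cmpFactor, Function.comp_def] using h3

theorem Admissible.neg (hp : 1 ≤ p) {φ : (Fin m → Fin N) → (Fin N → ℝ) → ℝ}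
    (hφ : Admissible p m φ) : Admissible p m (fun J x => -φ J x) :=
  ⟨fun J => (hφ.1 J).neg, fun x => (hφ.2 x).neg hp⟩

/-- The average of a tensor field over its first index. -/
def avgFirst (φ : (Fin (k + 1) → Fin N) → (Fin N → ℝ) → ℝ) (J : Fin k → Fin N)
    (x : Fin N → ℝ) : ℝ := 1 / (N : ℝ) * ∑ i, φ (Fin.cons i J) x

theorem isTest_avgFirst {φ : (Fin (k + 1) → Fin N) → (Fin N → ℝ) → ℝ} (hφ : ∀ J, IsTest (φ J))
    (J : Fin k → Fin N) : IsTest (avgFirst φ J) :=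
  (IsTest.sum _ fun i _ => hφ (Fin.cons i J)).const_mul _

theorem iterDiv_avgFirst {φ : (Fin (k + 1) → Fin N) → (Fin N → ℝ) → ℝ} (hφ : ∀ J, IsTest (φ J))
    {x : Fin N → ℝ} (hx : x ∈ Q N) : iterDiv k (avgFirst φ) x = extDiv 0 k φ x := by
  rw [extDiv_zero hφ hx]
  have h1 := iterDiv_const_mul (1 / (N : ℝ)) (k := k) (φ := fun J x => ∑ i, φ (Fin.cons i J) x)
    fun J => IsTest.sum _ fun i _ => hφ (Fin.cons i J)
  have h2 := iterDiv_sum Finset.univ (k := k) (φ := fun i J x => φ (Fin.cons i J) x)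
    fun i J => hφ (Fin.cons i J)
  unfold avgFirst
  rw [h1, h2]

/-- At integer orders, the two total variations differ by the factor `N^{1/p-1}`. -/
theorem splitTV_zero (hN : 1 ≤ N) (hp : 1 ≤ p) (k : ℕ) (u : (Fin N → ℝ) → ℝ) :
    splitTV p 0 k u = ENNReal.ofReal (intRatio N p) * intTV p k u := by
  have hc := intRatio_pos hN p
  apply le_antisymm
  · refine splitTV_le zero_lt_one fun φ hφ => ?_
    have hadm : Admissible p k (fun J x => (intRatio N p)⁻¹ * avgFirst φ J x) :=
      ⟨fun J => (isTest_avgFirst hφ.1 J).const_mul _, fun x => (hφ.2 x).average hN hp⟩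
    have h1 := le_intTV (u := u) hadm
    have h2 : ∫ x in Q N, u x * extDiv 0 k φ x = intRatio N p *
        ∫ x in Q N, u x * iterDiv k (fun J x => (intRatio N p)⁻¹ * avgFirst φ J x) x := by
      rw [← integral_const_mul]
      refine setIntegral_congr_fun measurableSet_Q fun x hx => ?_
      simp only [iterDiv_const_mul _ (isTest_avgFirst hφ.1), iterDiv_avgFirst hφ.1 hx]
      field_simp
    rw [h2, ENNReal.ofReal_mul hc.le]
    gcongr
  · simp only [intTV, ENNReal.mul_iSup]
    refine iSup₂_le fun ψ hψ => ?_
    have hadm : Admissible p (k + 1)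
        (fun (J : Fin (k + 1) → Fin N) x => intRatio N p * ψ (Fin.tail J) x) :=
      ⟨fun J => (hψ.1 _).const_mul _, fun x => (hψ.2 x).tail hN hp⟩
    refine le_trans (le_of_eq ?_) (le_splitTV zero_lt_one hadm)
    rw [← ENNReal.ofReal_mul hc.le, ← integral_const_mul]
    congr 1
    refine setIntegral_congr_fun measurableSet_Q fun x hx => ?_
    simp only [extDiv_zero hadm.1 hx, Fin.tail_cons, iterDiv_const_mul _ hψ.1]
    have : (N : ℝ) ≠ 0 := by positivity
    simp only [Finset.sum_const, Finset.card_univ, Fintype.card_fin, nsmul_eq_mul]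
    field_simp

theorem intTV_ge_splitTV_zero (hN : 1 ≤ N) (hp : 1 ≤ p) (k : ℕ) (u : (Fin N → ℝ) → ℝ) :
    splitTV p 0 k u ≤ intTV p k u := by
  rw [splitTV_zero hN hp]
  refine mul_le_of_le_one_left zero_le ?_
  rw [← ENNReal.ofReal_one]
  exact ENNReal.ofReal_le_ofReal (intRatio_le_one hN hp)

theorem splitTV_le_mul (hN : 1 ≤ N) {q : ℝ≥0∞} (hp : 1 ≤ p) (hq : 1 ≤ q) {s : ℝ} (hs : s < 1)
    (k : ℕ) (u : (Fin N → ℝ) → ℝ) :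
    splitTV q s k u ≤ ENNReal.ofReal ((N : ℝ) ^ (k + 1)) * splitTV p s k u := by
  refine splitTV_le hs fun φ hφ => ?_
  have h1 := le_splitTV (u := u) hs (Admissible.scale hN hp hq hφ)
  have hc := cmpFactor_pos hN (k + 1) p q
  have hN1 : (1 : ℝ) ≤ (N : ℝ) ^ (k + 1) := one_le_pow₀ (by exact_mod_cast hN)
  have hle : (cmpFactor N (k + 1) p q)⁻¹ ≤ (N : ℝ) ^ (k + 1) := by
    rw [cmpFactor, inv_inv]
    conv_rhs => rw [← Real.rpow_one ((N : ℝ) ^ (k + 1))]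
    refine Real.rpow_le_rpow_of_exponent_le hN1 ?_
    have h01 : ∀ {a : ℝ≥0∞}, 1 ≤ a → 0 ≤ (a⁻¹).toReal ∧ (a⁻¹).toReal ≤ 1 := fun ha =>
      ⟨ENNReal.toReal_nonneg, by
        rw [← ENNReal.toReal_one]
        exact ENNReal.toReal_mono ENNReal.one_ne_top (ENNReal.inv_le_one.2 ha)⟩
    rw [abs_le]
    constructor <;> linarith [(h01 hp).1, (h01 hp).2, (h01 hq).1, (h01 hq).2]
  have h2 : ∫ x in Q N, u x * extDiv s k φ x = (cmpFactor N (k + 1) p q)⁻¹ *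
      ∫ x in Q N, u x * extDiv s k (fun J x => cmpFactor N (k + 1) p q * φ J x) x := by
    rw [← integral_const_mul]
    congr 1; ext x
    rw [extDiv_const_mul _ _ hφ.1]
    field_simp
  rw [h2, ENNReal.ofReal_mul (inv_nonneg.2 hc.le)]
  gcongr

/-- Convergence tested by bounded functions, along a filter, of a sequence bounded in `L^1`. -/
structure WeakL1 (l : Filter ℕ) (u : ℕ → (Fin N → ℝ) → ℝ) (v : (Fin N → ℝ) → ℝ) : Prop where
  int : ∀ n, Integrable (u n) (μQ N)
  bdd : ∃ A, ∀ n, ∫ x in Q N, |u n x| ≤ A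
  lim : ∀ g : (Fin N → ℝ) → ℝ, Continuous g → (∃ B, ∀ x, |g x| ≤ B) →
    Tendsto (fun n => ∫ x in Q N, u n x * g x) l (𝓝 (∫ x in Q N, v x * g x))

theorem WeakL1.mono {l l' : Filter ℕ} {u : ℕ → (Fin N → ℝ) → ℝ} {v : (Fin N → ℝ) → ℝ}
    (h : WeakL1 l u v) (hl : l' ≤ l) : WeakL1 l' u v :=
  ⟨h.int, h.bdd, fun g hg hB => (h.lim g hg hB).mono_left hl⟩

/-- The `L^1` bound on `u n` and the uniform convergence of `F n` give `∫ u_n F_n → ∫ v F₀`.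
Semicontinuity is phrased through `y < T n`, which passes directly to suprema and works along any
filter. -/
theorem WeakL1.eventually_lt {l : Filter ℕ} {u : ℕ → (Fin N → ℝ) → ℝ} {v : (Fin N → ℝ) → ℝ}
    (h : WeakL1 l u v) {F : ℕ → (Fin N → ℝ) → ℝ} {F₀ : (Fin N → ℝ) → ℝ}
    (hF : ∀ᶠ n in l, Continuous (F n) ∧ ∃ B, ∀ x, |F n x| ≤ B)
    (hF₀ : Continuous F₀) (hB : ∃ B, ∀ x, |F₀ x| ≤ B)
    (hε : ∃ ε : ℕ → ℝ, Tendsto ε l (𝓝 0) ∧ ∀ᶠ n in l, ∀ x, |F n x - F₀ x| ≤ ε n)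
    {T : ℕ → ℝ≥0∞} (hT : ∀ᶠ n in l, ENNReal.ofReal (∫ x in Q N, u n x * F n x) ≤ T n)
    {y : ℝ≥0∞} (hy : y < ENNReal.ofReal (∫ x in Q N, v x * F₀ x)) : ∀ᶠ n in l, y < T n := by
  obtain ⟨A, hA⟩ := h.bdd
  obtain ⟨ε, hε0, hε⟩ := hε
  obtain ⟨B₀, hB₀⟩ := hB
  have hInt : ∀ n {g : (Fin N → ℝ) → ℝ}, Continuous g → (∃ B, ∀ x, |g x| ≤ B) →
      Integrable (fun x => u n x * g x) (μQ N) := fun n g hg ⟨B, hB⟩ =>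
    (h.int n).mul_bdd hg.aestronglyMeasurable (Eventually.of_forall hB)
  have hlim : Tendsto (fun n => ∫ x in Q N, u n x * F n x) l (𝓝 (∫ x in Q N, v x * F₀ x)) := by
    have h0 : Tendsto (fun n => (∫ x in Q N, u n x * F n x) - ∫ x in Q N, u n x * F₀ x) l
        (𝓝 0) := by
      have hA0 : Tendsto (fun n => |ε n| * A) l (𝓝 0) := by simpa using hε0.abs.mul_const A
      refine squeeze_zero_norm' ?_ hA0
      filter_upwards [hF, hε] with n hFn hn
      rw [← integral_sub (hInt n hFn.1 hFn.2) (hInt n hF₀ ⟨B₀, hB₀⟩)]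
      calc ‖∫ x in Q N, (u n x * F n x - u n x * F₀ x)‖ ≤ ∫ x in Q N, |ε n| * |u n x| := by
            refine norm_integral_le_of_norm_le ((h.int n).abs.const_mul _)
              (Eventually.of_forall fun x => ?_)
            rw [← mul_sub, norm_mul, mul_comm]
            exact mul_le_mul_of_nonneg_right ((hn x).trans (le_abs_self _)) (abs_nonneg _)
        _ ≤ |ε n| * A := by
            rw [integral_const_mul]
            exact mul_le_mul_of_nonneg_left (hA n) (abs_nonneg _)
    simpa using h0.add (h.lim F₀ hF₀ ⟨B₀, hB₀⟩)
  have := (ENNReal.tendsto_ofReal hlim).eventually (lt_mem_nhds hy)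
  filter_upwards [this, hT] with n h1 h2 using h1.trans_le h2

variable {l : Filter ℕ} {u : ℕ → (Fin N → ℝ) → ℝ} {v : (Fin N → ℝ) → ℝ}
  {P : ℕ → ℝ≥0∞} {p₀ : ℝ≥0∞}

/-- A near-optimal field for the limit, multiplied by `cmpFactor → 1`, is admissible for the
exponent `P n`. -/
theorem WeakL1.eventually_lt_splitTV [l.IsCountablyGenerated] (h : WeakL1 l u v)
    (hN : 1 ≤ N) (hP : ∀ n, 1 ≤ P n) (hp₀ : 1 ≤ p₀) (hlim : Tendsto P l (𝓝 p₀)) {s : ℕ → ℝ} {s₀ : ℝ} (hs₀ : s₀ < 1)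
    (hs : Tendsto s l (𝓝 s₀)) {y : ℝ≥0∞} (hy : y < splitTV p₀ s₀ k v) :
    ∀ᶠ n in l, y < splitTV (P n) (s n) k (u n) := by
  have hs1 : ∀ᶠ n in l, s n < 1 := hs.eventually (gt_mem_nhds hs₀)
  obtain ⟨φ, hφ, hy⟩ : ∃ φ : (Fin (k + 1) → Fin N) → (Fin N → ℝ) → ℝ, Admissible p₀ (k + 1) φ ∧
      y < ENNReal.ofReal (∫ x in Q N, v x * extDiv s₀ k φ x) := by
    by_contra! hcon
    exact absurd hy (not_lt.2 (splitTV_le hs₀ hcon))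
  refine h.eventually_lt
    (F := fun n => extDiv (s n) k fun J x => cmpFactor N (k + 1) (P n) p₀ * φ J x) ?_
    (continuous_extDiv hs₀.le hφ.1) (exists_extDiv_bound hs₀.le hφ.1) ?_ ?_ hy
  · filter_upwards [hs1] with n hn
    have ht : ∀ J, IsTest fun x => cmpFactor N (k + 1) (P n) p₀ * φ J x :=
      fun J => (hφ.1 J).const_mul _
    exact ⟨continuous_extDiv hn.le ht, exists_extDiv_bound hn.le ht⟩
  · simp_rw [extDiv_const_mul _ _ hφ.1]
    exact extDiv_tendsto_uniformly hs₀.le (hs1.mono fun n hn => hn.le) hs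
      (tendsto_cmpFactor hN _ hp₀ hlim) hφ.1
  · filter_upwards [hs1] with n hn
    exact le_splitTV hn (hφ.scale hN (hP n) hp₀)

/-- The limit `s → 1` raises the integer part: the limiting operator is the full divergence of order
`k + 1`, so the classical variation appears without the factor `intRatio`. -/
theorem WeakL1.eventually_lt_splitTV_one [l.IsCountablyGenerated] (h : WeakL1 l u v)
    (hN : 1 ≤ N) (hP : ∀ n, 1 ≤ P n) (hp₀ : 1 ≤ p₀) (hlim : Tendsto P l (𝓝 p₀)) {s : ℕ → ℝ} (hs1 : ∀ᶠ n in l, s n < 1)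
    (hs : Tendsto s l (𝓝 1)) {y : ℝ≥0∞} (hy : y < intTV p₀ (k + 1) v) :
    ∀ᶠ n in l, y < splitTV (P n) (s n) k (u n) := by
  simp only [intTV, lt_iSup_iff] at hy
  obtain ⟨ψ, hψ, hy⟩ := hy
  -- The operator `extDiv` at `s = 1` is minus the divergence, so the field enters with reversed
  -- sign.
  have hφ := hψ.neg hp₀
  set φ : (Fin (k + 1) → Fin N) → (Fin N → ℝ) → ℝ := fun J x => -ψ J x with hφdef
  have hy' : y < ENNReal.ofReal (∫ x in Q N, v x * extDiv 1 k φ x) := by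
    refine hy.trans_eq ?_
    congr 1
    refine setIntegral_congr_fun measurableSet_Q fun x hx => ?_
    have e : φ = fun J x => (-1) * ψ J x := by ext; simp [hφdef]
    simp only [e, extDiv_const_mul _ _ hψ.1, extDiv_one hψ.1 hx]
    ring
  refine h.eventually_lt
    (F := fun n => extDiv (s n) k fun J x => cmpFactor N (k + 1) (P n) p₀ * φ J x) ?_
    (continuous_extDiv le_rfl hφ.1) (exists_extDiv_bound le_rfl hφ.1) ?_ ?_ hy'
  · filter_upwards [hs1] with n hn
    have ht : ∀ J, IsTest fun x => cmpFactor N (k + 1) (P n) p₀ * φ J x :=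
      fun J => (hφ.1 J).const_mul _
    exact ⟨continuous_extDiv hn.le ht, exists_extDiv_bound hn.le ht⟩
  · simp_rw [extDiv_const_mul _ _ hφ.1]
    exact extDiv_tendsto_uniformly le_rfl (hs1.mono fun n hn => hn.le) hs
      (tendsto_cmpFactor hN _ hp₀ hlim) hφ.1
  · filter_upwards [hs1] with n hn
    exact le_splitTV hn (hφ.scale hN (hP n) hp₀)

theorem WeakL1.eventually_lt_intTV (h : WeakL1 l u v) (hN : 1 ≤ N) (hP : ∀ n, 1 ≤ P n)
    (hp₀ : 1 ≤ p₀) (hlim : Tendsto P l (𝓝 p₀)) {y : ℝ≥0∞} (hy : y < intTV p₀ k v) :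
    ∀ᶠ n in l, y < intTV (P n) k (u n) := by
  simp only [intTV, lt_iSup_iff] at hy
  obtain ⟨ψ, hψ, hy⟩ := hy
  have ht := IsTest.iterDiv hψ.1
  obtain ⟨C, hC0, hC⟩ := ht.exists_bound
  have hcm := tendsto_cmpFactor (l := l) hN k hp₀ hlim
  refine h.eventually_lt (F := fun n x => cmpFactor N k (P n) p₀ * iterDiv k ψ x) ?_
    ht.continuous ⟨C, hC⟩ ⟨fun n => |cmpFactor N k (P n) p₀ - 1| * C, ?_, ?_⟩ ?_ hy
  · refine Eventually.of_forall fun n => ⟨continuous_const.mul ht.continuous,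
      |cmpFactor N k (P n) p₀| * C, fun x => ?_⟩
    rw [abs_mul]
    exact mul_le_mul_of_nonneg_left (hC x) (abs_nonneg _)
  · have := (hcm.sub_const 1).abs.mul_const C
    simpa using this
  · refine Eventually.of_forall fun n x => ?_
    rw [← sub_one_mul, abs_mul]
    exact mul_le_mul_of_nonneg_left (hC x) (abs_nonneg _)
  · refine Eventually.of_forall fun n => ?_
    have := le_intTV (u := u n) (hψ.scale hN (hP n) hp₀)
    rwa [iterDiv_const_mul _ hψ.1] at this

end Semicontinuity

/-! ### Varying orders and the jump of the integer part. -/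

section Orders

variable {N : ℕ} {p : ℝ≥0∞} {k : ℕ}

theorem fracTV_natCast (hN : 1 ≤ N) (hp : 1 ≤ p) (k : ℕ) (u : (Fin N → ℝ) → ℝ) :
    fracTV p k u = ENNReal.ofReal (intRatio N p) * intTV p k u := by
  rw [fracTV_eq_splitTV p (Nat.floor_natCast k), sub_self, splitTV_zero hN hp]

theorem mixedTV_natCast (p : ℝ≥0∞) (k : ℕ) (u : (Fin N → ℝ) → ℝ) :
    mixedTV p k u = intTV p k u := by
  simp [mixedTV]

theorem mixedTV_of_ne {r : ℝ} (h : ∀ k : ℕ, r ≠ k) (u : (Fin N → ℝ) → ℝ) :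
    mixedTV p r u = fracTV p r u := by
  simp [mixedTV, h]

theorem fracTV_le_mixedTV (hN : 1 ≤ N) (hp : 1 ≤ p) (r : ℝ) (u : (Fin N → ℝ) → ℝ) :
    fracTV p r u ≤ mixedTV p r u := by
  by_cases h : ∃ k : ℕ, r = k
  · obtain ⟨k, rfl⟩ := h
    rw [mixedTV_natCast, fracTV_eq_splitTV p (Nat.floor_natCast k), sub_self]
    exact intTV_ge_splitTV_zero hN hp k u
  · push Not at h
    rw [mixedTV_of_ne h]

theorem intRatio_mul_mixedTV_le (hN : 1 ≤ N) (hp : 1 ≤ p) (r : ℝ) (u : (Fin N → ℝ) → ℝ) :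
    ENNReal.ofReal (intRatio N p) * mixedTV p r u ≤ fracTV p r u := by
  by_cases h : ∃ k : ℕ, r = k
  · obtain ⟨k, rfl⟩ := h
    rw [mixedTV_natCast, fracTV_natCast hN hp]
  · push Not at h
    rw [mixedTV_of_ne h]
    refine mul_le_of_le_one_left zero_le ?_
    rw [← ENNReal.ofReal_one]
    exact ENNReal.ofReal_le_ofReal (intRatio_le_one hN hp)

theorem sub_floor_lt_one {r : ℝ} : r - ⌊r⌋₊ < 1 := by
  have := Nat.lt_floor_add_one r
  linarith

theorem fracTV_le_mul (hN : 1 ≤ N) {q : ℝ≥0∞} (hp : 1 ≤ p) (hq : 1 ≤ q) (r : ℝ)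
    (u : (Fin N → ℝ) → ℝ) :
    fracTV q r u ≤ ENNReal.ofReal ((N : ℝ) ^ (⌊r⌋₊ + 1)) * fracTV p r u := by
  rw [fracTV_eq_splitTV q rfl, fracTV_eq_splitTV p rfl]
  exact splitTV_le_mul hN hp hq sub_floor_lt_one _ u

theorem tendsto_intRatio (hN : 1 ≤ N) {l : Filter ℕ} {P : ℕ → ℝ≥0∞} {p₀ : ℝ≥0∞} (hp₀ : 1 ≤ p₀)
    (hlim : Tendsto P l (𝓝 p₀)) :
    Tendsto (fun n => intRatio N (P n)) l (𝓝 (intRatio N p₀)) := by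
  have hN0 : (N : ℝ) ≠ 0 := by positivity
  have h1 : Tendsto (fun n => ((P n)⁻¹).toReal) l (𝓝 (p₀⁻¹).toReal) := by
    refine (ENNReal.tendsto_toReal ?_).comp ((continuous_inv.tendsto p₀).comp hlim)
    simpa using (zero_lt_one.trans_le hp₀).ne'
  exact (Real.continuousAt_const_rpow hN0).tendsto.comp (h1.sub_const 1)

/-- The indices with order below an integer limit and the remaining ones need different arguments.
Restricting the filter treats both without extracting subsequences, and one of the restrictions may
be trivial. -/
theorem eventually_of_inf_principal {l : Filter ℕ} {p : ℕ → Prop} {A : Set ℕ}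
    (h1 : ∀ᶠ n in l ⊓ 𝓟 A, p n) (h2 : ∀ᶠ n in l ⊓ 𝓟 Aᶜ, p n) : ∀ᶠ n in l, p n := by
  rw [eventually_inf_principal] at h1 h2
  filter_upwards [h1, h2] with n h1 h2
  by_cases hn : n ∈ A
  exacts [h1 hn, h2 hn]

variable {l : Filter ℕ} [l.IsCountablyGenerated] {u : ℕ → (Fin N → ℝ) → ℝ} {v : (Fin N → ℝ) → ℝ}
  {P : ℕ → ℝ≥0∞} {p₀ : ℝ≥0∞} {r : ℕ → ℝ} {r₀ : ℝ}

theorem WeakL1.eventually_lt_fracTV_of_le (h : WeakL1 l u v) (hN : 1 ≤ N) (hP : ∀ n, 1 ≤ P n)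
    (hp₀ : 1 ≤ p₀) (hlim : Tendsto P l (𝓝 p₀)) (hlimr : Tendsto r l (𝓝 r₀))
    (hle : ∀ᶠ n in l, (⌊r₀⌋₊ : ℝ) ≤ r n) {y : ℝ≥0∞} (hy : y < fracTV p₀ r₀ v) :
    ∀ᶠ n in l, y < fracTV (P n) (r n) (u n) := by
  rw [fracTV_eq_splitTV p₀ rfl] at hy
  have h1 := h.eventually_lt_splitTV hN hP hp₀ hlim sub_floor_lt_one
    (hlimr.sub_const (⌊r₀⌋₊ : ℝ)) hy
  have h2 : ∀ᶠ n in l, r n < ⌊r₀⌋₊ + 1 := hlimr.eventually (gt_mem_nhds (Nat.lt_floor_add_one r₀))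
  filter_upwards [h1, h2, hle] with n hn h2 h3
  have hfl : ⌊r n⌋₊ = ⌊r₀⌋₊ := (Nat.floor_eq_iff ((Nat.cast_nonneg _).trans h3)).2 ⟨h3, h2⟩
  rwa [fracTV_eq_splitTV _ hfl]

theorem WeakL1.eventually_lt_fracTV_of_lt (h : WeakL1 l u v) (hN : 1 ≤ N) (hP : ∀ n, 1 ≤ P n)
    (hp₀ : 1 ≤ p₀) (hlim : Tendsto P l (𝓝 p₀)) (hlimr : Tendsto r l (𝓝 ((k + 1 : ℕ) : ℝ)))
    (hlt : ∀ᶠ n in l, r n < ((k + 1 : ℕ) : ℝ)) {y : ℝ≥0∞} (hy : y < intTV p₀ (k + 1) v) :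
    ∀ᶠ n in l, y < fracTV (P n) (r n) (u n) := by
  push_cast at hlimr hlt
  have h1 := h.eventually_lt_splitTV_one hN hP hp₀ hlim (s := fun n => r n - k)
    (hlt.mono fun n hn => by linarith) (by simpa using hlimr.sub_const (k : ℝ)) hy
  have h2 : ∀ᶠ n in l, (k : ℝ) < r n := hlimr.eventually (lt_mem_nhds (lt_add_one _))
  filter_upwards [h1, h2, hlt] with n hn h2 h3
  have hfl : ⌊r n⌋₊ = k := (Nat.floor_eq_iff ((Nat.cast_nonneg _).trans h2.le)).2 ⟨h2.le, h3⟩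
  rwa [fracTV_eq_splitTV _ hfl]

/-- At an integer limit, approach from below even gives the classical variation of the limit, which
dominates the fractional one. -/
theorem WeakL1.eventually_lt_fracTV (h : WeakL1 l u v) (hN : 1 ≤ N) (hP : ∀ n, 1 ≤ P n)
    (hp₀ : 1 ≤ p₀) (hlim : Tendsto P l (𝓝 p₀)) (hr : ∀ n, 0 < r n) (hr₀ : 0 ≤ r₀)
    (hlimr : Tendsto r l (𝓝 r₀)) {y : ℝ≥0∞} (hy : y < fracTV p₀ r₀ v) :
    ∀ᶠ n in l, y < fracTV (P n) (r n) (u n) := by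
  rcases (Nat.floor_le hr₀).lt_or_eq with hlt | heq
  · exact h.eventually_lt_fracTV_of_le hN hP hp₀ hlim hlimr
      ((hlimr.eventually (lt_mem_nhds hlt)).mono fun n hn => hn.le) hy
  · rcases hk : ⌊r₀⌋₊ with _ | k
    -- Here the limit order has integer part 0, and positivity of the orders excludes approach from
    -- below.
    · exact h.eventually_lt_fracTV_of_le hN hP hp₀ hlim hlimr
        (Eventually.of_forall fun n => by rw [hk]; simpa using (hr n).le) hy
    · rw [hk] at heq
      refine eventually_of_inf_principal (A := {n | (⌊r₀⌋₊ : ℝ) ≤ r n}) ?_ ?_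
      · have hev : ∀ᶠ n in l ⊓ 𝓟 {n | (⌊r₀⌋₊ : ℝ) ≤ r n}, (⌊r₀⌋₊ : ℝ) ≤ r n :=
          eventually_inf_principal.2 (Eventually.of_forall fun n hn => hn)
        exact (h.mono inf_le_left).eventually_lt_fracTV_of_le hN hP hp₀
          (hlim.mono_left inf_le_left) (hlimr.mono_left inf_le_left) hev hy
      · refine (h.mono inf_le_left).eventually_lt_fracTV_of_lt (k := k) hN hP hp₀
          (hlim.mono_left inf_le_left) ?_ (eventually_inf_principal.2 (Eventually.of_forall
            fun n hn => ?_)) ?_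
        · rw [heq]; exact hlimr.mono_left inf_le_left
        · rw [hk] at hn; simpa using hn
        · rw [← heq] at hy
          rw [← mixedTV_natCast]
          exact hy.trans_le (fracTV_le_mixedTV hN hp₀ _ v)

/-- At a non-integer limit, or when `N^(1/p-1) = 1`, the two variations of the limit coincide. If
the orders do not exceed an integer limit, they either equal it, where classical semicontinuity
applies, or approach it from below, where the limit is again classical. -/
theorem WeakL1.eventually_lt_mixedTV (h : WeakL1 l u v) (hN : 1 ≤ N) (hP : ∀ n, 1 ≤ P n)
    (hp₀ : 1 ≤ p₀) (hlim : Tendsto P l (𝓝 p₀)) (hr : ∀ n, 0 < r n) (hr₀ : 0 ≤ r₀)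
    (hlimr : Tendsto r l (𝓝 r₀))
    (hcond : N = 1 ∨ p₀ = 1 ∨ (∀ k : ℕ, r₀ ≠ k) ∨ ∀ᶠ n in l, r n ≤ r₀)
    {y : ℝ≥0∞} (hy : y < mixedTV p₀ r₀ v) :
    ∀ᶠ n in l, y < mixedTV (P n) (r n) (u n) := by
  have hfrac : mixedTV p₀ r₀ v ≤ fracTV p₀ r₀ v →
      ∀ᶠ n in l, y < mixedTV (P n) (r n) (u n) := fun hle => by
    filter_upwards [h.eventually_lt_fracTV hN hP hp₀ hlim hr hr₀ hlimr (hy.trans_le hle)]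
      with n hn using hn.trans_le (fracTV_le_mixedTV hN (hP n) _ _)
  by_cases hInt : ∃ k : ℕ, r₀ = k
  swap
  · push Not at hInt
    exact hfrac (mixedTV_of_ne hInt v).le
  obtain ⟨k, rfl⟩ := hInt
  have hone : intRatio N p₀ = 1 → ∀ᶠ n in l, y < mixedTV (P n) (r n) (u n) := fun hone => by
    apply hfrac
    rw [mixedTV_natCast, fracTV_natCast hN hp₀, hone]
    simp
  rcases hcond with rfl | rfl | hcond | hcond
  · exact hone (by simp [intRatio])
  · exact hone (by simp [intRatio])
  · exact absurd rfl (hcond k)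
  · rw [mixedTV_natCast] at hy
    refine eventually_of_inf_principal (A := {n | r n = k}) ?_ ?_
    · filter_upwards [(h.mono inf_le_left).eventually_lt_intTV hN hP hp₀
        (hlim.mono_left inf_le_left) hy, eventually_inf_principal.2 (Eventually.of_forall
          fun n (hn : n ∈ {n | r n = k}) => hn)] with n h1 h2
      rw [h2, mixedTV_natCast]
      exact h1
    · have hlt : ∀ᶠ n in l ⊓ 𝓟 {n | r n = k}ᶜ, r n < k := by
        rw [eventually_inf_principal]
        filter_upwards [hcond] with n hn hne using lt_of_le_of_ne hn hne
      rcases k with _ | k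
      · filter_upwards [hlt] with n hn
        exact absurd (hr n) (by simpa using hn.le)
      · filter_upwards [(h.mono inf_le_left).eventually_lt_fracTV_of_lt hN hP hp₀
          (hlim.mono_left inf_le_left) (hlimr.mono_left inf_le_left) hlt hy] with n hn
        exact hn.trans_le (fracTV_le_mixedTV hN (hP n) _ _)

end Orders

/-! ### The semigroup property of fractional integrals. -/

section Semigroup

theorem integral_rpow_mul_rpow_sub {a b σ : ℝ} (ha : 0 < a) (hb : 0 < b) (hσ : 0 < σ) :
    ∫ τ in (0 : ℝ)..σ, τ ^ (a - 1) * (σ - τ) ^ (b - 1)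
      = Real.Gamma a * Real.Gamma b / Real.Gamma (a + b) * σ ^ (a + b - 1) := by
  have h := Complex.betaIntegral_scaled a b hσ
  rw [Complex.betaIntegral_eq_Gamma_mul_div _ _ (by simpa) (by simpa)] at h
  have e : ∫ x in (0 : ℝ)..σ, (x : ℂ) ^ ((a : ℂ) - 1) * ((σ : ℂ) - x) ^ ((b : ℂ) - 1)
      = ((∫ τ in (0 : ℝ)..σ, τ ^ (a - 1) * (σ - τ) ^ (b - 1) : ℝ) : ℂ) := by
    rw [← intervalIntegral.integral_ofReal]
    refine intervalIntegral.integral_congr fun t ht => ?_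
    rw [uIcc_of_le hσ.le] at ht
    simp only [Complex.ofReal_mul]
    rw [Complex.ofReal_cpow ht.1, Complex.ofReal_cpow (sub_nonneg.2 ht.2)]
    push_cast
    rfl
  rw [e] at h
  have h2 : ((σ : ℂ) ^ ((a : ℂ) + b - 1)) = ((σ ^ (a + b - 1) : ℝ) : ℂ) := by
    rw [Complex.ofReal_cpow hσ.le]; push_cast; rfl
  rw [h2, ← Complex.ofReal_add, Complex.Gamma_ofReal, Complex.Gamma_ofReal,
    Complex.Gamma_ofReal] at h
  norm_cast at h
  rw [h]; ring

/-- This is Euler's beta integral. For `σ ≤ 1` the truncation of the kernels at 1 has no effect. -/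
theorem integral_rlKernel_mul_rlKernel_sub {a b σ : ℝ} (ha : 0 < a) (hb : 0 < b) (hσ : σ ≤ 1) :
    ∫ τ, rlKernel a τ * rlKernel b (σ - τ) = rlKernel (a + b) σ := by
  rcases le_or_gt σ 0 with h0 | h0
  · have : ∀ τ, rlKernel a τ * rlKernel b (σ - τ) = 0 := fun τ => by
      by_cases hτ : τ ∈ Ioc (0 : ℝ) 1
      · have : σ - τ ∉ Ioc (0 : ℝ) 1 := fun h => by linarith [h.1, hτ.1]
        simp [rlKernel, this]
      · simp [rlKernel, hτ]
    simp only [this, integral_zero]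
    have : σ ∉ Ioc (0 : ℝ) 1 := fun h => by linarith [h.1]
    simp [rlKernel, this]
  · have hmem : σ ∈ Ioc (0 : ℝ) 1 := ⟨h0, hσ⟩
    have e : ∀ τ, rlKernel a τ * rlKernel b (σ - τ) = (Ioo (0 : ℝ) σ).indicator (fun τ =>
        (Real.Gamma a)⁻¹ * (Real.Gamma b)⁻¹ * (τ ^ (a - 1) * (σ - τ) ^ (b - 1))) τ := fun τ => by
      by_cases hτ : τ ∈ Ioo (0 : ℝ) σ
      · have h1 : τ ∈ Ioc (0 : ℝ) 1 := ⟨hτ.1, hτ.2.le.trans hσ⟩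
        have h2 : σ - τ ∈ Ioc (0 : ℝ) 1 := ⟨by linarith [hτ.2], by linarith [hτ.1]⟩
        simp only [rlKernel, indicator_of_mem h1, indicator_of_mem h2, indicator_of_mem hτ]
        ring
      · rw [indicator_of_notMem hτ]
        by_cases h1 : τ ∈ Ioc (0 : ℝ) 1
        · have h2 : σ - τ ∉ Ioc (0 : ℝ) 1 := fun h => hτ ⟨h1.1, by linarith [h.1]⟩
          simp [rlKernel, h2]
        · simp [rlKernel, h1]
    simp_rw [e]
    rw [integral_indicator measurableSet_Ioo, ← integral_Ioc_eq_integral_Ioo,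
      ← intervalIntegral.integral_of_le h0.le, intervalIntegral.integral_const_mul,
      integral_rpow_mul_rpow_sub ha hb h0, rlKernel, indicator_of_mem hmem]
    have := (Real.Gamma_pos_of_pos ha).ne'
    have := (Real.Gamma_pos_of_pos hb).ne'
    have := (Real.Gamma_pos_of_pos (add_pos ha hb)).ne'
    field_simp

variable {N : ℕ} {f : (Fin N → ℝ) → ℝ} {i : Fin N}

/-- The truncated kernels form a semigroup only up to distance 1, but beyond that distance the line
has left the cube and `f` vanishes. -/
theorem dirConv_rlKernel_add {a b : ℝ} (ha : 0 < a) (hb : 0 < b) (hf : IsTest f)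
    {x : Fin N → ℝ} (hx : 0 < x i) :
    dirConv (rlKernel a) i (dirConv (rlKernel b) i f) x = dirConv (rlKernel (a + b)) i f x := by
  obtain ⟨C, -, hC⟩ := hf.exists_bound
  let F : ℝ → ℝ := fun t => f (x + t • Pi.single i 1)
  have hF : Continuous F := hf.continuous.comp (continuous_line x i)
  have h1 : ∀ τ, dirConv (rlKernel b) i f (x + τ • Pi.single i 1)
      = ∫ σ, rlKernel b (σ - τ) * F σ := fun τ => by
    rw [dirConv, ← integral_sub_right_eq_self _ τ]
    congr 1; ext σ
    simp only [F]
    congr 2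
    rw [add_assoc, ← add_smul]
    congr 2; ring
  have hInt : Integrable (fun z : ℝ × ℝ => rlKernel a z.2 * rlKernel b (z.1 - z.2) * F z.1)
      (volume.prod volume) := by
    have := (integrable_rlKernel ha).convolution_integrand (ContinuousLinearMap.mul ℝ ℝ)
      (integrable_rlKernel hb)
    exact this.mul_bdd (hF.comp continuous_fst).aestronglyMeasurable
      (Eventually.of_forall fun z => hC _)
  calc dirConv (rlKernel a) i (dirConv (rlKernel b) i f) x
      = ∫ τ, ∫ σ, rlKernel a τ * rlKernel b (σ - τ) * F σ := by
        rw [dirConv]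
        congr 1; ext τ
        rw [h1, ← integral_const_mul]
        congr 1; ext σ; ring
    _ = ∫ σ, ∫ τ, rlKernel a τ * rlKernel b (σ - τ) * F σ :=
        integral_integral_swap (f := fun τ σ => rlKernel a τ * rlKernel b (σ - τ) * F σ) hInt.swap
    _ = dirConv (rlKernel (a + b)) i f x := by
        rw [dirConv]
        congr 1; ext σ
        rw [integral_mul_const]
        rcases le_or_gt σ 1 with h | h
        · rw [integral_rlKernel_mul_rlKernel_sub ha hb h]
        · have : F σ = 0 := hf.eq_zero (line_notMem_Q hx h.le)
          change _ * F σ = _ * F σ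
          rw [this, mul_zero, mul_zero]

theorem IsTest.iterate_partialD (hf : IsTest f) (i : Fin N) :
    ∀ m : ℕ, IsTest ((FracTV.partialD i)^[m] f)
  | 0 => hf
  | m + 1 => by
    rw [Function.iterate_succ_apply']
    exact (hf.iterate_partialD i m).partialD i

theorem dirConv_rlKernel_iterate_partialD {x : Fin N → ℝ} (hx : 0 < x i) : ∀ (m : ℕ)
    {f : (Fin N → ℝ) → ℝ}, IsTest f →
    dirConv (rlKernel (m + 1)) i ((partialD i)^[m + 1] f) x = (-1) ^ (m + 1) * f x
  | 0, f, hf => by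
    simpa using dirConv_rlKernel_one_partialD hf hx
  | m + 1, f, hf => by
    rw [Function.iterate_succ_apply']
    push_cast
    rw [dirConv_rlKernel_succ_partialD (hf.iterate_partialD i _) hx
      (by have : (0 : ℝ) ≤ m := m.cast_nonneg
          linarith), dirConv_rlKernel_iterate_partialD hx m hf, pow_succ (-1 : ℝ) (m + 1)]
    ring

end Semigroup

/-! ### The smooth, nonlocal part of the kernel. -/

section CutKernel

/-- The `t`-derivatives of `t^{r-1} χ(t)`, where `χ` is smooth, `0` for `t ≤ η/2` and `1` for
`t ≥ η`, as functions of the pair `(r, t)`. -/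
def cutKernel (η : ℝ) : ℕ → ℝ × ℝ → ℝ
  | 0 => fun z => z.2 ^ (z.1 - 1) * Real.smoothTransition (2 * z.2 / η - 1)
  | j + 1 => fun z => fderiv ℝ (cutKernel η j) z (0, 1)

variable {η : ℝ}

theorem cutKernel_zero_eq_zero (hη : 0 < η) {z : ℝ × ℝ} (hz : z.2 ≤ η / 2) :
    cutKernel η 0 z = 0 := by
  simp only [cutKernel]
  rw [Real.smoothTransition.zero_of_nonpos, mul_zero]
  rw [sub_nonpos, div_le_one hη]
  linarith

theorem contDiff_cutKernel (hη : 0 < η) : ∀ j, ContDiff ℝ ∞ (cutKernel η j)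
  | 0 => by
    rw [contDiff_iff_contDiffAt]
    intro z
    rcases lt_or_ge z.2 (η / 2) with hz | hz
    · have : cutKernel η 0 =ᶠ[𝓝 z] fun _ => 0 := by
        filter_upwards [(isOpen_lt continuous_snd continuous_const).mem_nhds hz] with w hw
        exact cutKernel_zero_eq_zero hη (le_of_lt hw)
      exact contDiffAt_const.congr_of_eventuallyEq this
    · refine ContDiffAt.mul ?_ ?_
      · exact contDiffAt_snd.rpow (contDiffAt_fst.sub contDiffAt_const)
          (by have : 0 < z.2 := by linarith
              exact this.ne')
      · refine (Real.smoothTransition.contDiff.contDiffAt).comp z ?_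
        exact ((contDiffAt_const.mul contDiffAt_snd).div_const η).sub contDiffAt_const
  | j + 1 => ((contDiff_cutKernel hη j).fderiv_right (m := ∞) (by simp)).clm_apply contDiff_const

theorem cutKernel_eq_zero (hη : 0 < η) : ∀ (j : ℕ) {z : ℝ × ℝ}, z.2 < η / 2 →
    cutKernel η j z = 0
  | 0, _, hz => cutKernel_zero_eq_zero hη hz.le
  | j + 1, z, hz => by
    have : cutKernel η j =ᶠ[𝓝 z] fun _ => 0 := by
      filter_upwards [(isOpen_lt continuous_snd continuous_const).mem_nhds hz] with w hw
      exact cutKernel_eq_zero hη j hw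
    simp only [cutKernel]
    rw [this.fderiv_eq]
    simp

theorem hasDerivAt_cutKernel (hη : 0 < η) (j : ℕ) (r t : ℝ) :
    HasDerivAt (fun t => cutKernel η j (r, t)) (cutKernel η (j + 1) (r, t)) t := by
  have h1 : HasDerivAt (fun t : ℝ => ((r, t) : ℝ × ℝ)) (0, 1) t :=
    (hasDerivAt_const t r).prodMk (hasDerivAt_id t)
  exact (((contDiff_cutKernel hη j).differentiable (by simp)) (r, t)).hasFDerivAt.comp_hasDerivAt
    t h1

/-- Joint smoothness in order and variable gives one bound for all orders in a compact interval. -/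
theorem exists_cutKernel_bound (hη : 0 < η) (a b : ℝ) (J : ℕ) :
    ∃ S, 0 ≤ S ∧ ∀ j ≤ J, ∀ r ∈ Icc a b, ∀ t ∈ Icc (0 : ℝ) 1, |cutKernel η j (r, t)| ≤ S := by
  have h : ∀ j, ∃ S, ∀ z ∈ Icc a b ×ˢ Icc (0 : ℝ) 1, ‖cutKernel η j z‖ ≤ S := fun j =>
    (isCompact_Icc.prod isCompact_Icc).exists_bound_of_continuousOn
      (contDiff_cutKernel hη j).continuous.continuousOn
  choose S hS using h
  refine ⟨∑ j ∈ Finset.range (J + 1), |S j|, Finset.sum_nonneg fun _ _ => abs_nonneg _,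
    fun j hj r hr t ht => ?_⟩
  refine (hS j (r, t) ⟨hr, ht⟩).trans ((le_abs_self _).trans ?_)
  exact Finset.single_le_sum (f := fun j => |S j|) (fun _ _ => abs_nonneg _)
    (Finset.mem_range.2 (by omega))

/-- `cutKernel` restricted to `t ∈ (0,1]`. -/
def cutKernel₁ (η r : ℝ) (j : ℕ) : ℝ → ℝ := indicator (Ioc 0 1) fun t => cutKernel η j (r, t)

theorem continuous_cutKernel (hη : 0 < η) (r : ℝ) (j : ℕ) :
    Continuous fun t => cutKernel η j (r, t) :=
  (contDiff_cutKernel hη j).continuous.comp (by fun_prop)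

theorem integrable_cutKernel₁ (hη : 0 < η) (r : ℝ) (j : ℕ) : Integrable (cutKernel₁ η r j) := by
  rw [cutKernel₁, integrable_indicator_iff measurableSet_Ioc]
  exact ((continuous_cutKernel hη r j).integrableOn_Icc).mono_set Ioc_subset_Icc_self

theorem integral_abs_cutKernel₁_le (hη : 0 < η) {r S : ℝ} {j : ℕ}
    (hS : ∀ t ∈ Icc (0 : ℝ) 1, |cutKernel η j (r, t)| ≤ S) : ∫ t, |cutKernel₁ η r j t| ≤ S := by
  have e : ∀ t, |cutKernel₁ η r j t| ≤ (Ioc (0 : ℝ) 1).indicator (fun _ => S) t := fun t => by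
    by_cases ht : t ∈ Ioc (0 : ℝ) 1
    · simp only [cutKernel₁, indicator_of_mem ht]
      exact hS t ⟨ht.1.le, ht.2⟩
    · simp [cutKernel₁, ht]
  have hInt : Integrable ((Ioc (0 : ℝ) 1).indicator fun _ => S) := by
    rw [integrable_indicator_iff measurableSet_Ioc]
    exact integrableOn_const (by simp)
  refine (integral_mono (integrable_cutKernel₁ hη r j).abs hInt e).trans_eq ?_
  rw [integral_indicator measurableSet_Ioc]
  simp

variable {N : ℕ} {f : (Fin N → ℝ) → ℝ} {i : Fin N}

theorem dirConv_cutKernel₁_eq (η r : ℝ) (j : ℕ) (f : (Fin N → ℝ) → ℝ) (x : Fin N → ℝ) :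
    dirConv (cutKernel₁ η r j) i f x
      = ∫ t in (0 : ℝ)..1, cutKernel η j (r, t) * f (x + t • Pi.single i 1) := by
  rw [dirConv, intervalIntegral.integral_of_le zero_le_one, ← integral_indicator measurableSet_Ioc]
  congr 1; ext t
  by_cases ht : t ∈ Ioc (0 : ℝ) 1
  · simp [cutKernel₁, ht]
  · simp [cutKernel₁, ht]

/-- The kernel vanishes near `t = 0` and `f` vanishes at `t = 1`, so derivatives move to the kernel
without boundary terms. -/
theorem dirConv_cutKernel₁_partialD (hη : 0 < η) (r : ℝ) (j : ℕ) (hf : IsTest f)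
    {x : Fin N → ℝ} (hx : 0 < x i) :
    dirConv (cutKernel₁ η r j) i (partialD i f) x = -dirConv (cutKernel₁ η r (j + 1)) i f x := by
  rw [dirConv_cutKernel₁_eq, dirConv_cutKernel₁_eq]
  have e := intervalIntegral.integral_mul_deriv_eq_deriv_mul (a := 0) (b := 1)
    (u := fun t => cutKernel η j (r, t)) (u' := fun t => cutKernel η (j + 1) (r, t))
    (v := fun t => f (x + t • Pi.single i 1))
    (v' := fun t => partialD i f (x + t • Pi.single i 1))
    (fun t _ => hasDerivAt_cutKernel hη j r t)
    (fun t _ => hasDerivAt_line hf.1 x i t)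
    ((continuous_cutKernel hη r (j + 1)).intervalIntegrable _ _)
    (((hf.partialD i).continuous.comp (continuous_line x i)).intervalIntegrable _ _)
  rw [hf.eq_zero (line_notMem_Q hx le_rfl), cutKernel_eq_zero hη j (z := (r, 0)) (by simpa using hη)] at e
  simpa using e

theorem dirConv_cutKernel₁_iterate_partialD (hη : 0 < η) (r : ℝ) {x : Fin N → ℝ} (hx : 0 < x i) :
    ∀ (m j : ℕ) {f : (Fin N → ℝ) → ℝ}, IsTest f →
    dirConv (cutKernel₁ η r j) i ((partialD i)^[m] f) x
      = (-1) ^ m * dirConv (cutKernel₁ η r (j + m)) i f x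
  | 0, j, f, hf => by simp
  | m + 1, j, f, hf => by
    rw [Function.iterate_succ_apply', dirConv_cutKernel₁_partialD hη r j
      (hf.iterate_partialD i m) hx, dirConv_cutKernel₁_iterate_partialD hη r hx m (j + 1) hf,
      show j + 1 + m = j + (m + 1) by ring, pow_succ]
    ring

end CutKernel

/-! ### Quantitative supports. -/

section Support

variable {N : ℕ} {f : (Fin N → ℝ) → ℝ} {i : Fin N} {δ ρ : ℝ} {K : ℝ → ℝ}

/-- `f` vanishes outside `[δ, 1-δ]^N`. -/
def SuppIn (δ : ℝ) (f : (Fin N → ℝ) → ℝ) : Prop := ∀ x, f x ≠ 0 → ∀ j, δ ≤ x j ∧ x j ≤ 1 - δ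

theorem SuppIn.tsupport_subset (h : SuppIn δ f) :
    tsupport f ⊆ Icc (fun _ => δ) (fun _ => 1 - δ) :=
  closure_minimal (fun x hx => ⟨fun j => (h x hx j).1, fun j => (h x hx j).2⟩) isClosed_Icc

theorem SuppIn.isTest (h : SuppIn δ f) (hδ : 0 < δ) (hf : ContDiff ℝ ∞ f) : IsTest f :=
  ⟨hf, isCompact_Icc.of_isClosed_subset (isClosed_tsupport f) h.tsupport_subset, fun _ hx j _ =>
    ⟨hδ.trans_le ((h.tsupport_subset hx).1 j), ((h.tsupport_subset hx).2 j).trans_lt (by linarith)⟩⟩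

theorem SuppIn.partialD (h : SuppIn δ f) (i : Fin N) : SuppIn δ (partialD i f) := fun _ hx j =>
  have := h.tsupport_subset (tsupport_fderiv_apply_subset ℝ _ (subset_tsupport _ hx))
  ⟨this.1 j, this.2 j⟩

theorem SuppIn.dirConv (h : SuppIn δ f) (hK : ∀ t, K t ≠ 0 → |t| ≤ ρ) (i : Fin N) :
    SuppIn (δ - ρ) (dirConv K i f) := by
  intro x hx j
  obtain ⟨t, ht⟩ : ∃ t, K t * f (x + t • Pi.single i 1) ≠ 0 := by
    by_contra! hcon
    exact hx (by simp [FracTV.dirConv, hcon])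
  have h1 := abs_le.1 (hK t (left_ne_zero_of_mul ht))
  have h2 := h _ (right_ne_zero_of_mul ht) j
  by_cases hj : j = i
  · subst hj
    simp only [Pi.add_apply, Pi.smul_apply, Pi.single_eq_same, smul_eq_mul, mul_one] at h2
    constructor <;> linarith
  · simp only [Pi.add_apply, Pi.smul_apply, Pi.single_eq_of_ne hj, smul_zero, add_zero] at h2
    constructor <;> linarith

end Support

/-! ### Testing with one pure directional entry. -/

section SingleEntry

variable {N : ℕ} {ψ : (Fin N → ℝ) → ℝ} {p : ℝ≥0∞}

theorem partialD_zero (i : Fin N) : partialD i (fun _ => (0 : ℝ)) = fun _ => 0 := by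
  ext x; simp [partialD]

theorem iterDiv_zero : ∀ k : ℕ, iterDiv k (fun (_ : Fin k → Fin N) (_ : Fin N → ℝ) => (0 : ℝ))
    = fun _ => 0
  | 0 => rfl
  | k + 1 => by
    ext x
    simp [iterDiv, iterDiv_zero k, partialD_zero]

theorem iterDiv_single (i : Fin N) : ∀ k : ℕ,
    iterDiv k (fun (J : Fin k → Fin N) x => if J = (fun _ => i) then ψ x else 0)
      = (partialD i)^[k] ψ
  | 0 => by
    ext x
    have : (Fin.elim0 : Fin 0 → Fin N) = fun _ => i := funext fun j => j.elim0
    simp [iterDiv, this]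
  | k + 1 => by
    ext x
    simp only [iterDiv]
    rw [Finset.sum_eq_single i]
    · have e : ∀ J : Fin k → Fin N,
          (Fin.cons i J : Fin (k + 1) → Fin N) = (fun _ => i) ↔ J = fun _ => i := fun J => by
        constructor
        · intro h; ext j
          simpa using congrArg Fin.val (congrFun h j.succ)
        · rintro rfl; ext j
          refine Fin.cases ?_ (fun j => ?_) j <;> simp
      simp only [e]
      rw [iterDiv_single i k, Function.iterate_succ_apply']
    · intro j _ hj
      have e : ∀ J : Fin k → Fin N, (Fin.cons j J : Fin (k + 1) → Fin N) ≠ fun _ => i :=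
        fun J h => hj (by simpa using congrFun h 0)
      simp only [e, if_false]
      rw [iterDiv_zero, partialD_zero]
    · simp

theorem extDiv_single (i : Fin N) (s : ℝ) (k : ℕ) (x : Fin N → ℝ) :
    extDiv s k (fun (J : Fin (k + 1) → Fin N) x => if J = (fun _ => i) then ψ x else 0) x
      = ((1 - 1 / (N : ℝ)) * s + 1 / (N : ℝ)) *
        dirConv (rlKernel (2 - s)) i ((partialD i)^[k + 2] ψ) x := by
  rw [extDiv, Finset.sum_eq_single i]
  · have e : ∀ J : Fin k → Fin N,
        (Fin.cons i J : Fin (k + 1) → Fin N) = (fun _ => i) ↔ J = fun _ => i := fun J => by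
      constructor
      · intro h; ext j
        simpa using congrArg Fin.val (congrFun h j.succ)
      · rintro rfl; ext j
        refine Fin.cases ?_ (fun j => ?_) j <;> simp
    simp only [e]
    rw [iterDiv_single, ← Function.iterate_succ_apply' (partialD i),
      ← Function.iterate_succ_apply' (partialD i)]
  · intro j _ hj
    have e : ∀ J : Fin k → Fin N, (Fin.cons j J : Fin (k + 1) → Fin N) ≠ fun _ => i :=
      fun J h => hj (by simpa using congrFun h 0)
    simp only [e, if_false]
    rw [iterDiv_zero, partialD_zero, partialD_zero]
    simp [dirConv]
  · simp

/-- A field whose only entry is `(i,…,i)` reduces the divergence to pure derivatives in direction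
`i`, so the variation controls a one-dimensional fractional derivative for each direction. -/
theorem integral_le_of_splitTV_le (hN : 1 ≤ N) (hp : 1 ≤ p) {s : ℝ} (hs0 : 0 ≤ s) (hs1 : s < 1)
    {k : ℕ} {u : (Fin N → ℝ) → ℝ} {C : ℝ} (hC : 0 ≤ C) (hTV : splitTV p s k u ≤ ENNReal.ofReal C)
    (hψ : IsTest ψ) {A : ℝ} (hA : 0 < A) (hψA : ∀ x, |ψ x| ≤ A) (i : Fin N) :
    ∫ x in Q N, u x * dirConv (rlKernel (2 - s)) i ((partialD i)^[k + 2] ψ) x ≤ N * A * C := by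
  have ht : ∀ J : Fin (k + 1) → Fin N, IsTest fun x => if J = (fun _ => i) then ψ x else 0 :=
    fun J => by
      by_cases h : J = fun _ => i
      · simpa [h] using hψ
      · simpa [h] using IsTest.zero
  have hadm : Admissible p (k + 1) (fun (J : Fin (k + 1) → Fin N) x =>
      A⁻¹ * if J = (fun _ => i) then ψ x else 0) := by
    refine ⟨fun J => (ht J).const_mul _, fun x => ?_⟩
    simp only [mul_ite, mul_zero]
    refine dualNormLeOne_single hp _ ?_
    rw [abs_mul, abs_of_pos (inv_pos.2 hA), inv_mul_le_iff₀ hA, mul_one]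
    exact hψA x
  have h1 := (le_splitTV (u := u) hs1 hadm).trans hTV
  rw [ENNReal.ofReal_le_ofReal_iff hC] at h1
  have hN0 : (0 : ℝ) < N := by exact_mod_cast hN
  set w := (1 - 1 / (N : ℝ)) * s + 1 / (N : ℝ) with hw
  -- The weight of the fractional divergence is bounded below uniformly in `s`; this produces the
  -- factor `N` in the estimate.
  have hw1 : 1 / (N : ℝ) ≤ w := by
    have : 1 / (N : ℝ) ≤ 1 := by
      rw [div_le_one hN0]; exact_mod_cast hN
    have : 0 ≤ (1 - 1 / (N : ℝ)) * s := mul_nonneg (by linarith) hs0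
    linarith
  set I := ∫ x in Q N, u x * dirConv (rlKernel (2 - s)) i ((partialD i)^[k + 2] ψ) x with hI
  have h2 : ∫ x in Q N, u x * extDiv s k (fun (J : Fin (k + 1) → Fin N) x =>
      A⁻¹ * if J = (fun _ => i) then ψ x else 0) x = A⁻¹ * w * I := by
    rw [hI, ← integral_const_mul]
    congr 1; ext x
    rw [extDiv_const_mul _ _ ht, extDiv_single]
    ring
  rw [h2] at h1
  rcases le_or_gt I 0 with hI0 | hI0
  · exact hI0.trans (by positivity)
  · have h3 : A⁻¹ * (1 / N) * I ≤ C := le_trans (by gcongr) h1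
    have h4 : I = N * A * (A⁻¹ * (1 / N) * I) := by field_simp
    rw [h4]
    gcongr

theorem iterate_partialD_neg (hψ : IsTest ψ) (i : Fin N) (m : ℕ) :
    (partialD i)^[m] (fun x => -ψ x) = fun x => -(partialD i)^[m] ψ x := by
  induction m with
  | zero => rfl
  | succ m ih =>
    rw [Function.iterate_succ_apply', ih, Function.iterate_succ_apply']
    have := partialD_const_mul (hψ.iterate_partialD i m).1 (-1) i
    simpa using this

theorem abs_integral_le_of_splitTV_le (hN : 1 ≤ N) (hp : 1 ≤ p) {s : ℝ} (hs0 : 0 ≤ s)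
    (hs1 : s < 1) {k : ℕ} {u : (Fin N → ℝ) → ℝ} {C : ℝ} (hC : 0 ≤ C)
    (hTV : splitTV p s k u ≤ ENNReal.ofReal C) (hψ : IsTest ψ) {A : ℝ} (hA : 0 < A)
    (hψA : ∀ x, |ψ x| ≤ A) (i : Fin N) :
    |∫ x in Q N, u x * dirConv (rlKernel (2 - s)) i ((partialD i)^[k + 2] ψ) x|
      ≤ N * A * C := by
  rw [abs_le']
  refine ⟨integral_le_of_splitTV_le hN hp hs0 hs1 hC hTV hψ hA hψA i, ?_⟩
  have := integral_le_of_splitTV_le hN hp hs0 hs1 hC hTV hψ.neg hA (fun x => by simpa using hψA x) i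
  refine le_trans (le_of_eq ?_) this
  rw [← integral_neg]
  congr 1; ext x
  rw [iterate_partialD_neg hψ]
  simp only [dirConv, mul_neg, integral_neg]

end SingleEntry

/-! ### A local parametrix for the fractional derivative. -/

section Parametrix

variable {N : ℕ} {f g G : (Fin N → ℝ) → ℝ} {i : Fin N} {K : ℝ → ℝ} {η r : ℝ}

theorem iterate_partialD_dirConv (hK : Integrable K) (hf : IsTest f) (i : Fin N) (m : ℕ) :
    (partialD i)^[m] (dirConv K i f) = dirConv K i ((partialD i)^[m] f) := by
  induction m with
  | zero => rfl
  | succ m ih =>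
    rw [Function.iterate_succ_apply', ih, Function.iterate_succ_apply',
      partialD_dirConv hK (hf.iterate_partialD i m)]

/-- The Riemann-Liouville kernel of order `r`, cut off smoothly at distance `η`. -/
def localKernel (η r : ℝ) (t : ℝ) : ℝ := rlKernel r t - (Real.Gamma r)⁻¹ * cutKernel₁ η r 0 t

theorem integrable_localKernel (hη : 0 < η) (hr : 0 < r) : Integrable (localKernel η r) :=
  (integrable_rlKernel hr).sub ((integrable_cutKernel₁ hη r 0).const_mul _)

theorem localKernel_eq (η r t : ℝ) : localKernel η r t = (Ioc (0 : ℝ) 1).indicator (fun t =>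
    (Real.Gamma r)⁻¹ * t ^ (r - 1) * (1 - Real.smoothTransition (2 * t / η - 1))) t := by
  by_cases ht : t ∈ Ioc (0 : ℝ) 1
  · simp only [localKernel, rlKernel, cutKernel₁, indicator_of_mem ht, cutKernel]
    ring
  · simp [localKernel, rlKernel, cutKernel₁, ht]

theorem localKernel_eq_zero (hη : 0 < η) {t : ℝ} (ht : t ∉ Ioc (0 : ℝ) η) :
    localKernel η r t = 0 := by
  rw [localKernel_eq]
  by_cases h1 : t ∈ Ioc (0 : ℝ) 1
  · have h2 : η < t := by
      by_contra hcon
      exact ht ⟨h1.1, not_lt.1 hcon⟩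
    rw [indicator_of_mem h1, Real.smoothTransition.one_of_one_le, sub_self, mul_zero]
    have : 1 ≤ t / η := (one_le_div hη).2 h2.le
    rw [mul_div_assoc]
    linarith
  · rw [indicator_of_notMem h1]

/-- The singularity `t^(r-1)` is integrable with mass `η^r / r` on `(0,η]`. It tends to 0 with `η`,
uniformly for orders bounded away from 0; this is where a positive limit order matters for
compactness. -/
theorem integral_abs_localKernel_le (hη : 0 < η) (hr : 0 < r) :
    ∫ t, |localKernel η r t| ≤ (Real.Gamma r)⁻¹ * (η ^ r / r) := by
  have hG : 0 < (Real.Gamma r)⁻¹ := inv_pos.2 (Real.Gamma_pos_of_pos hr)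
  have e : ∀ t, |localKernel η r t| ≤
      (Ioc (0 : ℝ) η).indicator (fun t => (Real.Gamma r)⁻¹ * t ^ (r - 1)) t := fun t => by
    by_cases ht : t ∈ Ioc (0 : ℝ) η
    · rw [indicator_of_mem ht, localKernel_eq]
      have h0 : 0 ≤ (Real.Gamma r)⁻¹ * t ^ (r - 1) := mul_nonneg hG.le (Real.rpow_nonneg ht.1.le _)
      by_cases h1 : t ∈ Ioc (0 : ℝ) 1
      · have h2 := Real.smoothTransition.le_one (2 * t / η - 1)
        have h3 := Real.smoothTransition.nonneg (2 * t / η - 1)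
        rw [indicator_of_mem h1, abs_of_nonneg (mul_nonneg h0 (by linarith))]
        exact mul_le_of_le_one_right h0 (by linarith)
      · rw [indicator_of_notMem h1, abs_zero]
        exact h0
    · rw [indicator_of_notMem ht, localKernel_eq_zero hη ht, abs_zero]
  have hInt : IntervalIntegrable (fun t : ℝ => t ^ (r - 1)) volume 0 η :=
    intervalIntegral.intervalIntegrable_rpow' (by linarith)
  rw [intervalIntegrable_iff_integrableOn_Ioc_of_le hη.le] at hInt
  refine (integral_mono (integrable_localKernel hη hr).abs ?_ e).trans_eq ?_
  · rw [integrable_indicator_iff measurableSet_Ioc]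
    exact hInt.const_mul _
  · rw [integral_indicator measurableSet_Ioc, integral_const_mul,
      ← intervalIntegral.integral_of_le hη.le, integral_rpow (Or.inl (by linarith))]
    rw [sub_add_cancel, Real.zero_rpow hr.ne', sub_zero]

theorem dirConv_localKernel (hη : 0 < η) (hr : 0 < r) (hf : IsTest f) (x : Fin N → ℝ) :
    dirConv (localKernel η r) i f x = dirConv (rlKernel r) i f x
      - (Real.Gamma r)⁻¹ * dirConv (cutKernel₁ η r 0) i f x := by
  obtain ⟨C, -, hC⟩ := hf.exists_bound
  simp only [dirConv]
  rw [← integral_const_mul, ← integral_sub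
    (integrable_dirConv_integrand (integrable_rlKernel hr) hf.continuous hC i x)
    ((integrable_dirConv_integrand (integrable_cutKernel₁ hη r 0) hf.continuous hC i x).const_mul _)]
  congr 1; ext t
  rw [localKernel]; ring

/-- The local kernel inverts the derivative of order `k + s` up to a smoothing operator. -/
theorem dirConv_iterate_partialD_localKernel (hη : 0 < η) {s : ℝ} {k : ℕ}
    (hs1 : s < 1) (hr : 0 < k + s) (hG : IsTest G) {x : Fin N → ℝ} (hx : 0 < x i) :
    dirConv (rlKernel (2 - s)) i
      ((partialD i)^[k + 2] (dirConv (localKernel η (k + s)) i (partialD i G))) x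
    = (-1) ^ k * (partialD i G x + (Real.Gamma (k + s))⁻¹ *
      dirConv (rlKernel (2 - s)) i (dirConv (cutKernel₁ η (k + s) (k + 3)) i G) x) := by
  have hf := hG.partialD i
  have hF := hf.iterate_partialD i (k + 2)
  obtain ⟨C, -, hC⟩ := hF.exists_bound
  obtain ⟨C', -, hC'⟩ := hG.exists_bound
  set r := k + s with hrdef
  have hκ : Integrable (rlKernel (2 - s)) := integrable_rlKernel (by linarith)
  have hI1 := integrable_dirConv_integrand hκ
    (contDiff_dirConv (integrable_rlKernel hr) hF.1 hF.2.1 i).continuous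
    (abs_dirConv_le (integrable_rlKernel hr) hC i) i x
  have hI2 := integrable_dirConv_integrand hκ
    (contDiff_dirConv (integrable_cutKernel₁ hη r (k + 3)) hG.1 hG.2.1 i).continuous
    (abs_dirConv_le (integrable_cutKernel₁ hη r (k + 3)) hC' i) i x
  -- The orders add up to `(2 - s) + (k + s) = k + 2`, which exactly undoes the `k + 2` derivatives.
  have h1 : dirConv (rlKernel (2 - s)) i
      (dirConv (rlKernel r) i ((partialD i)^[k + 2] (partialD i G))) x
      = (-1) ^ k * partialD i G x := by
    rw [dirConv_rlKernel_add (by linarith) hr hF hx,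
      show 2 - s + r = ((k + 1 : ℕ) : ℝ) + 1 by rw [hrdef]; push_cast; ring,
      dirConv_rlKernel_iterate_partialD hx (k + 1) hf]
    rw [pow_succ, pow_succ]
    ring
  rw [iterate_partialD_dirConv (integrable_localKernel hη hr) hf, mul_add, ← h1]
  simp only [← mul_assoc]
  -- All `k + 3` derivatives move to the smooth kernel. Only `t ∈ (0,1]` matters for the outer
  -- convolution, and there the coordinate stays positive.
  have h2 : ∀ t ∈ Ioc (0 : ℝ) 1, dirConv (cutKernel₁ η r 0) i ((partialD i)^[k + 2] (partialD i G))
      (x + t • Pi.single i 1) = -((-1) ^ k *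
        dirConv (cutKernel₁ η r (k + 3)) i G (x + t • Pi.single i 1)) := fun t ht => by
    rw [← Function.iterate_succ_apply, dirConv_cutKernel₁_iterate_partialD hη r _ _ _ hG]
    · rw [zero_add, show k.succ.succ.succ = k + 3 from rfl, pow_add]
      ring
    · have := ht.1
      simp only [Pi.add_apply, Pi.smul_apply, Pi.single_eq_same, smul_eq_mul, mul_one]
      linarith
  have h3 : dirConv (rlKernel (2 - s)) i (dirConv (localKernel η r) i
      ((partialD i)^[k + 2] (partialD i G))) x = ∫ t, (rlKernel (2 - s) t *
        dirConv (rlKernel r) i ((partialD i)^[k + 2] (partialD i G)) (x + t • Pi.single i 1)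
      + (-1) ^ k * (Real.Gamma r)⁻¹ * (rlKernel (2 - s) t *
        dirConv (cutKernel₁ η r (k + 3)) i G (x + t • Pi.single i 1))) := by
    rw [dirConv]
    congr 1; ext t
    rw [dirConv_localKernel hη hr hF]
    by_cases ht : t ∈ Ioc (0 : ℝ) 1
    · rw [h2 t ht]; ring
    · simp [rlKernel, ht]
  rw [h3, integral_add hI1 (hI2.const_mul _), integral_const_mul]
  rfl

theorem integral_abs_rlKernel_le {a : ℝ} (ha : 1 ≤ a) :
    ∫ t, |rlKernel a t| ≤ (Real.Gamma a)⁻¹ := by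
  have hG : 0 < (Real.Gamma a)⁻¹ := inv_pos.2 (Real.Gamma_pos_of_pos (by linarith))
  have e : ∀ t, |rlKernel a t| ≤ (Ioc (0 : ℝ) 1).indicator (fun _ => (Real.Gamma a)⁻¹) t :=
    fun t => by
      by_cases ht : t ∈ Ioc (0 : ℝ) 1
      · simp only [rlKernel, indicator_of_mem ht]
        rw [abs_of_nonneg (mul_nonneg hG.le (Real.rpow_nonneg ht.1.le _))]
        exact mul_le_of_le_one_right hG.le (Real.rpow_le_one ht.1.le ht.2 (by linarith))
      · simp [rlKernel, ht]
  refine (integral_mono (integrable_rlKernel (by linarith)).abs ?_ e).trans_eq ?_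
  · rw [integrable_indicator_iff measurableSet_Ioc]
    exact integrableOn_const (by simp)
  · rw [integral_indicator measurableSet_Ioc]
    simp

theorem exists_inv_Gamma_le {a b : ℝ} (ha : 0 < a) :
    ∃ B, 0 < B ∧ ∀ r ∈ Icc a b, (Real.Gamma r)⁻¹ ≤ B := by
  have hc : ContinuousOn (fun r => (Real.Gamma r)⁻¹) (Icc a b) := fun r hr => by
    have hr0 : 0 < r := ha.trans_le hr.1
    have h1 : ContinuousAt Real.Gamma r := (Real.differentiableAt_Gamma fun m => by
      have : (0 : ℝ) ≤ m := m.cast_nonneg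
      linarith).continuousAt
    exact (h1.inv₀ (Real.Gamma_pos_of_pos hr0).ne').continuousWithinAt
  obtain ⟨B, hB⟩ := isCompact_Icc.exists_bound_of_continuousOn hc
  exact ⟨|B| + 1, by positivity, fun r hr => (le_abs_self _).trans
    ((hB r hr).trans ((le_abs_self _).trans (by linarith)))⟩

end Parametrix

/-! ### Uniform translation estimates. -/

section Translation

variable {N : ℕ} {g : (Fin N → ℝ) → ℝ} {i : Fin N} {δ h : ℝ}

theorem partialD_dirConv_box (hg : IsTest g) (hh : 0 ≤ h) (i : Fin N) (x : Fin N → ℝ) :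
    partialD i (dirConv ((Ioc (-h) 0).indicator fun _ => 1) i g) x
      = g x - g (x - h • Pi.single i 1) := by
  have hInt : Integrable ((Ioc (-h) 0).indicator fun _ : ℝ => (1 : ℝ)) := by
    rw [integrable_indicator_iff measurableSet_Ioc]
    exact integrableOn_const (by simp)
  rw [partialD_dirConv hInt hg, dirConv]
  have e : ∀ t, (Ioc (-h) 0).indicator (fun _ : ℝ => (1 : ℝ)) t *
      partialD i g (x + t • Pi.single i 1)
      = (Ioc (-h) 0).indicator (fun t => partialD i g (x + t • Pi.single i 1)) t := fun t => by
    by_cases ht : t ∈ Ioc (-h) 0 <;> simp [ht]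
  simp_rw [e]
  rw [integral_indicator measurableSet_Ioc, ← intervalIntegral.integral_of_le (by linarith),
    intervalIntegral.integral_eq_sub_of_hasDerivAt (f := fun t => g (x + t • Pi.single i 1))
    (fun t _ => hasDerivAt_line hg.1 x i t)
    (((hg.partialD i).continuous.comp (continuous_line x i)).intervalIntegrable _ _)]
  simp [sub_eq_add_neg]

/-- Uniform equicontinuity under translations in a coordinate direction, tested by functions
supported away from the boundary. -/
theorem exists_translation_bound (hN : 1 ≤ N) {a b C δ ε : ℝ} (ha : 0 < a) (hC : 0 ≤ C)
    (hδ : 0 < δ) (hε : 0 < ε) :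
    ∃ h₀ : ℝ, 0 < h₀ ∧ ∀ u : (Fin N → ℝ) → ℝ, Integrable u (μQ N) → ∫ x in Q N, |u x| ≤ C →
      ∀ r ∈ Icc a b, ∀ p, 1 ≤ p → fracTV p r u ≤ ENNReal.ofReal C →
      ∀ (i : Fin N) (g : (Fin N → ℝ) → ℝ), ContDiff ℝ ∞ g → SuppIn δ g → (∀ x, |g x| ≤ 1) →
      ∀ h ∈ Icc (0 : ℝ) h₀, |∫ x in Q N, u x * (g x - g (x - h • Pi.single i 1))| ≤ ε := by
  obtain ⟨B₁, hB₁, hΓ₁⟩ := exists_inv_Gamma_le (b := b) ha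
  obtain ⟨B₂, hB₂, hΓ₂⟩ := exists_inv_Gamma_le (a := 1) (b := 2) one_pos
  have hlim : Tendsto (fun η : ℝ => N * (B₁ * (η ^ a / a) * 2) * C) (𝓝[>] 0) (𝓝 0) := by
    have h1 : Tendsto (fun η : ℝ => η ^ a) (𝓝[>] 0) (𝓝 0) := by
      have := (Real.continuousAt_rpow_const 0 a (Or.inr ha.le)).tendsto
      rw [Real.zero_rpow ha.ne'] at this
      exact this.mono_left nhdsWithin_le_nhds
    have := ((((h1.div_const a).const_mul B₁).mul_const 2).const_mul (N : ℝ)).mul_const C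
    simpa using this
  -- The scale `η` makes the variation term smaller than `ε / 2` and keeps the support of `ψ` inside
  -- the cube. The error term is handled afterwards by `h`, with constants depending on `η`.
  obtain ⟨η, ⟨hη1, hηδ⟩, hη0, hη⟩ : ∃ η : ℝ, (η < 1 ∧ η < δ / 4) ∧ 0 < η ∧
      N * (B₁ * (η ^ a / a) * 2) * C < ε / 2 := by
    have e1 := hlim.eventually (gt_mem_nhds (half_pos hε))
    have e2 : ∀ᶠ η : ℝ in 𝓝[>] 0, η < 1 := nhdsWithin_le_nhds (gt_mem_nhds one_pos)
    have e3 : ∀ᶠ η : ℝ in 𝓝[>] 0, η < δ / 4 := nhdsWithin_le_nhds (gt_mem_nhds (by positivity))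
    obtain ⟨η, h1, h2, h3, h4⟩ := (e1.and (e2.and (e3.and self_mem_nhdsWithin))).exists
    exact ⟨η, ⟨h2, h3⟩, h4, h1⟩
  -- Up to `k + 3` derivatives fall on the kernel, and `k ≤ ⌊b⌋` for all orders considered.
  obtain ⟨S, hS0, hS⟩ := exists_cutKernel_bound hη0 a b (⌊b⌋₊ + 3)
  -- The first bound leaves room for the support of `G`; the second makes the error at most `ε / 2`,
  -- and its `+ 1` keeps the denominator positive.
  refine ⟨min (δ / 2) (ε / (2 * (B₁ * B₂ * S * C + 1))), by positivity, ?_⟩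
  intro u hu huC r hr p hp hTV i g hg hgs hg1 h hh
  have hr0 : 0 < r := ha.trans_le hr.1
  set k := ⌊r⌋₊ with hk
  set s := r - k with hs
  have hs0 : 0 ≤ s := by
    have := Nat.floor_le hr0.le
    linarith
  have hs1 : s < 1 := sub_floor_lt_one
  have hrks : r = k + s := by rw [hs]; ring
  rw [fracTV_eq_splitTV p rfl] at hTV
  have hh1 : h ≤ δ / 2 := hh.2.trans (min_le_left _ _)
  have hh2 : h * (B₁ * B₂ * S * C) ≤ ε / 2 := by
    have hpos : 0 ≤ B₁ * B₂ * S * C := by positivity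
    have h1 := hh.2.trans (min_le_right _ _)
    rw [le_div_iff₀ (by positivity)] at h1
    nlinarith [hh.1]
  have hgt : IsTest g := hgs.isTest hδ hg
  set box : ℝ → ℝ := (Ioc (-h) 0).indicator fun _ => 1 with hbox
  have hboxint : Integrable box := by
    rw [hbox, integrable_indicator_iff measurableSet_Ioc]
    exact integrableOn_const (by simp)
  have hboxnorm : ∫ t, |box t| = h := by
    have : ∀ t, |box t| = box t := fun t => abs_of_nonneg (indicator_nonneg (by simp) t)
    simp_rw [this]
    rw [hbox, integral_indicator measurableSet_Ioc]
    simp [hh.1]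
  set G := dirConv box i g with hGdef
  have hGs : SuppIn (δ / 2) G := by
    have := hgs.dirConv (K := box) (ρ := δ / 2) (fun t ht => by
      have : t ∈ Ioc (-h) 0 := by
        by_contra hcon
        exact ht (indicator_of_notMem hcon _)
      rw [abs_le]
      constructor <;> linarith [this.1, this.2]) i
    rwa [show δ - δ / 2 = δ / 2 by ring] at this
  have hGt : IsTest G := hGs.isTest (half_pos hδ) (contDiff_dirConv hboxint hgt.1 hgt.2.1 i)
  have hG1 : ∀ x, |G x| ≤ h := fun x => by
    have := abs_dirConv_le hboxint hg1 i x
    rwa [hboxnorm, mul_one] at this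
  have hf : ∀ x, partialD i G x = g x - g (x - h • Pi.single i 1) :=
    partialD_dirConv_box hgt hh.1 i
  have hf2 : ∀ x, |partialD i G x| ≤ 2 := fun x => by
    rw [hf]
    exact (abs_sub _ _).trans (by linarith [hg1 x, hg1 (x - h • Pi.single i 1)])
  have hft : IsTest (partialD i G) := hGt.partialD i
  -- The field entry used for testing: its support margin drops from `δ / 2` to `δ / 4`, and its
  -- size is governed by the mass of the local kernel.
  set ψ := dirConv (localKernel η r) i (partialD i G) with hψ
  have hKint := integrable_localKernel hη0 hr0
  have hψs : SuppIn (δ / 4) ψ := by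
    have := (hGs.partialD i).dirConv (K := localKernel η r) (ρ := δ / 4) (fun t ht => by
      have : t ∈ Ioc 0 η := by
        by_contra hcon
        exact ht (localKernel_eq_zero hη0 hcon)
      rw [abs_le]
      constructor <;> linarith [this.1, this.2]) i
    rwa [show δ / 2 - δ / 4 = δ / 4 by ring] at this
  have hψt : IsTest ψ := hψs.isTest (by positivity) (contDiff_dirConv hKint hft.1 hft.2.1 i)
  have hψA : ∀ x, |ψ x| ≤ B₁ * (η ^ a / a) * 2 := fun x => by
    refine (abs_dirConv_le hKint hf2 i x).trans ?_
    refine mul_le_mul_of_nonneg_right ((integral_abs_localKernel_le hη0 hr0).trans ?_) zero_le_two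
    have h1 : η ^ r ≤ η ^ a := Real.rpow_le_rpow_of_exponent_ge hη0 hη1.le hr.1
    have h2 := hΓ₁ r hr
    have h3 := hr.1
    gcongr
  have hmain := abs_integral_le_of_splitTV_le hN hp hs0 hs1 hC hTV hψt (by positivity) hψA i
  set E : (Fin N → ℝ) → ℝ := fun x => (Real.Gamma r)⁻¹ *
      dirConv (rlKernel (2 - s)) i (dirConv (cutKernel₁ η r (k + 3)) i G) x with hE
  have hΓr : 0 < (Real.Gamma r)⁻¹ := inv_pos.2 (Real.Gamma_pos_of_pos hr0)
  have hcutint := integrable_cutKernel₁ hη0 r (k + 3)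
  have hkb : k + 3 ≤ ⌊b⌋₊ + 3 := by
    have := Nat.floor_le_floor hr.2
    omega
  have hE1 : ∀ x, |E x| ≤ h * (B₁ * B₂ * S) := fun x => by
    have h1 : ∀ y, |dirConv (cutKernel₁ η r (k + 3)) i G y| ≤ S * h := fun y =>
      (abs_dirConv_le hcutint hG1 i y).trans (mul_le_mul_of_nonneg_right
        (integral_abs_cutKernel₁_le hη0 fun t ht => hS _ hkb r hr t ht) hh.1)
    have h2 := abs_dirConv_le (integrable_rlKernel (a := 2 - s) (by linarith)) h1 i x
    have h3 : ∫ t, |rlKernel (2 - s) t| ≤ B₂ :=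
      (integral_abs_rlKernel_le (by linarith)).trans (hΓ₂ _ ⟨by linarith, by linarith⟩)
    rw [hE, abs_mul, abs_of_pos hΓr]
    have hSh : 0 ≤ S * h := mul_nonneg hS0 hh.1
    calc (Real.Gamma r)⁻¹ * _ ≤ B₁ * (B₂ * (S * h)) := by
          refine mul_le_mul (hΓ₁ r hr) (h2.trans (mul_le_mul_of_nonneg_right h3 hSh))
            (abs_nonneg _) hB₁.le
      _ = h * (B₁ * B₂ * S) := by ring
  have hcutc : ContDiff ℝ ∞ (dirConv (cutKernel₁ η r (k + 3)) i G) :=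
    contDiff_dirConv hcutint hGt.1 hGt.2.1 i
  have hcuts : HasCompactSupport (dirConv (cutKernel₁ η r (k + 3)) i G) := by
    have := hGs.dirConv (K := cutKernel₁ η r (k + 3)) (ρ := 1) (fun t ht => by
      have : t ∈ Ioc (0 : ℝ) 1 := by
        by_contra hcon
        exact ht (indicator_of_notMem hcon _)
      rw [abs_le]
      constructor <;> linarith [this.1, this.2]) i
    exact isCompact_Icc.of_isClosed_subset (isClosed_tsupport _) this.tsupport_subset
  have hEc : Continuous E := continuous_const.mul
    (contDiff_dirConv (integrable_rlKernel (by linarith)) hcutc hcuts i).continuous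
  -- The operator of order `r` applied to `ψ` returns the difference of translates up to `E`, so the
  -- variation bound for `ψ` controls the translation.
  have hX : ∀ x ∈ Q N, dirConv (rlKernel (2 - s)) i ((partialD i)^[k + 2] ψ) x
      = (-1) ^ k * (partialD i G x + E x) := fun x hx => by
    have := dirConv_iterate_partialD_localKernel (η := η) (s := s) (k := k) hη0 hs1
      (by rw [← hrks]; exact hr0) hGt (mem_Q_pos hx i)
    rw [← hrks] at this
    exact this
  have hI1 : Integrable (fun x => u x * partialD i G x) (μQ N) :=
    hu.mul_bdd hft.continuous.aestronglyMeasurable (Eventually.of_forall hf2)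
  have hI2 : Integrable (fun x => u x * E x) (μQ N) :=
    hu.mul_bdd hEc.aestronglyMeasurable (Eventually.of_forall hE1)
  have e1 : ∫ x in Q N, u x * dirConv (rlKernel (2 - s)) i ((partialD i)^[k + 2] ψ) x
      = (-1) ^ k * ((∫ x in Q N, u x * partialD i G x) + ∫ x in Q N, u x * E x) := by
    rw [← integral_add hI1 hI2, ← integral_const_mul]
    refine setIntegral_congr_fun measurableSet_Q fun x hx => ?_
    simp only [hX x hx]
    ring
  rw [e1, abs_mul, abs_pow, abs_neg, abs_one, one_pow, one_mul] at hmain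
  have hE2 : |∫ x in Q N, u x * E x| ≤ ε / 2 := by
    calc |∫ x in Q N, u x * E x| ≤ ∫ x in Q N, |u x| * (h * (B₁ * B₂ * S)) := by
          refine norm_integral_le_of_norm_le (f := fun x => u x * E x) (hu.abs.mul_const _)
            (Eventually.of_forall fun x => ?_)
          rw [norm_mul]
          exact mul_le_mul_of_nonneg_left (hE1 x) (abs_nonneg _)
      _ = (∫ x in Q N, |u x|) * (h * (B₁ * B₂ * S)) := integral_mul_const _ _
      _ ≤ C * (h * (B₁ * B₂ * S)) := by
          have := hh.1
          gcongr
      _ = h * (B₁ * B₂ * S * C) := by ring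
      _ ≤ ε / 2 := hh2
  simp_rw [← hf]
  rw [abs_le] at hmain hE2 ⊢
  constructor <;> linarith [hmain.1, hmain.2, hE2.1, hE2.2]

end Translation

/-! ### Recovering the `L^1` norm from smooth test functions. -/

section Duality

variable {N : ℕ} {w : (Fin N → ℝ) → ℝ} {δ η : ℝ}

/-- The closed cube `[δ, 1-δ]^N`. -/
def innerCube (N : ℕ) (δ : ℝ) : Set (Fin N → ℝ) := Icc (fun _ => δ) (fun _ => 1 - δ)

theorem measurableSet_innerCube : MeasurableSet (innerCube N δ) := measurableSet_Icc

theorem innerCube_subset_Q (hδ : 0 < δ) : innerCube N δ ⊆ Q N := fun _ hx j _ =>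
  ⟨hδ.trans_le (hx.1 j), (hx.2 j).trans_lt (by linarith)⟩

theorem abs_convolution_normed_le (φ : ContDiffBump (0 : Fin N → ℝ)) {f : (Fin N → ℝ) → ℝ}
    (hf1 : ∀ x, |f x| ≤ 1) (x : Fin N → ℝ) :
    |(convolution (φ.normed volume) f (ContinuousLinearMap.lsmul ℝ ℝ) volume) x| ≤ 1 := by
  simp only [convolution_def, ContinuousLinearMap.lsmul_apply, smul_eq_mul]
  refine (norm_integral_le_of_norm_le (f := fun t => φ.normed volume t * f (x - t))
    (φ.integrable_normed (μ := volume)) (Eventually.of_forall fun t => ?_)).trans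
    φ.integral_normed.le
  rw [norm_mul, Real.norm_eq_abs, Real.norm_eq_abs, abs_of_nonneg (φ.nonneg_normed t)]
  exact mul_le_of_le_one_right (φ.nonneg_normed t) (hf1 _)

theorem suppIn_convolution_normed (φ : ContDiffBump (0 : Fin N → ℝ)) {f : (Fin N → ℝ) → ℝ}
    (hφ : φ.rOut ≤ δ) (hf : SuppIn (2 * δ) f) :
    SuppIn δ (convolution (φ.normed volume) f (ContinuousLinearMap.lsmul ℝ ℝ) volume) := by
  intro x hx j
  obtain ⟨t, ht⟩ : ∃ t, φ.normed volume t * f (x - t) ≠ 0 := by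
    by_contra! hcon
    exact hx (by simp [convolution_def, hcon])
  have h1 : t ∈ Function.support (φ.normed volume) := left_ne_zero_of_mul ht
  rw [φ.support_normed_eq, mem_ball_zero_iff] at h1
  have h2 := hf _ (right_ne_zero_of_mul ht) j
  have h3 := abs_le.1 ((norm_le_pi_norm t j).trans (h1.le.trans hφ))
  simp only [Pi.sub_apply] at h2
  constructor <;> linarith [h3.1, h3.2]

/-- The `L¹` norm on an inner cube is controlled by testing with smooth functions. -/
theorem integral_abs_le_of_forall_smooth (hw : Integrable w (μQ N)) (hδ : 0 < δ)
    (h : ∀ g : (Fin N → ℝ) → ℝ, ContDiff ℝ ∞ g → SuppIn δ g → (∀ x, |g x| ≤ 1) →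
      ∫ x in Q N, w x * g x ≤ η) :
    ∫ x in innerCube N (2 * δ), |w x| ≤ η := by
  classical
  -- A measurable representative makes the sign function `f` measurable; mollifications of `f` are
  -- the test functions.
  set w' := hw.aestronglyMeasurable.mk w with hw'
  have hw'm : Measurable w' := hw.aestronglyMeasurable.stronglyMeasurable_mk.measurable
  have hw'e : w =ᵐ[μQ N] w' := hw.aestronglyMeasurable.ae_eq_mk
  set f : (Fin N → ℝ) → ℝ :=
    (innerCube N (2 * δ)).indicator fun x => if 0 ≤ w' x then 1 else -1 with hf
  have hfm : Measurable f := (Measurable.ite (measurableSet_le measurable_const hw'm)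
    measurable_const measurable_const).indicator measurableSet_innerCube
  have hf1 : ∀ x, |f x| ≤ 1 := fun x => by
    simp only [hf, indicator_apply]
    split_ifs <;> simp
  have hfs : SuppIn (2 * δ) f := fun x hx j => by
    have : x ∈ innerCube N (2 * δ) := by
      by_contra hcon
      exact hx (indicator_of_notMem hcon _)
    exact ⟨this.1 j, this.2 j⟩
  have hfl : LocallyIntegrable f volume :=
    (locallyIntegrable_const (1 : ℝ)).mono hfm.aestronglyMeasurable
      (Eventually.of_forall fun x => by simpa using hf1 x)
  -- The outer radii stay below `δ`, so mollification costs at most half of the margin `2 δ`. Their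
  -- fixed ratio 2 to the inner radii gives almost everywhere convergence at Lebesgue points.
  let φ : ℕ → ContDiffBump (0 : Fin N → ℝ) := fun n =>
    ⟨δ / (n + 2), 2 * (δ / (n + 2)), by positivity, by
      have : 0 < δ / ((n : ℝ) + 2) := by positivity
      linarith⟩
  have hφδ : ∀ n, (φ n).rOut ≤ δ := fun n => by
    change 2 * (δ / ((n : ℝ) + 2)) ≤ δ
    rw [← mul_div_assoc, div_le_iff₀ (by positivity)]
    nlinarith [(Nat.cast_nonneg n : (0 : ℝ) ≤ n)]
  have hφ0 : Tendsto (fun n => (φ n).rOut) atTop (𝓝 0) := by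
    have h1 : Tendsto (fun n : ℕ => (n : ℝ) + 2) atTop atTop :=
      tendsto_atTop_add_const_right _ _ tendsto_natCast_atTop_atTop
    simpa using (h1.const_div_atTop δ).const_mul 2
  have hconv := ContDiffBump.ae_convolution_tendsto_right_of_locallyIntegrable (K := 2) hφ0
    (Eventually.of_forall fun n => le_rfl) hfl
  set g : ℕ → (Fin N → ℝ) → ℝ := fun n =>
    convolution ((φ n).normed volume) f (ContinuousLinearMap.lsmul ℝ ℝ) volume with hg
  have hgc : ∀ n, ContDiff ℝ ∞ (g n) := fun n =>
    (φ n).hasCompactSupport_normed.contDiff_convolution_left _ (φ n).contDiff_normed hfl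
  have hg1 : ∀ n x, |g n x| ≤ 1 := fun n x => abs_convolution_normed_le (φ n) hf1 x
  have hlim : Tendsto (fun n => ∫ x in Q N, w x * g n x) atTop (𝓝 (∫ x in Q N, w x * f x)) := by
    refine tendsto_integral_of_dominated_convergence (fun x => |w x|)
      (fun n => hw.aestronglyMeasurable.mul (hgc n).continuous.aestronglyMeasurable) hw.abs
      (fun n => Eventually.of_forall fun x => ?_) ?_
    · rw [norm_mul]
      exact mul_le_of_le_one_right (abs_nonneg _) (hg1 n x)
    · filter_upwards [ae_restrict_of_ae hconv] with x hx using hx.const_mul _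
  have heq : ∫ x in innerCube N (2 * δ), |w x| = ∫ x in Q N, w x * f x := by
    have e : (fun x => w x * f x) =ᵐ[μQ N] (innerCube N (2 * δ)).indicator fun x => |w x| := by
      filter_upwards [hw'e] with x hx
      simp only [hf, indicator_apply, ← hx]
      split_ifs with h1 h2
      · rw [abs_of_nonneg h2, mul_one]
      · rw [abs_of_neg (not_le.1 h2)]; ring
      · simp
    rw [integral_congr_ae e, integral_indicator measurableSet_innerCube,
      Measure.restrict_restrict measurableSet_innerCube,
      inter_eq_left.2 (innerCube_subset_Q (by positivity))]
  rw [heq]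
  exact le_of_tendsto' hlim fun n =>
    h _ (hgc n) (suppIn_convolution_normed (φ n) (hφδ n) hfs) (hg1 n)

end Duality

/-! ### From weak to strong convergence. -/

section Compactness

variable {N : ℕ} {u : ℕ → (Fin N → ℝ) → ℝ} {v w g ρ : (Fin N → ℝ) → ℝ} {δ ε h : ℝ}

theorem SuppIn.translate (hg : SuppIn δ g) {y : Fin N → ℝ} (hy : ∀ j, y j ∈ Icc 0 h) :
    SuppIn (δ - h) fun x => g (x - y) := fun x hx j => by
  have h1 := hg _ hx j
  have h2 := hy j
  simp only [Pi.sub_apply] at h1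
  constructor <;> linarith [h1.1, h1.2, h2.1, h2.2]

/-- Translation estimates in the coordinate directions add up. -/
theorem abs_integral_translate_le (hw : Integrable w (μQ N)) (hg : ContDiff ℝ ∞ g)
    (hgs : SuppIn δ g) (hg1 : ∀ x, |g x| ≤ 1) (hh : 0 ≤ h)
    (H : ∀ (i : Fin N) (g : (Fin N → ℝ) → ℝ), ContDiff ℝ ∞ g → SuppIn (δ - h) g →
      (∀ x, |g x| ≤ 1) → ∀ t ∈ Icc 0 h,
        |∫ x in Q N, w x * (g x - g (x - t • Pi.single i 1))| ≤ ε)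
    {y : Fin N → ℝ} (hy : ∀ j, y j ∈ Icc 0 h) :
    |∫ x in Q N, w x * (g x - g (x - y))| ≤ N * ε := by
  classical
  -- One coordinate is moved at a time. Each step uses the directional estimate for an already
  -- translated test function, whose margin is still at least `δ - h`.
  have key : ∀ S : Finset (Fin N),
      |∫ x in Q N, w x * (g x - g (x - ∑ i ∈ S, Pi.single i (y i)))| ≤ S.card * ε := by
    intro S
    induction S using Finset.induction_on with
    | empty => simp
    | insert i S hi ih =>
      set z : Fin N → ℝ := ∑ i ∈ S, Pi.single i (y i) with hz
      have hzj : ∀ j, z j ∈ Icc 0 h := fun j => by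
        have : z j = if j ∈ S then y j else 0 := by
          simp [hz, Finset.sum_apply, Pi.single_apply]
        rw [this]
        split_ifs
        exacts [hy j, ⟨le_rfl, hh⟩]
      set g' : (Fin N → ℝ) → ℝ := fun x => g (x - z) with hg'
      have hg'c : ContDiff ℝ ∞ g' := hg.comp (contDiff_id.sub contDiff_const)
      have h1 := H i g' hg'c (hgs.translate hzj) (fun x => hg1 _) (y i) (hy i)
      have hInt : ∀ f₁ f₂ : (Fin N → ℝ) → ℝ, Continuous f₁ → Continuous f₂ →
          (∀ x, |f₁ x| ≤ 1) → (∀ x, |f₂ x| ≤ 1) →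
          Integrable (fun x => w x * (f₁ x - f₂ x)) (μQ N) := fun f₁ f₂ h₁ h₂ b₁ b₂ =>
        hw.mul_bdd (c := 2) (h₁.sub h₂).aestronglyMeasurable (Eventually.of_forall fun x => by
          rw [Real.norm_eq_abs]
          exact (abs_sub _ _).trans (by linarith [b₁ x, b₂ x]))
      have e : ∀ x, w x * (g x - g (x - ∑ i ∈ insert i S, Pi.single i (y i)))
          = w x * (g x - g' x) + w x * (g' x - g' (x - y i • Pi.single i 1)) := fun x => by
        have : x - ∑ i ∈ insert i S, Pi.single i (y i) = x - y i • Pi.single i 1 - z := by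
          rw [Finset.sum_insert hi, ← Pi.single_smul, smul_eq_mul, mul_one]
          abel
        simp only [hg', this]
        ring
      simp_rw [e]
      have i1 := hInt _ _ hg.continuous hg'c.continuous hg1 fun x => hg1 _
      have i2 : Integrable (fun x => w x * (g' x - g' (x - y i • Pi.single i 1))) (μQ N) :=
        hInt _ (fun x => g' (x - y i • Pi.single i 1)) hg'c.continuous
          (hg'c.continuous.comp (by fun_prop)) (fun x => hg1 _) fun x => hg1 _
      rw [integral_add i1 i2, Finset.card_insert_of_notMem hi]
      refine (abs_add_le _ _).trans ?_
      push_cast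
      linarith [ih, h1]
  simpa [Finset.univ_sum_single] using key Finset.univ

/-- Splitting a test function into an oscillation and a mollification. -/
theorem abs_integral_le_of_translate (hw : Integrable w (μQ N)) (hg : Continuous g)
    (hgs : SuppIn δ g) (hδ : 0 < δ) (hg1 : ∀ x, |g x| ≤ 1)
    (hρ : Continuous ρ) (hρ0 : ∀ x, 0 ≤ ρ x) (hρi : Integrable ρ) (hρ1 : ∫ x, ρ x = 1)
    {B : ℝ} (hρB : ∀ x, |ρ x| ≤ B)
    (H : ∀ y, ρ y ≠ 0 → |∫ x in Q N, w x * (g x - g (x - y))| ≤ ε) :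
    |∫ x in Q N, w x * g x| ≤ ε + ∫ z in Q N, |∫ x in Q N, w x * ρ (x - z)| := by
  have hgm : ∀ x, ∫ y, ρ y * g (x - y) = ∫ z in Q N, ρ (x - z) * g z := fun x => by
    rw [setIntegral_eq_integral_of_forall_compl_eq_zero, ← integral_sub_left_eq_self _ volume x]
    · simp
    · intro z hz
      by_cases h0 : g z = 0
      · rw [h0, mul_zero]
      · exact absurd (innerCube_subset_Q hδ ⟨fun j => (hgs z h0 j).1, fun j => (hgs z h0 j).2⟩) hz
  have hρg : ∀ x, Integrable fun y => ρ y * g (x - y) := fun x =>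
    hρi.mul_bdd (c := 1) (hg.comp (by fun_prop)).aestronglyMeasurable
      (Eventually.of_forall fun y => hg1 _)
  have hF : Integrable (Function.uncurry fun x y => w x * ρ y * (g x - g (x - y)))
      ((μQ N).prod volume) :=
    (hw.mul_prod hρi).mul_bdd (c := 2)
      (Continuous.aestronglyMeasurable (f := fun z : (Fin N → ℝ) × (Fin N → ℝ) =>
        g z.1 - g (z.1 - z.2)) (by fun_prop))
      (Eventually.of_forall fun z => by
        rw [Real.norm_eq_abs]
        exact (abs_sub _ _).trans (by linarith [hg1 z.1, hg1 (z.1 - z.2)]))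
  have hG : Integrable (Function.uncurry fun x z => w x * (ρ (x - z) * g z))
      ((μQ N).prod (μQ N)) := by
    have := (hw.mul_prod (integrable_const (μ := μQ N) (1 : ℝ))).mul_bdd (c := B)
      (Continuous.aestronglyMeasurable (f := fun z : (Fin N → ℝ) × (Fin N → ℝ) =>
        ρ (z.1 - z.2) * g z.2) (by fun_prop))
      (Eventually.of_forall fun z => by
        rw [norm_mul]
        exact (mul_le_of_le_one_right (norm_nonneg _) (hg1 _)).trans (hρB _))
    simpa [Function.uncurry_def] using this
  -- Since `ρ` has mass 1, `g = ∫ ρ(y) (g - g(· - y)) dy + ρ ∗ g`; the second term is written with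
  -- the kernel `ρ(x - z)` so that Fubini's theorem moves `ρ` onto `w`.
  have e : ∀ x, w x * g x = (∫ y, w x * ρ y * (g x - g (x - y)))
      + ∫ z in Q N, w x * (ρ (x - z) * g z) := fun x => by
    rw [integral_const_mul, ← hgm]
    have : ∀ y, w x * ρ y * (g x - g (x - y)) = w x * (ρ y * g x - ρ y * g (x - y)) :=
      fun y => by ring
    simp_rw [this]
    rw [integral_const_mul, integral_sub (hρi.mul_const _) (hρg x), integral_mul_const, hρ1]
    ring
  have h1 : |∫ x in Q N, ∫ y, w x * ρ y * (g x - g (x - y))| ≤ ε := by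
    rw [integral_integral_swap hF]
    have : ∀ y, ‖∫ x in Q N, w x * ρ y * (g x - g (x - y))‖ ≤ ρ y * ε := fun y => by
      have e : ∀ x, w x * ρ y * (g x - g (x - y)) = ρ y * (w x * (g x - g (x - y))) :=
        fun x => by ring
      simp_rw [e]
      rw [integral_const_mul, norm_mul, Real.norm_eq_abs, abs_of_nonneg (hρ0 y)]
      by_cases h0 : ρ y = 0
      · simp [h0]
      · exact mul_le_mul_of_nonneg_left (H y h0) (hρ0 y)
    refine (norm_integral_le_of_norm_le (hρi.mul_const ε) (Eventually.of_forall this)).trans ?_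
    rw [integral_mul_const, hρ1, one_mul]
  have h2 : |∫ x in Q N, ∫ z in Q N, w x * (ρ (x - z) * g z)|
      ≤ ∫ z in Q N, |∫ x in Q N, w x * ρ (x - z)| := by
    have e : ∀ z, ∫ x in Q N, w x * (ρ (x - z) * g z)
        = (∫ x in Q N, w x * ρ (x - z)) * g z := fun z => by
      rw [← integral_mul_const]
      simp_rw [mul_assoc]
    have hG' : Integrable (Function.uncurry fun x z => w x * ρ (x - z))
        ((μQ N).prod (μQ N)) := by
      have := (hw.mul_prod (integrable_const (μ := μQ N) (1 : ℝ))).mul_bdd (c := B)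
        (Continuous.aestronglyMeasurable (f := fun z : (Fin N → ℝ) × (Fin N → ℝ) =>
          ρ (z.1 - z.2)) (by fun_prop)) (Eventually.of_forall fun z => hρB _)
      simpa [Function.uncurry_def] using this
    rw [integral_integral_swap hG]
    simp_rw [e]
    refine norm_integral_le_of_norm_le (f := fun z => (∫ x in Q N, w x * ρ (x - z)) * g z)
      hG'.integral_prod_right.abs (Eventually.of_forall fun z => ?_)
    rw [norm_mul]
    exact mul_le_of_le_one_right (norm_nonneg _) (hg1 z)
  simp_rw [e]
  have hF' : Integrable (fun x => ∫ y, w x * ρ y * (g x - g (x - y))) (μQ N) :=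
    hF.integral_prod_left
  have hG' : Integrable (fun x => ∫ z in Q N, w x * (ρ (x - z) * g z)) (μQ N) :=
    hG.integral_prod_left
  rw [integral_add hF' hG']
  exact (abs_add_le _ _).trans (add_le_add h1 h2)

/-- Weak convergence becomes strong, uniformly in space, after mollification. -/
theorem WeakL1.tendsto_mollified (hW : WeakL1 atTop u v) (hv : Integrable v (μQ N))
    (hρ : Continuous ρ) {B : ℝ} (hρB : ∀ x, |ρ x| ≤ B) :
    Tendsto (fun n => ∫ z in Q N, |∫ x in Q N, (u n x - v x) * ρ (x - z)|) atTop (𝓝 0) := by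
  obtain ⟨A, hA⟩ := hW.bdd
  have hB : 0 ≤ B := (abs_nonneg _).trans (hρB 0)
  have hρz : ∀ z, Continuous fun x => ρ (x - z) := fun z => hρ.comp (by fun_prop)
  have hbd : ∀ f, Integrable f (μQ N) → ∀ z, Integrable (fun x => f x * ρ (x - z)) (μQ N) :=
    fun f hf z => hf.mul_bdd (hρz z).aestronglyMeasurable (Eventually.of_forall fun x => hρB _)
  have hle : ∀ n z, |∫ x in Q N, (u n x - v x) * ρ (x - z)| ≤ (A + ∫ x in Q N, |v x|) * B := by
    intro n z
    have hi := ((hW.int n).sub hv).abs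
    refine (norm_integral_le_of_norm_le (f := fun x => (u n x - v x) * ρ (x - z))
      (hi.mul_const B) (Eventually.of_forall fun x => ?_)).trans ?_
    · rw [norm_mul]
      exact mul_le_mul_of_nonneg_left (hρB _) (abs_nonneg _)
    · rw [integral_mul_const]
      refine mul_le_mul_of_nonneg_right ?_ hB
      refine (integral_mono hi ((hW.int n).abs.add hv.abs) fun x => abs_sub _ _).trans ?_
      simp only [Pi.add_apply]
      rw [integral_add (hW.int n).abs hv.abs]
      gcongr
      exact hA n
  have h0 : ∫ z in Q N, (0 : ℝ) = 0 := by simp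
  rw [← h0]
  -- For fixed `z`, the translate of `ρ` is a bounded continuous test function for the weak
  -- convergence; the uniform bound is integrable on the cube.
  refine tendsto_integral_of_dominated_convergence (fun _ => (A + ∫ x in Q N, |v x|) * B)
    (fun n => ?_) (integrable_const _) (fun n => Eventually.of_forall fun z => ?_)
    (Eventually.of_forall fun z => ?_)
  · have hG' : Integrable (Function.uncurry fun x z => (u n x - v x) * ρ (x - z))
        ((μQ N).prod (μQ N)) := by
      have := (((hW.int n).sub hv).mul_prod (integrable_const (μ := μQ N) (1 : ℝ))).mul_bdd (c := B)
        (Continuous.aestronglyMeasurable (f := fun z : (Fin N → ℝ) × (Fin N → ℝ) =>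
          ρ (z.1 - z.2)) (by fun_prop)) (Eventually.of_forall fun z => hρB _)
      simpa [Function.uncurry_def] using this
    exact hG'.integral_prod_right.abs.aestronglyMeasurable
  · rw [Real.norm_eq_abs, abs_abs]
    exact hle n z
  · have := hW.lim _ (hρz z) ⟨B, fun x => hρB _⟩
    have h2 := (this.sub_const (∫ x in Q N, v x * ρ (x - z))).abs
    rw [sub_self, abs_zero] at h2
    refine h2.congr fun n => ?_
    rw [← integral_sub (hbd _ (hW.int n) z) (hbd _ hv z)]
    simp_rw [sub_mul]

/-- Compactness: a bound on the total variations of orders bounded away from `0` turns weak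
convergence into strong convergence, provided no mass concentrates at the boundary. -/
theorem WeakL1.tendsto_integral_abs_sub (hN : 1 ≤ N) (hW : WeakL1 atTop u v)
    (hv : Integrable v (μQ N)) {a b C : ℝ} (ha : 0 < a) {r : ℕ → ℝ} (hr : ∀ n, r n ∈ Icc a b)
    {m : ℕ → ℝ≥0∞} (hm : ∀ n, 1 ≤ m n) (huC : ∀ n, ∫ x in Q N, |u n x| ≤ C)
    (hTV : ∀ n, fracTV (m n) (r n) (u n) ≤ ENNReal.ofReal C)
    (hbd : ∀ ε > 0, ∃ δ > 0, ∀ n, ∫ x in Q N \ innerCube N (2 * δ), |u n x - v x| ≤ ε) :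
    Tendsto (fun n => ∫ x in Q N, |u n x - v x|) atTop (𝓝 0) := by
  have hC : 0 ≤ C := (integral_nonneg fun x => abs_nonneg _).trans (huC 0)
  have hwi : ∀ n, Integrable (fun x => u n x - v x) (μQ N) := fun n => (hW.int n).sub hv
  have key : ∀ ε > 0, ∃ e : ℕ → ℝ, Tendsto e atTop (𝓝 0) ∧
      ∀ n, ∫ x in Q N, |u n x - v x| ≤ (2 * N + 1) * ε + e n := by
    intro ε hε
    obtain ⟨δ, hδ, hδε⟩ := hbd ε hε
    obtain ⟨h₀, hh₀, H⟩ := exists_translation_bound (b := b) hN ha hC (half_pos hδ) hε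
    set h := min h₀ (δ / 2) with hh
    have hhpos : 0 < h := lt_min hh₀ (half_pos hδ)
    -- The mollifier is centred at `(h/2,…,h/2)`, so its support lies in `[0,h]^N` and only
    -- nonnegative translations occur.
    let φ : ContDiffBump (fun _ : Fin N => h / 2) := ⟨h / 4, h / 2, by positivity, by linarith⟩
    set ρ := φ.normed volume with hρ
    have hρs : ∀ y, ρ y ≠ 0 → ∀ j, y j ∈ Icc 0 h := fun y hy j => by
      have h1 : y ∈ Function.support (φ.normed volume) := hy
      rw [φ.support_normed_eq, mem_ball_iff_norm] at h1
      have h2 := abs_le.1 ((norm_le_pi_norm _ j).trans h1.le)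
      have h3 : φ.rOut = h / 2 := rfl
      simp only [Pi.sub_apply, h3] at h2
      constructor <;> linarith [h2.1, h2.2]
    obtain ⟨B, hB⟩ := φ.continuous_normed.bounded_above_of_compact_support
      (φ.hasCompactSupport_normed (μ := volume))
    refine ⟨_, hW.tendsto_mollified hv (φ.continuous_normed (μ := volume)) hB, fun n => ?_⟩
    have hin := integral_abs_le_of_forall_smooth
      (η := N * ε + N * ε + ∫ z in Q N, |∫ x in Q N, (u n x - v x) * ρ (x - z)|) (hwi n) hδ
      fun g hg hgs hg1 => by
        refine (le_abs_self _).trans (abs_integral_le_of_translate (hwi n) hg.continuous hgs hδ hg1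
          φ.continuous_normed φ.nonneg_normed φ.integrable_normed φ.integral_normed hB
          fun y hy => ?_)
        have hT : ∀ n, |∫ x in Q N, u n x * (g x - g (x - y))| ≤ N * ε := fun n =>
          abs_integral_translate_le (hW.int n) hg hgs hg1 hhpos.le
            (fun i g' hg' hgs' hg1' t ht => H (u n) (hW.int n) (huC n) (r n) (hr n) (m n) (hm n)
              (hTV n) i g' hg' (fun x hx j => by
                have := hgs' x hx j
                have h2 := min_le_right h₀ (δ / 2)
                constructor <;> linarith [this.1, this.2]) hg1' t
              ⟨ht.1, ht.2.trans (min_le_left _ _)⟩) (hρs y hy)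
        have hgy : Continuous fun x => g x - g (x - y) :=
          hg.continuous.sub (hg.continuous.comp (by fun_prop))
        have hgb : ∀ x, |g x - g (x - y)| ≤ 2 := fun x =>
          (abs_sub _ _).trans (by linarith [hg1 x, hg1 (x - y)])
        -- The weak limit inherits the translation bound.
        have hTv : |∫ x in Q N, v x * (g x - g (x - y))| ≤ N * ε :=
          le_of_tendsto' (hW.lim _ hgy ⟨2, hgb⟩).abs hT
        have hi : ∀ f, Integrable f (μQ N) →
            Integrable (fun x => f x * (g x - g (x - y))) (μQ N) := fun f hf =>
          hf.mul_bdd hgy.aestronglyMeasurable (Eventually.of_forall hgb)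
        simp_rw [sub_mul (u n _) (v _)]
        rw [integral_sub (hi _ (hW.int n)) (hi _ hv)]
        exact (abs_sub _ _).trans (add_le_add (hT n) hTv)
    have hsplit : ∫ x in Q N, |u n x - v x| = (∫ x in innerCube N (2 * δ), |u n x - v x|)
        + ∫ x in Q N \ innerCube N (2 * δ), |u n x - v x| := by
      have hsub : innerCube N (2 * δ) ⊆ Q N := innerCube_subset_Q (by positivity)
      rw [← setIntegral_union disjoint_sdiff_right (measurableSet_Q.diff measurableSet_innerCube)
        ((hwi n).abs.mono_measure (Measure.restrict_mono hsub le_rfl))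
        ((hwi n).abs.mono_measure (Measure.restrict_mono sdiff_subset le_rfl)),
        union_sdiff_cancel hsub]
    rw [hsplit]
    linarith [hin, hδε n]
  rw [Metric.tendsto_atTop]
  intro ε hε
  -- The constant collects `N ε` from `u n`, `N ε` from `v` and `ε` from the boundary layer.
  obtain ⟨e, he, hle⟩ := key (ε / (2 * (2 * N + 1))) (by positivity)
  obtain ⟨n₀, hn₀⟩ := eventually_atTop.1 (he.eventually (gt_mem_nhds (half_pos hε)))
  refine ⟨n₀, fun n hn => ?_⟩
  rw [Real.dist_0_eq_abs, abs_of_nonneg (integral_nonneg fun x => abs_nonneg _)]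
  have h1 : (2 * (N : ℝ) + 1) * (ε / (2 * (2 * N + 1))) = ε / 2 := by field_simp
  have h2 := hle n
  rw [h1] at h2
  linarith [hn₀ n hn]

end Compactness

/-! ### No concentration at the boundary. -/

section Boundary

variable {N : ℕ} {q K : ℝ≥0∞} {ε : ℝ}

theorem tendsto_volume_sdiff_innerCube :
    Tendsto (fun δ : ℝ => volume (Q N \ innerCube N (2 * δ))) (𝓝[>] 0) (𝓝 0) := by
  have h1 : Tendsto (fun δ : ℝ => 1 - ENNReal.ofReal (1 - 2 * δ - 2 * δ) ^ N) (𝓝[>] 0) (𝓝 0) := by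
    have : Tendsto (fun δ : ℝ => ENNReal.ofReal (1 - 2 * δ - 2 * δ) ^ N) (𝓝[>] 0) (𝓝 1) := by
      have hc : Continuous fun δ : ℝ => ENNReal.ofReal (1 - 2 * δ - 2 * δ) ^ N :=
        (ENNReal.continuous_pow N).comp (ENNReal.continuous_ofReal.comp (by fun_prop))
      have := hc.tendsto 0
      simp only [mul_zero, sub_zero, ENNReal.ofReal_one, one_pow] at this
      exact this.mono_left nhdsWithin_le_nhds
    simpa using ENNReal.Tendsto.sub tendsto_const_nhds this (Or.inl ENNReal.one_ne_top)
  refine h1.congr' ?_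
  filter_upwards [self_mem_nhdsWithin] with δ hδ
  have hδ : (0 : ℝ) < δ := hδ
  have hsub : innerCube N (2 * δ) ⊆ Q N := innerCube_subset_Q (by positivity)
  have hvol : volume (innerCube N (2 * δ)) = ENNReal.ofReal (1 - 2 * δ - 2 * δ) ^ N := by
    rw [innerCube, Real.volume_Icc_pi]
    simp
  rw [measure_sdiff hsub measurableSet_innerCube.nullMeasurableSet
    ((measure_mono hsub).trans_lt (by simp [volume_Q])).ne, volume_Q, hvol]

/-- A bound in `L^q`, `q > 1`, prevents concentration at the boundary. -/
theorem exists_integral_boundary_le (hq : 1 < q) (hK : K ≠ ⊤) (hε : 0 < ε) :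
    ∃ δ > 0, ∀ f : (Fin N → ℝ) → ℝ, AEStronglyMeasurable f (μQ N) → eLpNorm f q (μQ N) ≤ K →
      ∫ x in Q N \ innerCube N (2 * δ), |f x| ≤ ε := by
  -- The Hölder exponent `1 - 1/q` is positive exactly because `q > 1`. For `q = ∞` the conventions
  -- `⊤.toReal = 0` and `1 / 0 = 0` give the correct value 1.
  have he : 0 < 1 / (1 : ℝ≥0∞).toReal - 1 / q.toReal := by
    rw [ENNReal.toReal_one, div_one, sub_pos]
    rcases eq_or_ne q ⊤ with rfl | hqt
    · simp
    · have : 1 < q.toReal := by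
        rw [← ENNReal.toReal_one]
        exact (ENNReal.toReal_lt_toReal ENNReal.one_ne_top hqt).2 hq
      rw [div_lt_one (by linarith)]
      exact this
  have hlim : Tendsto (fun δ : ℝ => K * volume (Q N \ innerCube N (2 * δ)) ^
      (1 / (1 : ℝ≥0∞).toReal - 1 / q.toReal)) (𝓝[>] 0) (𝓝 0) := by
    have := ENNReal.Tendsto.const_mul (a := K)
      ((ENNReal.continuous_rpow_const
        (y := 1 / (1 : ℝ≥0∞).toReal - 1 / q.toReal)).tendsto _ |>.comp (tendsto_volume_sdiff_innerCube (N := N)))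
      (Or.inr hK)
    rw [ENNReal.zero_rpow_of_pos he, mul_zero] at this
    exact this
  obtain ⟨δ, h1, hδ⟩ := ((hlim.eventually (gt_mem_nhds (ENNReal.ofReal_pos.2 hε))).and
    self_mem_nhdsWithin).exists
  refine ⟨δ, hδ, fun f hf hfK => ?_⟩
  have hle : volume.restrict (Q N \ innerCube N (2 * δ)) ≤ μQ N :=
    Measure.restrict_mono sdiff_subset le_rfl
  have hf' := hf.mono_measure hle
  have h2 := eLpNorm_le_eLpNorm_mul_rpow_measure_univ hq.le hf'
  rw [Measure.restrict_apply_univ] at h2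
  have h3 : eLpNorm f 1 (volume.restrict (Q N \ innerCube N (2 * δ))) ≤ ENNReal.ofReal ε :=
    h2.trans ((mul_le_mul_left ((eLpNorm_mono_measure f hle).trans hfK) _).trans h1.le)
  rw [eLpNorm_one_eq_lintegral_enorm] at h3
  simp_rw [← Real.norm_eq_abs]
  rw [integral_norm_eq_lintegral_enorm hf']
  exact ENNReal.toReal_le_of_le_ofReal hε.le h3

theorem integral_abs_le_toReal_eLpNorm (hq : 1 ≤ q) (hK : K ≠ ⊤) {f : (Fin N → ℝ) → ℝ}
    (hf : AEStronglyMeasurable f (μQ N)) (hfK : eLpNorm f q (μQ N) ≤ K) :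
    ∫ x in Q N, |f x| ≤ K.toReal := by
  simp_rw [← Real.norm_eq_abs]
  rw [integral_norm_eq_lintegral_enorm hf, ← eLpNorm_one_eq_lintegral_enorm]
  exact ENNReal.toReal_mono hK ((eLpNorm_le_eLpNorm_of_exponent_le hq hf).trans hfK)

end Boundary

/-! ### Assembling the theorem. -/

section Main

variable {N : ℕ} {q K : ℝ≥0∞} {u : ℕ → (Fin N → ℝ) → ℝ} {v : (Fin N → ℝ) → ℝ} {r : ℕ → ℝ} {r₀ : ℝ}
  {m : ℕ → ℝ≥0∞}

theorem WeakConv.weakL1 (h : WeakConv q u v) (hq : 1 < q) (hK : K ≠ ⊤)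
    (hu : ∀ n, eLpNorm (u n) q (μQ N) ≤ K) : WeakL1 atTop u v where
  int n := (h.1 n).integrable hq.le
  bdd := ⟨K.toReal, fun n => integral_abs_le_toReal_eLpNorm hq.le hK (h.1 n).1 (hu n)⟩
  lim g hg hgB := by
    obtain ⟨B, hB⟩ := hgB
    refine h.2.2 (1 - q⁻¹)⁻¹ ?_ g (MemLp.of_bound hg.aestronglyMeasurable B
      (Eventually.of_forall hB))
    rw [inv_inv]
    exact add_tsub_cancel_of_le (ENNReal.inv_le_one.2 hq.le)

/-- Semicontinuity is applied with a constant exponent `p`, after replacing the exponents `m n` by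
`p` at a bounded cost. -/
theorem WeakL1.mem_BVr (h : WeakL1 atTop u v) (hN : 1 ≤ N) (hv : Integrable v (μQ N))
    (hr : ∀ n, 0 < r n) (hr₀ : 0 ≤ r₀) (hlimr : Tendsto r atTop (𝓝 r₀)) (hm : ∀ n, 1 ≤ m n)
    (hK : K ≠ ⊤) (hTV : ∀ n, fracTV (m n) (r n) (u n) ≤ K) : v ∈ BVr N r₀ := by
  refine ⟨hv, fun p hp => ?_⟩
  -- Changing the exponent costs `N^(⌊r n⌋ + 1)`, which this constant bounds once `r n < r₀ + 1`. A
  -- single such index suffices for the contradiction.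
  set B : ℝ≥0∞ := ENNReal.ofReal ((N : ℝ) ^ (⌊r₀ + 1⌋₊ + 1)) * K with hB
  have hBt : B < ⊤ := ENNReal.mul_lt_top ENNReal.ofReal_lt_top hK.lt_top
  refine lt_of_le_of_lt (not_lt.1 fun hlt => ?_) hBt
  have h1 := h.eventually_lt_fracTV hN (P := fun _ => p) (fun _ => hp) hp tendsto_const_nhds hr hr₀
    hlimr hlt
  obtain ⟨n, hn, hrn⟩ := (h1.and (hlimr.eventually (gt_mem_nhds (lt_add_one r₀)))).exists
  refine absurd hn (not_lt.2 ((fracTV_le_mul hN (hm n) hp (r n) (u n)).trans ?_))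
  have hN' : (1 : ℝ) ≤ N := by exact_mod_cast hN
  have hfl : ⌊r n⌋₊ + 1 ≤ ⌊r₀ + 1⌋₊ + 1 := by
    have := Nat.floor_le_floor hrn.le
    omega
  exact mul_le_mul' (ENNReal.ofReal_le_ofReal (pow_le_pow_right₀ hN' hfl)) (hTV n)

theorem WeakConv.tendsto_eLpNorm_sub (h : WeakConv q u v) (hN : 1 ≤ N) (hq : 1 < q)
    (hr₀ : 0 < r₀) (hlimr : Tendsto r atTop (𝓝 r₀)) (hm : ∀ n, 1 ≤ m n)
    (hK : K ≠ ⊤) (hu : ∀ n, eLpNorm (u n) q (μQ N) ≤ K)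
    (hTV : ∀ n, fracTV (m n) (r n) (u n) ≤ K) :
    Tendsto (fun n => eLpNorm (u n - v) 1 (μQ N)) atTop (𝓝 0) := by
  have hW := h.weakL1 hq hK hu
  have hv : Integrable v (μQ N) := h.2.1.integrable hq.le
  -- From `n₀` on the orders lie in `[r₀/2, r₀ + 1]`, a compact subset of `(0,∞)`; the sequence is
  -- shifted accordingly.
  obtain ⟨n₀, hn₀⟩ := eventually_atTop.1 (hlimr.eventually
    (Icc_mem_nhds (half_lt_self hr₀) (lt_add_one r₀)))
  have hshift : Tendsto (fun n => n + n₀) atTop atTop := tendsto_add_atTop_nat n₀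
  have hW' : WeakL1 atTop (fun n => u (n + n₀)) v :=
    ⟨fun n => hW.int _, hW.bdd.imp fun A hA n => hA _, fun g hg hgB => (hW.lim g hg hgB).comp hshift⟩
  have hL : K + eLpNorm v q (μQ N) ≠ ⊤ := ENNReal.add_ne_top.2 ⟨hK, h.2.1.2.ne⟩
  have hmain := hW'.tendsto_integral_abs_sub hN hv (half_pos hr₀) (r := fun n => r (n + n₀))
    (fun n => hn₀ _ (Nat.le_add_left _ _)) (m := fun n => m (n + n₀)) (fun n => hm _)
    (fun n => integral_abs_le_toReal_eLpNorm hq.le hK (h.1 _).1 (hu _))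
    (fun n => (hTV _).trans (ENNReal.ofReal_toReal hK).ge) fun ε hε => by
      obtain ⟨δ, hδ, H⟩ := exists_integral_boundary_le (N := N) hq hL hε
      exact ⟨δ, hδ, fun n => H (u (n + n₀) - v) ((h.1 _).1.sub h.2.1.1)
        ((eLpNorm_sub_le (h.1 _).1 h.2.1.1 hq.le).trans (add_le_add_left (hu _) _))⟩
  rw [← tendsto_add_atTop_iff_nat n₀]
  have h2 := ENNReal.tendsto_ofReal hmain
  rw [ENNReal.ofReal_zero] at h2
  refine h2.congr fun n => ?_
  rw [eLpNorm_one_eq_lintegral_enorm, ← ofReal_integral_norm_eq_lintegral_enorm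
    ((hW.int _).sub hv)]
  rfl

theorem exists_strictMono_tendsto_liminf (f : ℕ → ℝ≥0∞) :
    ∃ σ : ℕ → ℕ, StrictMono σ ∧ Tendsto (fun n => f (σ n)) atTop (𝓝 (liminf f atTop)) := by
  obtain ⟨x, hx, hxt⟩ := exists_seq_tendsto_liminf (f := atTop) (u := f)
  obtain ⟨φ, hφ, hxφ⟩ := strictMono_subseq_of_tendsto_atTop hxt
  exact ⟨x ∘ φ, hxφ, hx.comp hφ.tendsto_atTop⟩

theorem le_of_eventually_lt_of_tendsto {f : ℕ → ℝ≥0∞} {a L : ℝ≥0∞}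
    (hf : Tendsto f atTop (𝓝 L)) (h : ∀ y < a, ∀ᶠ n in atTop, y < f n) : a ≤ L :=
  le_of_forall_lt_imp_le_of_dense fun y hy => ge_of_tendsto hf ((h y hy).mono fun _ hn => hn.le)

/-- Lower semicontinuity of the mixed total variation implies that of the fractional one. -/
theorem fracTV_le_liminf_of_mixedTV_le (hN : 1 ≤ N) {p : ℕ → ℝ≥0∞} (hp : ∀ n, 1 ≤ p n) {p₀ : ℝ≥0∞}
    (hp₀ : 1 ≤ p₀) (hlimp : Tendsto p atTop (𝓝 p₀)) (hlimr : Tendsto r atTop (𝓝 r₀))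
    (h : mixedTV p₀ r₀ v ≤ liminf (fun n => mixedTV (p n) (r n) (u n)) atTop) :
    fracTV p₀ r₀ v ≤ liminf (fun n => fracTV (p n) (r n) (u n)) atTop := by
  by_cases hInt : ∃ k : ℕ, r₀ = k
  · obtain ⟨k, rfl⟩ := hInt
    have hc : Tendsto (fun n => ENNReal.ofReal (intRatio N (p n))) atTop
        (𝓝 (ENNReal.ofReal (intRatio N p₀))) :=
      ENNReal.tendsto_ofReal (tendsto_intRatio hN hp₀ hlimp)
    -- The factor at `p₀` is the limit of the factors at `p n`, and each of these times the mixed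
    -- variation is at most the fractional one, at integer and non-integer orders alike.
    rw [fracTV_natCast hN hp₀, ← mixedTV_natCast, ← hc.liminf_eq]
    exact (mul_le_mul_right h _).trans (ENNReal.le_liminf_mul.trans
      (liminf_le_liminf (Eventually.of_forall fun n => intRatio_mul_mixedTV_le hN (hp n) _ _)))
  · push Not at hInt
    rw [mixedTV_of_ne hInt] at h
    refine h.trans (liminf_congr ?_).le
    -- The naturals are closed in the reals, so orders close to a non-integer limit are non-integers
    -- and both variations agree.
    have ho : IsOpen (range ((↑) : ℕ → ℝ))ᶜ :=
      Nat.isClosedEmbedding_coe_real.isClosed_range.isOpen_compl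
    filter_upwards [hlimr.eventually (ho.mem_nhds fun ⟨k, hk⟩ => hInt k hk.symm)] with n hn
    exact mixedTV_of_ne (fun k hk => hn ⟨k, hk.symm⟩) _

theorem exists_weakConv_subseq (hq : 1 < q) (hK : K ≠ ⊤)
    (hu : ∀ n, AEStronglyMeasurable (u n) (μQ N)) (huK : ∀ n, eLpNorm (u n) q (μQ N) ≤ K)
    (σ : ℕ → ℕ) :
    ∃ (v : (Fin N → ℝ) → ℝ) (τ : ℕ → ℕ), StrictMono τ ∧ WeakConv q (fun n => u (σ (τ n))) v := by
  obtain ⟨v, τ, hτ, hv, hlim⟩ := exists_weakly_convergent_subseq hq (fun n => hu (σ n)) hK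
    fun n => huK (σ n)
  exact ⟨v, τ, hτ, fun n => ⟨hu _, (huK _).trans_lt hK.lt_top⟩, hv, hlim⟩

end Main

end FracTV

end

theorem theorem4p10 (N : ℕ) (hN : 1 ≤ N)
    (r : ℕ → ℝ) (hr : ∀ n, 0 < r n) (r₀ : ℝ) (hr₀ : 0 ≤ r₀) (hlimr : Tendsto r atTop (𝓝 r₀))
    (p : ℕ → ℝ≥0∞) (hp : ∀ n, 1 ≤ p n) (p₀ : ℝ≥0∞) (hp₀ : 1 ≤ p₀)
    (hlimp : Tendsto p atTop (𝓝 p₀))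
    (u : ℕ → (Fin N → ℝ) → ℝ) (hu : ∀ n, IntegrableOn (u n) (FracTV.Q N))
    (q : ℝ≥0∞) (hq : 1 < q)
    -- the norms `ℓ^{m n}` underlying the total variations in the bound are arbitrary
    (m : ℕ → ℝ≥0∞) (hm : ∀ n, 1 ≤ m n)
    (hbound : (⨆ n, (eLpNorm (u n) q (FracTV.μQ N) + FracTV.fracTV (m n) (r n) (u n))) < ⊤) :
    ∃ (v : (Fin N → ℝ) → ℝ) (σ : ℕ → ℕ), StrictMono σ ∧
      v ∈ FracTV.BVr N r₀ ∧
      FracTV.WeakConv q (fun n => u (σ n)) v ∧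
      FracTV.fracTV p₀ r₀ v ≤ liminf (fun n => FracTV.fracTV (p n) (r n) (u n)) atTop ∧
      ((N = 1 ∨ p₀ = 1 ∨ (∀ k : ℕ, r₀ ≠ k) ∨ ∀ᶠ n in atTop, r n ≤ r₀) →
        FracTV.mixedTV p₀ r₀ v ≤ liminf (fun n => FracTV.mixedTV (p n) (r n) (u n)) atTop) ∧
      (0 < r₀ → (∃ M : ℝ, ∀ n, u n ∈ FracTV.IM N M ∩ FracTV.SVr N (r n)) →
        Tendsto (fun n => eLpNorm (u (σ n) - v) 1 (FracTV.μQ N)) atTop (𝓝 0)) := by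
  have hK := hbound.ne
  have huK := fun n => (le_self_add (a := eLpNorm (u n) q (FracTV.μQ N))).trans
    (le_iSup (fun n => eLpNorm (u n) q (FracTV.μQ N) + FracTV.fracTV (m n) (r n) (u n)) n)
  have hTV := fun n => (le_add_self (a := FracTV.fracTV (m n) (r n) (u n))).trans
    (le_iSup (fun n => eLpNorm (u n) q (FracTV.μQ N) + FracTV.fracTV (m n) (r n) (u n)) n)
  have hum := fun n => (hu n).aestronglyMeasurable
  -- Both lower bounds concern the full sequence but the same limit `v`, so the subsequence must
  -- realize the right lower limit. Under the extra condition it realizes that of the mixed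
  -- variation, from which the fractional bound follows. Otherwise only the fractional bound is
  -- claimed, and its lower limit is realized instead.
  by_cases hcond : N = 1 ∨ p₀ = 1 ∨ (∀ k : ℕ, r₀ ≠ k) ∨ ∀ᶠ n in atTop, r n ≤ r₀
  · obtain ⟨σ, hσ, hσlim⟩ := FracTV.exists_strictMono_tendsto_liminf
      fun n => FracTV.mixedTV (p n) (r n) (u n)
    obtain ⟨v, τ, hτ, hv⟩ := FracTV.exists_weakConv_subseq hq hK hum huK σ
    have hW := hv.weakL1 hq hK fun n => huK _
    have ht : Tendsto (fun n => σ (τ n)) atTop atTop := (hσ.comp hτ).tendsto_atTop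
    have hmixed : FracTV.mixedTV p₀ r₀ v
        ≤ liminf (fun n => FracTV.mixedTV (p n) (r n) (u n)) atTop :=
      FracTV.le_of_eventually_lt_of_tendsto (hσlim.comp hτ.tendsto_atTop) fun y hy =>
        hW.eventually_lt_mixedTV hN (P := fun n => p (σ (τ n))) (r := fun n => r (σ (τ n)))
          (fun n => hp _) hp₀ (hlimp.comp ht) (fun n => hr _) hr₀ (hlimr.comp ht)
          (hcond.imp_right (Or.imp_right (Or.imp_right fun h => ht.eventually h))) hy
    exact ⟨v, fun n => σ (τ n), hσ.comp hτ,
      hW.mem_BVr hN (hv.2.1.integrable hq.le) (fun n => hr _) hr₀ (hlimr.comp ht) (fun n => hm _)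
        hK (fun n => hTV _), hv,
      FracTV.fracTV_le_liminf_of_mixedTV_le hN hp hp₀ hlimp hlimr hmixed, fun _ => hmixed,
      fun hr₀' _ => hv.tendsto_eLpNorm_sub hN hq hr₀' (hlimr.comp ht) (fun n => hm _) hK
        (fun n => huK _) (fun n => hTV _)⟩
  · obtain ⟨σ, hσ, hσlim⟩ := FracTV.exists_strictMono_tendsto_liminf
      fun n => FracTV.fracTV (p n) (r n) (u n)
    obtain ⟨v, τ, hτ, hv⟩ := FracTV.exists_weakConv_subseq hq hK hum huK σ
    have hW := hv.weakL1 hq hK fun n => huK _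
    have ht : Tendsto (fun n => σ (τ n)) atTop atTop := (hσ.comp hτ).tendsto_atTop
    exact ⟨v, fun n => σ (τ n), hσ.comp hτ,
      hW.mem_BVr hN (hv.2.1.integrable hq.le) (fun n => hr _) hr₀ (hlimr.comp ht) (fun n => hm _)
        hK (fun n => hTV _), hv,
      FracTV.le_of_eventually_lt_of_tendsto (hσlim.comp hτ.tendsto_atTop) fun y hy =>
        hW.eventually_lt_fracTV hN (P := fun n => p (σ (τ n))) (r := fun n => r (σ (τ n)))
          (fun n => hp _) hp₀ (hlimp.comp ht) (fun n => hr _) hr₀ (hlimr.comp ht) hy,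
      fun h => absurd h hcond,
      fun hr₀' _ => hv.tendsto_eLpNorm_sub hN hq hr₀' (hlimr.comp ht) (fun n => hm _) hK
        (fun n => huK _) (fun n => hTV _)⟩
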